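/- Let $m\ge n\ge 1$ be integers, $K$ a field, and let $S=K[x_1,\dots,x_{m+n},y_1,\dots,y_{m+n}]$ with the standard grading and the lexicographic order induced by $x_1>\dots>x_{m+n}>y_1>\dots>y_{m+n}$. Let $G=K_{m,n}$ be the complete bipartite graph on the vertex set $\{1,\dots,m\}\cup\{m+1,\dots,m+n\}$, let $J_G=(x_iy_j-x_jy_i : \{i,j\}\in E(G))\subset S$ be its binomial edge ideal, and let $\operatorname{in}_<(J_G)$ be its initial ideal. For a finitely generated graded $S$-module $M$ let $\beta_{i,j}(M)$ be the number of generators of degree $j$ in homological degree $i$ of a minimal graded free resolution of $M$; call $\beta_{i,i+j}(M)$ extremal if $\beta_{i,i+j}(M)\ne 0$ and $\beta_{k,k+l}(M)=0$ for all $(k,l)\neq(i,j)$ with $k\ge i$, $l\ge j$. Put $p=m$ if $n=1$ and $p=2m+n-2$ if $n>1$. Then: (a) $\operatorname{pd} S/\operatorname{in}_<(J_G)=\operatorname{pd}\operatorname{in}_<(J_G)+1=p=\operatorname{pd} S/J_G$. (b) If $m\ge 2$, then each of $S/\operatorname{in}_<(J_G)$ and $S/J_G$ has a unique extremal Betti number,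 namely the one at position $(p,p+2)$, and $$\beta_{p,p+2}(S/\operatorname{in}_<(J_G))=\beta_{p-1,p+2}(\operatorname{in}_<(J_G))=\beta_{p,p+2}(S/J_G)=\begin{cases} m-1,& n=1,\\ n-1,& m>n>1,\\ 2(n-1),& m=n>1.\end{cases}$$ -/

import Mathlib

open MvPolynomial

namespace BinomialEdge

section Ideals

/-- The variables `x_v`, `y_v` (`v ∈ V`) are indexed by the lexicographic sum `V ⊕ₗ V`,
so that all the `x_v` come before all the `y_v`, each block in the order of `V`. -/
abbrev Vars (V : Type) : Type := V ⊕ₗ V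

instance (V : Type) [LinearOrder V] [Finite V] : WellFoundedGT (Vars V) :=
  haveI : Finite (Vars V) := inferInstanceAs (Finite (V ⊕ V))
  inferInstance

/-- The polynomial ring `S = K[x_v, y_v : v ∈ V]`. -/
abbrev PolyRing (K : Type*) [Field K] (V : Type) := MvPolynomial (Vars V) K

variable (K : Type*) [Field K] {V : Type}

/-- The variable `x_v`. -/
noncomputable def x (v : V) : PolyRing K V := X (Sum.inlₗ v)

/-- The variable `y_v`. -/
noncomputable def y (v : V) : PolyRing K V := X (Sum.inrₗ v)

/-- The binomial edge ideal `J_G = (x_i y_j - x_j y_i : {i, j} ∈ E(G), i < j)`. -/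
noncomputable def binomialEdgeIdeal [LinearOrder V] (G : SimpleGraph V) : Ideal (PolyRing K V) :=
  Ideal.span {f | ∃ i j : V, i < j ∧ G.Adj i j ∧ f = x K i * y K j - x K j * y K i}

variable {K}

/-- The initial ideal of `I` for the lexicographic order with
`x_1 > x_2 > ⋯ > y_1 > y_2 > ⋯`: in Mathlib's `MonomialOrder.lex` a variable with a smaller
index is larger. -/
noncomputable def initialIdeal [LinearOrder V] [Finite V] (I : Ideal (PolyRing K V)) :
    Ideal (PolyRing K V) :=
  Ideal.span
    ((MonomialOrder.lex : MonomialOrder (Vars V)).leadingTerm '' (I : Set (PolyRing K V)))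

end Ideals

/-- The complete bipartite graph `K_{m,n}` on `m + n` linearly ordered vertices, the first part
being the first `m` vertices and the second part the last `n` vertices. -/
def completeBipartite (m n : ℕ) : SimpleGraph (Fin (m + n)) :=
  (completeBipartiteGraph (Fin m) (Fin n)).map finSumFinEquiv.toEmbedding

section Betti

variable {σ K : Type*} [Field K]

/-- The grading of `S ⧸ I` induced by the standard grading of `S`, for a homogeneous ideal `I`. -/
noncomputable def quotientGrading (I : Ideal (MvPolynomial σ K)) (j : ℕ) :
    Submodule K (MvPolynomial σ K ⧸ I) :=
  (homogeneousSubmodule σ K j).map (Ideal.Quotient.mkₐ K I).toLinearMap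

/-- The grading of a homogeneous ideal `I` induced by the standard grading of `S`. -/
noncomputable def idealGrading (I : Ideal (MvPolynomial σ K)) (j : ℕ) : Submodule K I :=
  (homogeneousSubmodule σ K j).comap (I.subtype.restrictScalars K)

/-- A minimal graded free resolution
`⋯ ⟶ F_2 ⟶ F_1 ⟶ F_0 ⟶ M ⟶ 0` of a graded `S`-module `M` with graded components `𝓜 j`,
where `S = K[X_s : s ∈ σ]` has the standard grading. The module `F_i` is `⨁_k S(-deg i k)`,
with one basis element of degree `deg i k` for each `k < rank i`. -/
structure MinimalGradedFreeResolution {M : Type*} [AddCommGroup M] [Module K M]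
    [Module (MvPolynomial σ K) M] (𝓜 : ℕ → Submodule K M) where
  /-- the rank of `F_i` -/
  rank : ℕ → ℕ
  /-- the degrees of the basis elements of `F_i` -/
  deg : ∀ i, Fin (rank i) → ℕ
  /-- the differential `F_{i+1} ⟶ F_i` -/
  d : ∀ i, (Fin (rank (i + 1)) → MvPolynomial σ K) →ₗ[MvPolynomial σ K]
    (Fin (rank i) → MvPolynomial σ K)
  /-- the augmentation `F_0 ⟶ M` -/
  ε : (Fin (rank 0) → MvPolynomial σ K) →ₗ[MvPolynomial σ K] M
  /-- the augmentation has degree `0` -/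
  ε_homogeneous : ∀ k, ε (Pi.single k 1) ∈ 𝓜 (deg 0 k)
  /-- the differentials have degree `0` -/
  d_homogeneous : ∀ i k l, d i (Pi.single k 1) l = 0 ∨
    ∃ e, e + deg i l = deg (i + 1) k ∧ (d i (Pi.single k 1) l).IsHomogeneous e
  /-- minimality: the entries of the differentials lie in the ideal generated by the variables -/
  minimal : ∀ i k l, constantCoeff (d i (Pi.single k 1) l) = 0
  /-- exactness at `M` -/
  ε_surjective : Function.Surjective ε
  /-- exactness at `F_0` -/
  exact_zero : Function.Exact (d 0) ε
  /-- exactness at `F_{i+1}` -/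
  exact_succ : ∀ i, Function.Exact (d (i + 1)) (d i)

open Classical in
/-- The graded Betti number `β_{i,j}(M)`: the number of basis elements of degree `j` in
homological degree `i` of a minimal graded free resolution of `M`. (For a finitely generated
graded module such a resolution exists and the number does not depend on it.) -/
noncomputable def gradedBetti {M : Type*} [AddCommGroup M] [Module K M]
    [Module (MvPolynomial σ K) M] (𝓜 : ℕ → Submodule K M) (i j : ℕ) : ℕ :=
  if h : Nonempty (MinimalGradedFreeResolution (σ := σ) 𝓜) then
    Fintype.card {k : Fin (h.some.rank i) // h.some.deg i k = j}
  else 0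

/-- `β_{i,j}(S ⧸ I)` for a homogeneous ideal `I`. -/
noncomputable def bettiQuotient (I : Ideal (MvPolynomial σ K)) (i j : ℕ) : ℕ :=
  gradedBetti (σ := σ) (quotientGrading I) i j

/-- `β_{i,j}(I)` for a homogeneous ideal `I`. -/
noncomputable def bettiIdeal (I : Ideal (MvPolynomial σ K)) (i j : ℕ) : ℕ :=
  gradedBetti (σ := σ) (idealGrading I) i j

/-- For a table `β` of graded Betti numbers, `β_{i,i+j}` is extremal: it is nonzero, and
`β_{k,k+l} = 0` for all `(k, l) ≠ (i, j)` with `k ≥ i` and `l ≥ j`. -/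
def IsExtremalBetti (β : ℕ → ℕ → ℕ) (i j : ℕ) : Prop :=
  β i (i + j) ≠ 0 ∧
    ∀ k l, i ≤ k → j ≤ l → (k, l) ≠ (i, j) → β k (k + l) = 0

end Betti

section ProjectiveDimension

universe u

/-- The projective dimension of an `R`-module. -/
noncomputable def projdim (R : Type u) [CommRing R] (M : Type u) [AddCommGroup M] [Module R M] :
    WithBot ℕ∞ :=
  CategoryTheory.projectiveDimension (ModuleCat.of R M)

end ProjectiveDimension

end BinomialEdge

/-! Let `A`, `B` be the two parts of the vertex set and `G` the binomial edge ideal. For a set `W`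
of vertices let `I_W` be the ideal of 2-minors of the generic matrix with columns `(x_v, y_v)`, `v ∈
W`, and `P_W` the ideal generated by these variables. The quotient `S/G` is filtered by `G ⊆ G + I_A
⊆ G + I_A + I_B = I_{A ∪ B}`. A three-term identity gives `P_B I_A ⊆ G`; moreover `G ⊆ P_B`, and
`I_A ∩ P_B = P_B I_A` because the generators of `I_A` do not involve `B`. Hence `(G + I_A)/G ≅ I_A /
P_B I_A`, and in the same way the next quotient is `I_B / P_A I_B`.

The Betti numbers of `S/I_W` are those of the Eagon–Northcott complex: a linear resolution of length
`|W| - 1` whose last Betti number is `|W| - 1`. So `I_A` is generated in degree 2 with a linear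
resolution, and the `2n` variables of `B`, being regular on it, lengthen that resolution without
changing its last Betti number. The two subquotients live in row 2 and end in homological degrees `m
+ 2n - 2` and `2m + n - 2` with last Betti numbers `m - 1` and `n - 1`; `S/I_{A ∪ B}` lives in rows
0 and 1 and is too short to interfere. The corner of the table is therefore the sum of what ends at
`p`: the second piece if `m > n > 1`, both if `m = n > 1`, and the first if `n = 1`, since then `I_B
= 0`. For `m = n = 1` only `S/I_{A ∪ B}` is left.

For the initial ideal the same filtration works with `I_W` replaced by `(x_i y_j : i < j in W)`,
which has the same Betti data. So `tor_of_glue` is stated for abstract ideals and used twice. The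
other main ingredients are `initialIdeal_genericBipartite` (the initial ideal),
`hasShape_genericIdeal` and `hasShape_monoIdeal` (the Betti data of the pieces),
`gradedBetti_eq_tor` (Betti numbers are dimensions of Koszul homology, which has long exact
sequences), and `GradedExact.tor_of_smul` (the effect of a regular variable). -/

open CategoryTheory

universe u

namespace BinomialEdge

/-! ### Contraction, exterior multiplication and the Koszul differential -/

section KoszulOperators

variable {σ : Type} [LinearOrder σ] {K : Type u} [Field K]
  {M : Type u} [AddCommGroup M] [Module (MvPolynomial σ K) M]

/-- The sign with which the variable `s` is inserted in the wedge product indexed by `A`. -/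
def koszulSign (s : σ) (A : Finset σ) : ℤ := (-1) ^ (A.filter (· < s)).card

theorem koszulSign_insert {s t : σ} {A : Finset σ} (ht : t ∉ A) :
    koszulSign s (insert t A) = if t < s then -koszulSign s A else koszulSign s A := by
  unfold koszulSign
  rw [Finset.filter_insert]
  split_ifs with h
  · rw [Finset.card_insert_of_notMem (by simp [ht]), pow_succ]; ring
  · rfl

theorem koszulSign_mul_self (s : σ) (A : Finset σ) : koszulSign s A * koszulSign s A = 1 := by
  unfold koszulSign
  rw [← mul_pow]; simp

theorem koszulSign_insert_self (s : σ) (A : Finset σ) :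
    koszulSign s (insert s A) = koszulSign s A := by
  by_cases h : s ∈ A
  · rw [Finset.insert_eq_of_mem h]
  · rw [koszulSign_insert h, if_neg (lt_irrefl s)]

/-- Of the two variables exactly one precedes the other, so exactly one of the two signs changes. -/
theorem koszulSign_insert_mul {s t : σ} (hst : s ≠ t) {A : Finset σ} (hs : s ∉ A) (ht : t ∉ A) :
    koszulSign s A * koszulSign t (insert s A) = -(koszulSign t A * koszulSign s (insert t A)) := by
  rw [koszulSign_insert hs, koszulSign_insert ht]
  rcases lt_or_gt_of_ne hst with h | h
  · rw [if_pos h, if_neg h.not_gt]; ring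
  · rw [if_neg h.not_gt, if_pos h]; ring

variable (K M) in
/-- Contraction with the dual basis vector of `s` on the exterior algebra with coefficients
in `M`. -/
def contraction (s : σ) : (Finset σ → M) →ₗ[MvPolynomial σ K] (Finset σ → M) where
  toFun z A := if s ∈ A then 0 else koszulSign s A • z (insert s A)
  map_add' z w := by ext A; by_cases h : s ∈ A <;> simp [h]
  map_smul' r z := by ext A; by_cases h : s ∈ A <;> simp [h, smul_comm r]

variable (K M) in
/-- Exterior multiplication with the basis vector of `s`. -/
def wedge (s : σ) : (Finset σ → M) →ₗ[MvPolynomial σ K] (Finset σ → M) where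
  toFun z A := if s ∈ A then koszulSign s A • z (A.erase s) else 0
  map_add' z w := by ext A; by_cases h : s ∈ A <;> simp [h]
  map_smul' r z := by ext A; by_cases h : s ∈ A <;> simp [h, smul_comm r]

theorem contraction_apply (s : σ) (z : Finset σ → M) (A : Finset σ) :
    contraction K M s z A = if s ∈ A then 0 else koszulSign s A • z (insert s A) := rfl

theorem wedge_apply (s : σ) (z : Finset σ → M) (A : Finset σ) :
    wedge K M s z A = if s ∈ A then koszulSign s A • z (A.erase s) else 0 := rfl

theorem contraction_contraction_self (s : σ) (z : Finset σ → M) :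
    contraction K M s (contraction K M s z) = 0 := by
  ext A
  simp [contraction_apply]

theorem contraction_contraction (s t : σ) (z : Finset σ → M) :
    contraction K M s (contraction K M t z) = -contraction K M t (contraction K M s z) := by
  by_cases hst : s = t
  · subst hst; simp [contraction_contraction_self]
  ext A
  by_cases hs : s ∈ A
  · simp [contraction_apply, hs]
  by_cases ht : t ∈ A
  · simp [contraction_apply, ht]
  simp only [contraction_apply, hs, ht, Finset.mem_insert, hst, Ne.symm hst, or_self, if_false,
    Pi.neg_apply, smul_smul, ← neg_smul, koszulSign_insert_mul hst hs ht,
    Finset.insert_comm s t]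

theorem contraction_wedge_self (s : σ) (z : Finset σ → M) :
    contraction K M s (wedge K M s z) + wedge K M s (contraction K M s z) = z := by
  ext A
  by_cases hs : s ∈ A
  · have h := koszulSign_insert_self s (A.erase s)
    rw [Finset.insert_erase hs] at h
    simp [contraction_apply, wedge_apply, hs, smul_smul, Finset.insert_erase hs, ← h,
      koszulSign_mul_self]
  · simp [contraction_apply, wedge_apply, hs, smul_smul, koszulSign_insert_self,
      koszulSign_mul_self]

theorem contraction_wedge {s t : σ} (hst : s ≠ t) (z : Finset σ → M) :
    contraction K M s (wedge K M t z) + wedge K M t (contraction K M s z) = 0 := by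
  ext A
  by_cases hs : s ∈ A
  · simp [contraction_apply, wedge_apply, hs, hst]
  by_cases ht : t ∈ A
  · obtain ⟨B, hB, rfl⟩ : ∃ B, t ∉ B ∧ A = insert t B :=
      ⟨A.erase t, Finset.notMem_erase t A, (Finset.insert_erase ht).symm⟩
    have hsB : s ∉ B := fun h => hs (Finset.mem_insert_of_mem h)
    have htB : t ∉ insert s B := by simp [hB, Ne.symm hst]
    -- This is `koszulSign_insert_mul` multiplied by signs whose squares are 1.
    have key : koszulSign s (insert t B) * koszulSign t (insert s B) =
        -(koszulSign t B * koszulSign s B) := by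
      have h1 := koszulSign_insert_mul hst hsB hB
      have h2 := koszulSign_mul_self s B
      have h3 := koszulSign_mul_self s (insert t B)
      have : koszulSign t (insert s B) =
          -(koszulSign s B * koszulSign t B * koszulSign s (insert t B)) := by
        linear_combination koszulSign s B * h1 - koszulSign t (insert s B) * h2
      rw [this]
      linear_combination (-koszulSign s B * koszulSign t B) * h3
    simp [contraction_apply, wedge_apply, hs, smul_smul, koszulSign_insert_self,
      Finset.insert_comm s t B, hB, hsB, htB, key]
  · simp [contraction_apply, wedge_apply, hs, ht, Ne.symm hst]

variable [Fintype σ]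

variable (K M) in
/-- The Koszul differential on the exterior algebra with coefficients in `M`. -/
noncomputable def koszulD : (Finset σ → M) →ₗ[MvPolynomial σ K] (Finset σ → M) :=
  ∑ s : σ, (X s : MvPolynomial σ K) • contraction K M s

theorem koszulD_eq (z : Finset σ → M) :
    koszulD K M z = ∑ s : σ, (X s : MvPolynomial σ K) • contraction K M s z := by
  simp [koszulD]

theorem koszulD_apply (z : Finset σ → M) (A : Finset σ) :
    koszulD K M z A = ∑ s : σ, (X s : MvPolynomial σ K) • contraction K M s z A := by
  simp [koszulD_eq, Finset.sum_apply]

/-- The terms for `(s, t)` and `(t, s)` cancel; the diagonal terms vanish separately, which keeps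
the argument valid in characteristic 2. -/
theorem koszulD_koszulD (z : Finset σ → M) : koszulD K M (koszulD K M z) = 0 := by
  rw [koszulD_eq]
  simp only [koszulD_eq z, map_sum, map_smul, Finset.smul_sum]
  rw [← Finset.sum_product']
  refine Finset.sum_involution (fun p _ => (p.2, p.1)) ?_ ?_ ?_ ?_
  · rintro ⟨s, t⟩ -
    rw [contraction_contraction s t, smul_neg, smul_neg, smul_comm, neg_add_cancel]
  · rintro ⟨s, t⟩ - h1 h2
    simp only [Prod.mk.injEq] at h2
    obtain ⟨rfl, -⟩ := h2
    exact h1 (by simp [contraction_contraction_self])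
  · simp
  · simp

/-- Exterior multiplication by `t` is a homotopy between multiplication by `X t` and zero. This is
why variables annihilate Koszul homology. -/
theorem koszulD_wedge (t : σ) (z : Finset σ → M) :
    koszulD K M (wedge K M t z) + wedge K M t (koszulD K M z) = (X t : MvPolynomial σ K) • z := by
  simp only [koszulD_eq, map_sum, map_smul, ← Finset.sum_add_distrib, ← smul_add]
  rw [Finset.sum_eq_single t]
  · rw [contraction_wedge_self]
  · intro s _ hs
    rw [contraction_wedge hs, smul_zero]
  · simp

theorem koszulD_map {M' : Type u} [AddCommGroup M'] [Module (MvPolynomial σ K) M']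
    (f : M →ₗ[MvPolynomial σ K] M') (z : Finset σ → M) :
    koszulD K M' (fun A => f (z A)) = fun A => f (koszulD K M z A) := by
  ext A
  simp only [koszulD_apply, map_sum, map_smul]
  refine Finset.sum_congr rfl fun s _ => ?_
  by_cases h : s ∈ A <;> simp [contraction_apply, h]

end KoszulOperators

/-! ### Koszul homology of a single strand and its long exact sequence -/

section Strands

/-- A family of `K`-subspaces `c 0, c 1, …` of an `S`-module such that multiplication by a
variable maps `c (i + 1)` to `c i`: the coefficients of a strand of a Koszul complex. -/
structure Strand (σ : Type) (K : Type u) [Field K] (M : Type u) [AddCommGroup M] [Module K M]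
    [Module (MvPolynomial σ K) M] where
  /-- the subspaces -/
  obj : ℕ → Submodule K M
  X_smul_mem : ∀ s i, ∀ v ∈ obj (i + 1), (X s : MvPolynomial σ K) • v ∈ obj i

variable {σ : Type} {K : Type u} [Field K]
  {M : Type u} [AddCommGroup M] [Module K M] [Module (MvPolynomial σ K) M]
  {M' : Type u} [AddCommGroup M'] [Module K M'] [Module (MvPolynomial σ K) M']
  {M'' : Type u} [AddCommGroup M''] [Module K M''] [Module (MvPolynomial σ K) M'']

/-- The `i`-chains of the Koszul strand with coefficients in `c`. -/
def Strand.chains (c : Strand σ K M) (i : ℕ) : Submodule K (Finset σ → M) where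
  carrier := {z | ∀ A : Finset σ, (A.card = i → z A ∈ c.obj i) ∧ (A.card ≠ i → z A = 0)}
  zero_mem' A := ⟨fun _ => zero_mem _, fun _ => rfl⟩
  add_mem' hz hw A := ⟨fun h => add_mem ((hz A).1 h) ((hw A).1 h), fun h => by
    simp [(hz A).2 h, (hw A).2 h]⟩
  smul_mem' r z hz A := ⟨fun h => Submodule.smul_mem _ r ((hz A).1 h), fun h => by
    simp [(hz A).2 h]⟩

variable [LinearOrder σ]

theorem Strand.wedge_mem_chains {c : Strand σ K M} {c' : Strand σ K M} {i : ℕ}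
    (h : c.obj i ≤ c'.obj (i + 1)) (s : σ) {z : Finset σ → M} (hz : z ∈ c.chains i) :
    wedge K M s z ∈ c'.chains (i + 1) := by
  intro A
  rw [wedge_apply]
  split_ifs with hs
  · have := Finset.card_erase_add_one hs
    exact ⟨fun hA => zsmul_mem (h ((hz _).1 (by omega))) _, fun hA => by
      rw [(hz _).2 (by omega), smul_zero]⟩
  · exact ⟨fun _ => zero_mem _, fun _ => rfl⟩

variable [Fintype σ]

theorem Strand.koszulD_mem_chains (c : Strand σ K M) {i : ℕ} {z : Finset σ → M}
    (hz : z ∈ c.chains (i + 1)) : koszulD K M z ∈ c.chains i := by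
  intro A
  rw [koszulD_apply]
  constructor
  · intro hA
    refine sum_mem fun s _ => c.X_smul_mem s i _ ?_
    rw [contraction_apply]
    split_ifs with h
    · exact zero_mem _
    · exact zsmul_mem ((hz _).1 (by rw [Finset.card_insert_of_notMem h, hA])) _
  · intro hA
    refine Finset.sum_eq_zero fun s _ => ?_
    rw [contraction_apply]
    split_ifs with h
    · simp
    · rw [(hz _).2 (by rw [Finset.card_insert_of_notMem h]; omega)]; simp

theorem Strand.koszulD_eq_zero (c : Strand σ K M) {z : Finset σ → M}
    (hz : z ∈ c.chains 0) : koszulD K M z = 0 := by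
  ext A
  rw [koszulD_apply]
  refine Finset.sum_eq_zero fun s _ => ?_
  rw [contraction_apply]
  split_ifs with h
  · simp
  · rw [(hz _).2 (by rw [Finset.card_insert_of_notMem h]; omega)]; simp

variable [IsScalarTower K (MvPolynomial σ K) M] [IsScalarTower K (MvPolynomial σ K) M']
  [IsScalarTower K (MvPolynomial σ K) M'']

/-- The Koszul differential on the chains of a strand. -/
noncomputable def Strand.d (c : Strand σ K M) (i : ℕ) : c.chains (i + 1) →ₗ[K] c.chains i :=
  ((koszulD K M).restrictScalars K).restrict fun _ hz => c.koszulD_mem_chains hz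

/-- The Koszul complex of a strand. -/
noncomputable def Strand.complex (c : Strand σ K M) : ChainComplex (ModuleCat.{u} K) ℕ :=
  ChainComplex.of (fun i => ModuleCat.of K (c.chains i)) (fun i => ModuleCat.ofHom (c.d i))
    fun _ => ModuleCat.hom_ext (LinearMap.ext fun z => Subtype.ext (koszulD_koszulD z.1))

theorem Strand.complex_d (c : Strand σ K M) (i : ℕ) :
    c.complex.d (i + 1) i = ModuleCat.ofHom (c.d i) :=
  ChainComplex.of_d (X := fun i => ModuleCat.of K (c.chains i)) (fun i => ModuleCat.ofHom (c.d i)) i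

/-- The `K`-linear map on chains given by an `S`-linear map of coefficients. -/
noncomputable def Strand.chainsMap {c : Strand σ K M} {c' : Strand σ K M'}
    (f : M →ₗ[MvPolynomial σ K] M') (hf : ∀ i, ∀ v ∈ c.obj i, f v ∈ c'.obj i) (i : ℕ) :
    c.chains i →ₗ[K] c'.chains i :=
  LinearMap.restrict ((f.restrictScalars K).compLeft (Finset σ)) fun _ hz A =>
    ⟨fun hA => hf i _ ((hz A).1 hA), fun hA => by simp [(hz A).2 hA]⟩

/-- The map of Koszul complexes given by an `S`-linear map of coefficients. -/
noncomputable def Strand.map {c : Strand σ K M} {c' : Strand σ K M'}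
    (f : M →ₗ[MvPolynomial σ K] M') (hf : ∀ i, ∀ v ∈ c.obj i, f v ∈ c'.obj i) :
    c.complex ⟶ c'.complex :=
  ChainComplex.ofHom (fun i => ModuleCat.ofHom (Strand.chainsMap f hf i)) fun i => by
    rw [c.complex_d, c'.complex_d]
    ext z
    exact Subtype.ext (koszulD_map f z.1)

/-- Koszul homology of a strand. -/
noncomputable def Strand.H (c : Strand σ K M) (i : ℕ) : ModuleCat.{u} K := c.complex.homology i

/-- The dimension of the Koszul homology of a strand. -/
noncomputable def Strand.h (c : Strand σ K M) (i : ℕ) : Cardinal.{u} := Module.rank K (c.H i)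

/-- It suffices to test on cycles that every image is a boundary. Later vanishing statements use
this form and never handle homology classes. -/
theorem Strand.homologyMap_eq_zero {c : Strand σ K M} {c' : Strand σ K M'}
    (f : M →ₗ[MvPolynomial σ K] M') (hf : ∀ i, ∀ v ∈ c.obj i, f v ∈ c'.obj i) (i : ℕ)
    (h0 : ∀ z ∈ c.chains i, koszulD K M z = 0 → ∃ w ∈ c'.chains (i + 1),
      koszulD K M' w = fun A => f (z A)) :
    HomologicalComplex.homologyMap (Strand.map f hf) i = 0 := by
  rw [← cancel_epi (c.complex.homologyπ i), Limits.comp_zero,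
    HomologicalComplex.homologyπ_naturality]
  ext z
  have hz : koszulD K M (c.complex.iCycles i z).1 = 0 := by
    cases i with
    | zero => exact c.koszulD_eq_zero (c.complex.iCycles 0 z).2
    | succ i =>
      have := congrArg (fun φ => φ.hom z) (c.complex.iCycles_d (i + 1) i)
      rw [c.complex_d] at this
      exact congrArg Subtype.val this
  obtain ⟨w, hw, hwz⟩ := h0 _ (c.complex.iCycles i z).2 hz
  have key : HomologicalComplex.cyclesMap (Strand.map f hf) i z =
      c'.complex.toCycles (i + 1) i (⟨w, hw⟩ : c'.chains (i + 1)) := by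
    have hinj : Function.Injective (c'.complex.iCycles i) :=
      (ModuleCat.mono_iff_injective _).1 inferInstance
    apply hinj
    have h1 := congrArg (fun φ => φ.hom z) (HomologicalComplex.cyclesMap_i (Strand.map f hf) i)
    have h2 := congrArg (fun φ => φ.hom (⟨w, hw⟩ : c'.chains (i + 1)))
      (c'.complex.toCycles_i (i + 1) i)
    rw [c'.complex_d] at h2
    refine Eq.trans h1 (Eq.trans ?_ h2.symm)
    exact Subtype.ext hwz.symm
  have h3 := congrArg (fun φ => φ.hom (⟨w, hw⟩ : c'.chains (i + 1)))
      (c'.complex.toCycles_comp_homologyπ (i + 1) i)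
  change c'.complex.homologyπ i (HomologicalComplex.cyclesMap (Strand.map f hf) i z) = 0
  rw [key]
  exact h3

theorem Strand.map_id (c : Strand σ K M) :
    Strand.map (c := c) (c' := c) LinearMap.id (fun _ _ h => h) = 𝟙 _ := by
  ext i z
  rfl

/-- The criterion for a zero map, applied to the identity. -/
theorem Strand.h_eq_zero (c : Strand σ K M) (i : ℕ)
    (h0 : ∀ z ∈ c.chains i, koszulD K M z = 0 → ∃ w ∈ c.chains (i + 1), koszulD K M w = z) :
    c.h i = 0 := by
  have h1 := Strand.homologyMap_eq_zero (c := c) (c' := c) LinearMap.id (fun _ _ h => h) i h0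
  rw [Strand.map_id, HomologicalComplex.homologyMap_id] at h1
  have h2 : Limits.IsZero (c.H i) := (Limits.IsZero.iff_id_eq_zero _).2 h1
  have := ModuleCat.subsingleton_of_isZero h2
  exact rank_subsingleton' K _

theorem Strand.exists_of_h_eq_zero (c : Strand σ K M) (i : ℕ) (h0 : c.h i = 0)
    {z : Finset σ → M} (hz : z ∈ c.chains i) (hd : koszulD K M z = 0) :
    ∃ w ∈ c.chains (i + 1), koszulD K M w = z := by
  have hs : Subsingleton (c.H i) := rank_zero_iff.1 h0
  have h1 : c.complex.ExactAt i := by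
    rw [HomologicalComplex.exactAt_iff_isZero_homology]
    exact @ModuleCat.isZero_of_subsingleton _ _ (c.complex.homology i) hs
  cases i with
  | zero =>
    rw [HomologicalComplex.exactAt_iff' _ 1 0 0 (by simp) (by simp),
      ShortComplex.moduleCat_exact_iff] at h1
    obtain ⟨w, hw⟩ := h1 (⟨z, hz⟩ : c.chains 0) (by
      change (c.complex.d 0 0).hom _ = 0
      rw [HomologicalComplex.shape _ _ _ (by simp)]; rfl)
    change (c.complex.d (0 + 1) 0).hom w = _ at hw
    rw [c.complex_d] at hw
    exact ⟨w.1, w.2, congrArg Subtype.val hw⟩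
  | succ i =>
    rw [HomologicalComplex.exactAt_iff' _ (i + 1 + 1) (i + 1) i (by simp) (by simp),
      ShortComplex.moduleCat_exact_iff] at h1
    obtain ⟨w, hw⟩ := h1 (⟨z, hz⟩ : c.chains (i + 1)) (by
      change (c.complex.d (i + 1) i).hom _ = 0
      rw [c.complex_d]
      exact Subtype.ext hd)
    change (c.complex.d (i + 1 + 1) (i + 1)).hom w = _ at hw
    rw [c.complex_d] at hw
    exact ⟨w.1, w.2, congrArg Subtype.val hw⟩

/-- In degree 0 every chain is a cycle, so homology is the cokernel of `c.d 0`, and `φ` exhibits `V`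
as another such cokernel. -/
theorem Strand.h_zero_eq_rank (c : Strand σ K M) {V : Type u} [AddCommGroup V] [Module K V]
    (φ : c.chains 0 →ₗ[K] V) (hφ : Function.Surjective φ)
    (hex : Function.Exact (c.d 0) φ) : c.h 0 = Module.rank K V := by
  have hi : IsIso (c.complex.iCycles 0) := c.complex.isIso_iCycles 0 0 (by simp)
    (HomologicalComplex.shape _ _ _ (by simp))
  let p := inv (c.complex.iCycles 0) ≫ c.complex.homologyπ 0
  have hp : Function.Surjective p.hom := (ModuleCat.epi_iff_surjective p).1 (epi_comp _ _)
  have hz : c.complex.d 1 0 ≫ p = 0 := by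
    rw [← c.complex.toCycles_i 1 0, Category.assoc, IsIso.hom_inv_id_assoc,
      HomologicalComplex.toCycles_comp_homologyπ]
  let q : c.chains 0 →ₗ[K] c.H 0 := p.hom
  have hpex : Function.Exact (c.d 0) q := by
    have h1 := ShortComplex.exact_of_g_is_cokernel
      (.mk _ _ (c.complex.toCycles_comp_homologyπ 1 0)) (c.complex.homologyIsCokernel 1 0 (by simp))
    have h2 : (ShortComplex.mk _ _ hz).Exact := by
      refine (ShortComplex.exact_iff_of_iso ?_).1 h1
      refine ShortComplex.isoMk (Iso.refl _) (asIso (c.complex.iCycles 0)) (Iso.refl _) ?_ ?_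
      · simp
      · simp [p]
    have h3 := (ShortComplex.ShortExact.moduleCat_exact_iff_function_exact _).1 h2
    have h4 : (c.complex.d 1 0).hom = c.d 0 := congrArg ModuleCat.Hom.hom (c.complex_d 0)
    intro y
    refine (h3 y).trans ?_
    change y ∈ Set.range (c.complex.d 1 0).hom ↔ _
    rw [h4]; rfl
  have hker : LinearMap.ker q = LinearMap.ker φ := by
    rw [LinearMap.exact_iff.1 hpex, LinearMap.exact_iff.1 hex]
  exact LinearEquiv.rank_eq ((q.quotKerEquivOfSurjective hp).symm ≪≫ₗ
    Submodule.quotEquivOfEq _ _ hker ≪≫ₗ φ.quotKerEquivOfSurjective hφ)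

/-- Short exactness, strand by strand, of a pair of `S`-linear maps. -/
structure StrandExact (f : M' →ₗ[MvPolynomial σ K] M) (g : M →ₗ[MvPolynomial σ K] M'')
    (c' : Strand σ K M') (c : Strand σ K M) (c'' : Strand σ K M'') : Prop where
  map_left : ∀ i, ∀ v ∈ c'.obj i, f v ∈ c.obj i
  map_right : ∀ i, ∀ v ∈ c.obj i, g v ∈ c''.obj i
  inj : ∀ i, ∀ v ∈ c'.obj i, f v = 0 → v = 0
  comp : ∀ i, ∀ v ∈ c'.obj i, g (f v) = 0
  exact : ∀ i, ∀ v ∈ c.obj i, g v = 0 → ∃ u ∈ c'.obj i, f u = v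
  surj : ∀ i, ∀ v ∈ c''.obj i, ∃ u ∈ c.obj i, g u = v

variable {f : M' →ₗ[MvPolynomial σ K] M} {g : M →ₗ[MvPolynomial σ K] M''}
  {c' : Strand σ K M'} {c : Strand σ K M} {c'' : Strand σ K M''}

/-- The short exact sequence of Koszul complexes. -/
noncomputable def StrandExact.shortComplex (h : StrandExact f g c' c c'') :
    ShortComplex (ChainComplex (ModuleCat.{u} K) ℕ) :=
  ShortComplex.mk (Strand.map f h.map_left) (Strand.map g h.map_right) (by
    ext i z
    refine Subtype.ext (funext fun A => ?_)
    change g (f (z.1 A)) = 0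
    by_cases hA : A.card = i
    · exact h.comp i _ ((z.2 A).1 hA)
    · rw [(z.2 A).2 hA, map_zero, map_zero])

theorem StrandExact.shortExact (h : StrandExact f g c' c c'') : h.shortComplex.ShortExact := by
  refine HomologicalComplex.shortExact_of_degreewise_shortExact _ fun i => ?_
  refine ShortComplex.ShortExact.mk' ?_ ?_ ?_
  · rw [ShortComplex.moduleCat_exact_iff]
    intro z hz
    have hz' : ∀ A, g (z.1 A) = 0 := fun A => congrFun (congrArg Subtype.val hz) A
    have hw : ∀ A : Finset σ, ∃ u, (A.card = i → u ∈ c'.obj i) ∧ (A.card ≠ i → u = 0) ∧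
        f u = z.1 A := by
      intro A
      by_cases hA : A.card = i
      · obtain ⟨u, hu, hu'⟩ := h.exact i _ ((z.2 A).1 hA) (hz' A)
        exact ⟨u, fun _ => hu, fun h => absurd hA h, hu'⟩
      · exact ⟨0, fun h => absurd h hA, fun _ => rfl, by rw [map_zero, (z.2 A).2 hA]⟩
    choose w hw1 hw2 hw3 using hw
    exact ⟨(⟨w, fun A => ⟨hw1 A, hw2 A⟩⟩ : c'.chains i), Subtype.ext (funext hw3)⟩
  · rw [ModuleCat.mono_iff_injective]
    change Function.Injective (Strand.chainsMap f h.map_left i)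
    rw [injective_iff_map_eq_zero]
    intro z hz
    refine Subtype.ext (funext fun A => ?_)
    by_cases hA : A.card = i
    · exact h.inj i _ ((z.2 A).1 hA) (congrFun (congrArg Subtype.val hz) A)
    · exact (z.2 A).2 hA
  · rw [ModuleCat.epi_iff_surjective]
    intro z
    have hw : ∀ A : Finset σ, ∃ u, (A.card = i → u ∈ c.obj i) ∧ (A.card ≠ i → u = 0) ∧
        g u = z.1 A := by
      intro A
      by_cases hA : A.card = i
      · obtain ⟨u, hu, hu'⟩ := h.surj i _ ((z.2 A).1 hA)
        exact ⟨u, fun _ => hu, fun h => absurd hA h, hu'⟩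
      · exact ⟨0, fun h => absurd h hA, fun _ => rfl, by rw [map_zero, (z.2 A).2 hA]⟩
    choose w hw1 hw2 hw3 using hw
    exact ⟨(⟨w, fun A => ⟨hw1 A, hw2 A⟩⟩ : c.chains i), Subtype.ext (funext hw3)⟩

/-- The map induced on homology by the first map of a short exact sequence. -/
noncomputable def StrandExact.homL (h : StrandExact f g c' c c'') (i : ℕ) : c'.H i →ₗ[K] c.H i :=
  (HomologicalComplex.homologyMap (Strand.map f h.map_left) i).hom

/-- The map induced on homology by the second map of a short exact sequence. -/
noncomputable def StrandExact.homR (h : StrandExact f g c' c c'') (i : ℕ) : c.H i →ₗ[K] c''.H i :=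
  (HomologicalComplex.homologyMap (Strand.map g h.map_right) i).hom

/-- The connecting homomorphism. -/
noncomputable def StrandExact.conn (h : StrandExact f g c' c c'') (i : ℕ) :
    c''.H (i + 1) →ₗ[K] c'.H i :=
  (h.shortExact.δ (i + 1) i rfl).hom

theorem StrandExact.exact_homL_homR (h : StrandExact f g c' c c'') (i : ℕ) :
    Function.Exact (h.homL i) (h.homR i) :=
  (ShortComplex.ShortExact.moduleCat_exact_iff_function_exact _).1 (h.shortExact.homology_exact₂ i)

theorem StrandExact.exact_conn_homL (h : StrandExact f g c' c c'') (i : ℕ) :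
    Function.Exact (h.conn i) (h.homL i) :=
  (ShortComplex.ShortExact.moduleCat_exact_iff_function_exact _).1
    (h.shortExact.homology_exact₁ (i + 1) i rfl)

theorem StrandExact.exact_homR_conn (h : StrandExact f g c' c c'') (i : ℕ) :
    Function.Exact (h.homR (i + 1)) (h.conn i) :=
  (ShortComplex.ShortExact.moduleCat_exact_iff_function_exact _).1
    (h.shortExact.homology_exact₃ (i + 1) i rfl)

/-- The right-hand end of the long exact sequence: homology in degree 0 coincides with opcycles, and
passing to opcycles preserves epimorphisms. -/
theorem StrandExact.surjective_homR_zero (h : StrandExact f g c' c c'') :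
    Function.Surjective (h.homR 0) := by
  refine (ModuleCat.epi_iff_surjective _).1 ?_
  have hE : Epi h.shortComplex.g := h.shortExact.epi_g
  have i2 : IsIso (c.complex.homologyι 0) := c.complex.isIso_homologyι 0 0 (by simp)
    (HomologicalComplex.shape _ _ _ (by simp))
  have i3 : IsIso (c''.complex.homologyι 0) := c''.complex.isIso_homologyι 0 0 (by simp)
    (HomologicalComplex.shape _ _ _ (by simp))
  have e : HomologicalComplex.homologyMap (Strand.map g h.map_right) 0 =
      c.complex.homologyι 0 ≫ HomologicalComplex.opcyclesMap (Strand.map g h.map_right) 0 ≫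
        inv (c''.complex.homologyι 0) := by
    rw [← HomologicalComplex.homologyι_naturality_assoc, IsIso.hom_inv_id, Category.comp_id]
  have hE' : Epi (HomologicalComplex.opcyclesMap (Strand.map g h.map_right) 0) :=
    inferInstanceAs (Epi (HomologicalComplex.opcyclesMap h.shortComplex.g 0))
  rw [e]
  infer_instance

end Strands

theorem rank_eq_of_exact {K : Type u} [Field K] {A B C : Type u} [AddCommGroup A] [Module K A]
    [AddCommGroup B] [Module K B] [AddCommGroup C] [Module K C] {f : A →ₗ[K] B} {g : B →ₗ[K] C}
    (h : Function.Exact f g) :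
    Module.rank K B = Module.rank K (LinearMap.range f) + Module.rank K (LinearMap.range g) := by
  rw [← LinearMap.exact_iff.1 h, add_comm, LinearMap.rank_range_add_rank_ker]

/-! ### Graded Koszul homology and numerical consequences of exact sequences -/

section Graded

variable {σ : Type} {K : Type u} [Field K]
  {M : Type u} [AddCommGroup M] [Module K M] [Module (MvPolynomial σ K) M]
  {M' : Type u} [AddCommGroup M'] [Module K M'] [Module (MvPolynomial σ K) M']
  {M'' : Type u} [AddCommGroup M''] [Module K M''] [Module (MvPolynomial σ K) M'']

section

variable [Fintype σ] [LinearOrder σ]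
  [IsScalarTower K (MvPolynomial σ K) M] [IsScalarTower K (MvPolynomial σ K) M']
  [IsScalarTower K (MvPolynomial σ K) M'']

/-- Here `a`, `b`, `e` are the ranks of the left, right and connecting maps on homology. Each
dimension is a sum of two of them, so later chases reduce to the fact that a sum of cardinals
vanishes only if both terms do; no finiteness or subtraction is needed. -/
theorem StrandExact.ranks {f : M' →ₗ[MvPolynomial σ K] M} {g : M →ₗ[MvPolynomial σ K] M''}
    {c' : Strand σ K M'} {c : Strand σ K M} {c'' : Strand σ K M''}
    (h : StrandExact f g c' c c'') :
    ∃ a b e : ℕ → Cardinal.{u}, (∀ i, c'.h i = e i + a i) ∧ (∀ i, c.h i = a i + b i) ∧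
      (∀ i, c''.h (i + 1) = b (i + 1) + e i) ∧ c''.h 0 = b 0 ∧ ∀ i, h.homL i = 0 → a i = 0 := by
  refine ⟨fun i => Module.rank K (LinearMap.range (h.homL i)),
    fun i => Module.rank K (LinearMap.range (h.homR i)),
    fun i => Module.rank K (LinearMap.range (h.conn i)),
    fun i => rank_eq_of_exact (h.exact_conn_homL i),
    fun i => rank_eq_of_exact (h.exact_homL_homR i),
    fun i => rank_eq_of_exact (h.exact_homR_conn i), ?_, fun i hi => ?_⟩
  · have := LinearMap.range_eq_top.2 h.surjective_homR_zero
    change c''.h 0 = Module.rank K (LinearMap.range (h.homR 0))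
    rw [this, rank_top]; rfl
  · change Module.rank K (LinearMap.range (h.homL i)) = 0
    rw [hi, LinearMap.range_zero, rank_bot]

theorem Strand.h_eq_zero_of_obj (c : Strand σ K M) (i : ℕ) (h : c.obj i = ⊥) : c.h i = 0 := by
  refine c.h_eq_zero i fun z hz _ => ⟨0, zero_mem _, ?_⟩
  ext A
  by_cases hA : A.card = i
  · have := (hz A).1 hA
    rw [h, Submodule.mem_bot] at this
    simp [this]
  · simp [(hz A).2 hA]

/-- The long exact sequence with third term zero. Only bijectivity between the given subspaces
matters, not that of `f`. -/
theorem Strand.h_eq_of_bijective {c : Strand σ K M} {c' : Strand σ K M'}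
    (f : M →ₗ[MvPolynomial σ K] M') (hf : ∀ i, ∀ v ∈ c.obj i, f v ∈ c'.obj i)
    (hinj : ∀ i, ∀ v ∈ c.obj i, f v = 0 → v = 0)
    (hsurj : ∀ i, ∀ v ∈ c'.obj i, ∃ u ∈ c.obj i, f u = v) (i : ℕ) : c.h i = c'.h i := by
  let c'' : Strand σ K M' := ⟨fun _ => ⊥, fun s i v hv => by
    rw [Submodule.mem_bot] at hv ⊢; rw [hv, smul_zero]⟩
  have h0 : ∀ i, c''.h i = 0 := fun i => c''.h_eq_zero_of_obj i rfl
  have hE : StrandExact f (0 : M' →ₗ[MvPolynomial σ K] M') c c' c'' :=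
    ⟨hf, fun _ _ _ => zero_mem _, hinj, fun _ _ _ => rfl, fun i v hv _ => hsurj i v hv,
      fun i v hv => ⟨0, zero_mem _, by rw [(Submodule.mem_bot K).1 hv, map_zero]⟩⟩
  obtain ⟨a, b, e, h1, h2, h3, h4, -⟩ := hE.ranks
  have hb : ∀ i, b i = 0 := by
    rintro (_ | i)
    · rw [← h4, h0]
    · have := h3 i
      rw [h0, eq_comm, add_eq_zero] at this
      exact this.1
  have he : e i = 0 := by
    have := h3 i
    rw [h0, eq_comm, add_eq_zero] at this
    exact this.2
  rw [h1, h2, hb, he, zero_add, add_zero]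

end

/-- A family of `K`-subspaces of an `S`-module such that multiplication by a variable maps each
subspace to the next one. -/
structure GradedFamily (σ : Type) (K : Type u) [Field K] (M : Type u) [AddCommGroup M] [Module K M]
    [Module (MvPolynomial σ K) M] where
  /-- the subspaces -/
  obj : ℕ → Submodule K M
  X_smul_mem : ∀ s j, ∀ v ∈ obj j, (X s : MvPolynomial σ K) • v ∈ obj (j + 1)

/-- The coefficients of the Koszul strand of internal degree `j`. -/
def GradedFamily.strand (𝓜 : GradedFamily σ K M) (j : ℕ) : Strand σ K M where
  obj i := if i ≤ j then 𝓜.obj (j - i) else ⊥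
  X_smul_mem s i v hv := by
    by_cases hi : i + 1 ≤ j
    · rw [if_pos hi] at hv
      rw [if_pos (by omega), show j - i = j - (i + 1) + 1 by omega]
      exact 𝓜.X_smul_mem s _ v hv
    · rw [if_neg hi, Submodule.mem_bot] at hv
      rw [hv, smul_zero]
      exact zero_mem _

theorem GradedFamily.strand_obj_add (𝓜 : GradedFamily σ K M) (i l : ℕ) :
    (𝓜.strand (i + l)).obj i = 𝓜.obj l := by
  change (if i ≤ i + l then 𝓜.obj (i + l - i) else ⊥) = _
  rw [if_pos (by omega), Nat.add_sub_cancel_left]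

theorem GradedFamily.strand_obj_of_lt (𝓜 : GradedFamily σ K M) {i j : ℕ} (h : j < i) :
    (𝓜.strand j).obj i = ⊥ := if_neg (by omega)

/-- The graded family shifted by one. -/
def GradedFamily.shift (𝓜 : GradedFamily σ K M) : GradedFamily σ K M where
  obj j := if j = 0 then ⊥ else 𝓜.obj (j - 1)
  X_smul_mem s j v hv := by
    rcases j with _ | j
    · rw [if_pos rfl, Submodule.mem_bot] at hv
      rw [hv, smul_zero]
      exact zero_mem _
    · exact 𝓜.X_smul_mem s j v hv

theorem GradedFamily.shift_obj_succ (𝓜 : GradedFamily σ K M) (j : ℕ) :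
    𝓜.shift.obj (j + 1) = 𝓜.obj j := rfl

theorem GradedFamily.shift_strand_zero (𝓜 : GradedFamily σ K M) (i : ℕ) :
    (𝓜.shift.strand 0).obj i = ⊥ := by
  rcases i with _ | i
  · rfl
  · exact 𝓜.shift.strand_obj_of_lt (by omega)

theorem GradedFamily.shift_strand_succ (𝓜 : GradedFamily σ K M) (j : ℕ) :
    𝓜.shift.strand (j + 1) = 𝓜.strand j := by
  have : (𝓜.shift.strand (j + 1)).obj = (𝓜.strand j).obj := by
    funext i
    rcases lt_trichotomy i (j + 1) with h | h | h
    · obtain ⟨l, rfl⟩ : ∃ l, j = i + l := ⟨j - i, by omega⟩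
      rw [strand_obj_add, add_assoc, strand_obj_add, shift_obj_succ]
    · rw [h, 𝓜.strand_obj_of_lt (by omega)]
      exact (𝓜.shift.strand_obj_add (j + 1) 0)
    · rw [𝓜.strand_obj_of_lt (by omega), 𝓜.shift.strand_obj_of_lt (by omega)]
  cases h1 : 𝓜.shift.strand (j + 1)
  cases h2 : 𝓜.strand j
  simp_all

/-- Short exactness, degree by degree, of a pair of `S`-linear maps. -/
structure GradedExact (f : M' →ₗ[MvPolynomial σ K] M) (g : M →ₗ[MvPolynomial σ K] M'')
    (𝓜' : GradedFamily σ K M') (𝓜 : GradedFamily σ K M) (𝓜'' : GradedFamily σ K M'') : Prop where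
  map_left : ∀ i, ∀ v ∈ 𝓜'.obj i, f v ∈ 𝓜.obj i
  map_right : ∀ i, ∀ v ∈ 𝓜.obj i, g v ∈ 𝓜''.obj i
  inj : ∀ i, ∀ v ∈ 𝓜'.obj i, f v = 0 → v = 0
  comp : ∀ i, ∀ v ∈ 𝓜'.obj i, g (f v) = 0
  exact : ∀ i, ∀ v ∈ 𝓜.obj i, g v = 0 → ∃ u ∈ 𝓜'.obj i, f u = v
  surj : ∀ i, ∀ v ∈ 𝓜''.obj i, ∃ u ∈ 𝓜.obj i, g u = v

theorem GradedExact.strand {f : M' →ₗ[MvPolynomial σ K] M} {g : M →ₗ[MvPolynomial σ K] M''}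
    {𝓜' : GradedFamily σ K M'} {𝓜 : GradedFamily σ K M} {𝓜'' : GradedFamily σ K M''}
    (h : GradedExact f g 𝓜' 𝓜 𝓜'') (j : ℕ) :
    StrandExact f g (𝓜'.strand j) (𝓜.strand j) (𝓜''.strand j) := by
  have key : ∀ i, (∃ l, (𝓜'.strand j).obj i = 𝓜'.obj l ∧ (𝓜.strand j).obj i = 𝓜.obj l ∧
      (𝓜''.strand j).obj i = 𝓜''.obj l) ∨ ((𝓜'.strand j).obj i = ⊥ ∧ (𝓜.strand j).obj i = ⊥ ∧
      (𝓜''.strand j).obj i = ⊥) := by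
    intro i
    rcases le_or_gt i j with hi | hi
    · obtain ⟨l, rfl⟩ := Nat.exists_eq_add_of_le hi
      exact Or.inl ⟨l, 𝓜'.strand_obj_add i l, 𝓜.strand_obj_add i l, 𝓜''.strand_obj_add i l⟩
    · exact Or.inr ⟨𝓜'.strand_obj_of_lt hi, 𝓜.strand_obj_of_lt hi, 𝓜''.strand_obj_of_lt hi⟩
  constructor <;> intro i <;> rcases key i with ⟨l, h1, h2, h3⟩ | ⟨h1, h2, h3⟩ <;>
    simp only [h1, h2, h3, Submodule.mem_bot]
  · exact h.map_left l
  · rintro v rfl; simp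
  · exact h.map_right l
  · rintro v rfl; simp
  · exact h.inj l
  · rintro v rfl; simp
  · exact h.comp l
  · rintro v rfl; simp
  · exact h.exact l
  · rintro v rfl; simp
  · exact h.surj l
  · rintro v rfl; simp

variable [Fintype σ] [LinearOrder σ]
  [IsScalarTower K (MvPolynomial σ K) M] [IsScalarTower K (MvPolynomial σ K) M']
  [IsScalarTower K (MvPolynomial σ K) M'']

/-- The dimension of the degree `j` part of the `i`-th Koszul homology. -/
noncomputable def GradedFamily.tor (𝓜 : GradedFamily σ K M) (i j : ℕ) : Cardinal.{u} :=
  (𝓜.strand j).h i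

theorem GradedFamily.tor_shift_succ (𝓜 : GradedFamily σ K M) (i j : ℕ) :
    𝓜.shift.tor i (j + 1) = 𝓜.tor i j := by
  rw [tor, tor, shift_strand_succ]

theorem GradedFamily.tor_shift_zero (𝓜 : GradedFamily σ K M) (i : ℕ) :
    𝓜.shift.tor i 0 = 0 :=
  Strand.h_eq_zero_of_obj _ _ (𝓜.shift_strand_zero i)

theorem GradedFamily.tor_of_lt (𝓜 : GradedFamily σ K M) {i j : ℕ} (h : j < i) : 𝓜.tor i j = 0 :=
  Strand.h_eq_zero_of_obj _ _ (𝓜.strand_obj_of_lt h)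

theorem GradedFamily.tor_add_of_obj (𝓜 : GradedFamily σ K M) {i l : ℕ} (h : 𝓜.obj l = ⊥) :
    𝓜.tor i (i + l) = 0 :=
  Strand.h_eq_zero_of_obj _ _ (by rw [strand_obj_add, h])

theorem GradedFamily.tor_eq_of_bijective {𝓜 : GradedFamily σ K M} {𝓜' : GradedFamily σ K M'}
    (f : M →ₗ[MvPolynomial σ K] M') (hf : ∀ i, ∀ v ∈ 𝓜.obj i, f v ∈ 𝓜'.obj i)
    (hinj : ∀ i, ∀ v ∈ 𝓜.obj i, f v = 0 → v = 0)
    (hsurj : ∀ i, ∀ v ∈ 𝓜'.obj i, ∃ u ∈ 𝓜.obj i, f u = v) (i j : ℕ) :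
    𝓜.tor i j = 𝓜'.tor i j := by
  refine Strand.h_eq_of_bijective f ?_ ?_ ?_ i <;> intro i <;> rcases le_or_gt i j with hi | hi
  · obtain ⟨l, rfl⟩ := Nat.exists_eq_add_of_le hi
    simpa only [strand_obj_add] using hf l
  · simp [strand_obj_of_lt _ hi]
  · obtain ⟨l, rfl⟩ := Nat.exists_eq_add_of_le hi
    simpa only [strand_obj_add] using hinj l
  · simp +contextual [strand_obj_of_lt _ hi]
  · obtain ⟨l, rfl⟩ := Nat.exists_eq_add_of_le hi
    simpa only [strand_obj_add] using hsurj l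
  · simp [strand_obj_of_lt _ hi]

section Exact

variable {f : M' →ₗ[MvPolynomial σ K] M} {g : M →ₗ[MvPolynomial σ K] M''}
  {𝓜' : GradedFamily σ K M'} {𝓜 : GradedFamily σ K M} {𝓜'' : GradedFamily σ K M''}

theorem GradedExact.tor_mid_eq_zero (h : GradedExact f g 𝓜' 𝓜 𝓜'') {i j : ℕ}
    (h1 : 𝓜'.tor i j = 0) (h2 : 𝓜''.tor i j = 0) : 𝓜.tor i j = 0 := by
  obtain ⟨a, b, e, e1, e2, e3, e4, -⟩ := (h.strand j).ranks
  unfold GradedFamily.tor at *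
  have ha : a i = 0 := (add_eq_zero.1 ((e1 i).symm.trans h1)).2
  have hb : b i = 0 := by
    rcases i with _ | i
    · rw [← e4, h2]
    · exact (add_eq_zero.1 ((e3 i).symm.trans h2)).1
  rw [e2, ha, hb, zero_add]

theorem GradedExact.tor_right_succ_eq_zero (h : GradedExact f g 𝓜' 𝓜 𝓜'') {i j : ℕ}
    (h1 : 𝓜.tor (i + 1) j = 0) (h2 : 𝓜'.tor i j = 0) : 𝓜''.tor (i + 1) j = 0 := by
  obtain ⟨a, b, e, e1, e2, e3, e4, -⟩ := (h.strand j).ranks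
  unfold GradedFamily.tor at *
  rw [e3, (add_eq_zero.1 ((e2 _).symm.trans h1)).2, (add_eq_zero.1 ((e1 i).symm.trans h2)).1,
    zero_add]

theorem GradedExact.tor_right_eq_left (h : GradedExact f g 𝓜' 𝓜 𝓜'') {i j : ℕ}
    (h1 : 𝓜.tor (i + 1) j = 0) (h2 : 𝓜.tor i j = 0) : 𝓜''.tor (i + 1) j = 𝓜'.tor i j := by
  obtain ⟨a, b, e, e1, e2, e3, e4, -⟩ := (h.strand j).ranks
  unfold GradedFamily.tor at *
  rw [e1, e3, (add_eq_zero.1 ((e2 _).symm.trans h1)).2, (add_eq_zero.1 ((e2 _).symm.trans h2)).1,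
    zero_add, add_zero]

/-- The two hypotheses kill the connecting maps on both sides of position `i + 1`. -/
theorem GradedExact.tor_mid_eq_add (h : GradedExact f g 𝓜' 𝓜 𝓜'') {i j : ℕ}
    (h1 : 𝓜''.tor (i + 2) j = 0) (h2 : 𝓜'.tor i j = 0) :
    𝓜.tor (i + 1) j = 𝓜'.tor (i + 1) j + 𝓜''.tor (i + 1) j := by
  obtain ⟨a, b, e, e1, e2, e3, e4, -⟩ := (h.strand j).ranks
  unfold GradedFamily.tor at *
  rw [e1, e2, e3, (add_eq_zero.1 ((e3 _).symm.trans h1)).2,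
    (add_eq_zero.1 ((e1 _).symm.trans h2)).1, zero_add, add_zero]

/-- If the first map vanishes on homology, the long exact sequence splits up. -/
theorem GradedExact.tor_of_homL_eq_zero (h : GradedExact f g 𝓜' 𝓜 𝓜'') (j : ℕ)
    (h0 : ∀ i, (h.strand j).homL i = 0) :
    𝓜''.tor 0 j = 𝓜.tor 0 j ∧ ∀ i, 𝓜''.tor (i + 1) j = 𝓜.tor (i + 1) j + 𝓜'.tor i j := by
  obtain ⟨a, b, e, e1, e2, e3, e4, e5⟩ := (h.strand j).ranks
  unfold GradedFamily.tor at *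
  have ha : ∀ i, a i = 0 := fun i => e5 i (h0 i)
  refine ⟨?_, fun i => ?_⟩
  · rw [e4, e2, ha, zero_add]
  · rw [e3, e2, e1, ha, ha, zero_add, add_zero]

theorem GradedExact.tor_of_homL_zero (h : GradedExact f g 𝓜' 𝓜 𝓜'') (j : ℕ)
    (h0 : (h.strand j).homL 0 = 0) (h1 : 𝓜.tor 1 j = 0) :
    𝓜''.tor 0 j = 𝓜.tor 0 j ∧ 𝓜''.tor 1 j = 𝓜'.tor 0 j := by
  obtain ⟨a, b, e, e1, e2, e3, e4, e5⟩ := (h.strand j).ranks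
  unfold GradedFamily.tor at *
  have ha : a 0 = 0 := e5 0 h0
  refine ⟨?_, ?_⟩
  · rw [e4, e2, ha, zero_add]
  · rw [e3, e1, ha, add_zero, (add_eq_zero.1 ((e2 1).symm.trans h1)).2, zero_add]

end Exact

/-- Multiplication by a variable is zero on Koszul homology. -/
theorem GradedExact.tor_of_smul {𝓜 : GradedFamily σ K M} {𝓜'' : GradedFamily σ K M''}
    {f : M →ₗ[MvPolynomial σ K] M} {g : M →ₗ[MvPolynomial σ K] M''}
    (h : GradedExact f g 𝓜.shift 𝓜 𝓜'') (s : σ) (hf : ∀ v, f v = (X s : MvPolynomial σ K) • v) :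
    (∀ j, 𝓜''.tor 0 j = 𝓜.tor 0 j) ∧ (∀ i, 𝓜''.tor (i + 1) 0 = 𝓜.tor (i + 1) 0) ∧
      ∀ i j, 𝓜''.tor (i + 1) (j + 1) = 𝓜.tor (i + 1) (j + 1) + 𝓜.tor i j := by
  have key : ∀ j i, (h.strand j).homL i = 0 := by
    intro j i
    have := Strand.homologyMap_eq_zero f (h.strand j).map_left i ?_
    · exact congrArg ModuleCat.Hom.hom this
    intro z hz hd
    -- For a cycle `z` the homotopy formula says that the wedge of `z` with `s` has boundary `X s •
    -- z`.
    refine ⟨wedge K M s z, Strand.wedge_mem_chains ?_ s hz, ?_⟩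
    · rcases j with _ | j
      · rw [𝓜.shift_strand_zero]; exact bot_le
      · rw [𝓜.shift_strand_succ]
        rcases le_or_gt i j with hi | hi
        · obtain ⟨l, rfl⟩ := Nat.exists_eq_add_of_le hi
          rw [𝓜.strand_obj_add, show i + l + 1 = (i + 1) + l by omega, 𝓜.strand_obj_add]
        · rw [𝓜.strand_obj_of_lt hi]; exact bot_le
    · have := koszulD_wedge (K := K) s z
      rw [hd, map_zero, add_zero] at this
      rw [this]
      ext A
      exact (hf _).symm
  refine ⟨fun j => (h.tor_of_homL_eq_zero j (key j)).1, fun i => ?_, fun i j => ?_⟩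
  · rw [(h.tor_of_homL_eq_zero 0 (key 0)).2, 𝓜.tor_shift_zero, add_zero]
  · rw [(h.tor_of_homL_eq_zero (j + 1) (key (j + 1))).2, 𝓜.tor_shift_succ]

end Graded

attribute [local instance] MvPolynomial.gradedAlgebra

/-! ### Exact sequences of subquotients of the polynomial ring -/

section Subquotients

variable {σ : Type} {K : Type u} [Field K]

/-- Homogeneity of an ideal for the standard grading. -/
abbrev IsHomog (I : Ideal (MvPolynomial σ K)) : Prop :=
  Ideal.IsHomogeneous (homogeneousSubmodule σ K) I

theorem IsHomog.component_mem {I : Ideal (MvPolynomial σ K)} (hI : IsHomog I)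
    {f : MvPolynomial σ K} (hf : f ∈ I) (j : ℕ) : homogeneousComponent j f ∈ I :=
  homogeneousComponent_mem_of_mem hI hf j

theorem IsHomog.span {B : Set (MvPolynomial σ K)} (h : ∀ f ∈ B, ∃ j, f.IsHomogeneous j) :
    IsHomog (Ideal.span B) :=
  Ideal.homogeneous_span _ _ fun f hf => by
    obtain ⟨j, hj⟩ := h f hf
    exact ⟨j, hj⟩

theorem IsHomog.span_singleton_X (s : σ) :
    IsHomog (Ideal.span {(X s : MvPolynomial σ K)}) :=
  IsHomog.span fun f hf => ⟨1, by rw [Set.mem_singleton_iff.1 hf]; exact isHomogeneous_X _ _⟩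

theorem homogeneousComponent_X_mul_succ (s : σ) (f : MvPolynomial σ K) (j : ℕ) :
    homogeneousComponent (j + 1) (X s * f) = X s * homogeneousComponent j f := by
  classical
  ext d
  simp only [coeff_homogeneousComponent, coeff_X_mul']
  by_cases h : s ∈ d.support
  · have : d.degree = (d - Finsupp.single s 1).degree + 1 := by
      have h1 : d = (d - Finsupp.single s 1) + Finsupp.single s 1 := by
        rw [tsub_add_cancel_of_le]
        rw [Finsupp.single_le_iff]
        exact Nat.one_le_iff_ne_zero.2 (Finsupp.mem_support_iff.1 h)
      conv_lhs => rw [h1]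
      simp [Finsupp.degree_single]
    simp [h, this]
  · simp [h]

theorem homogeneousComponent_X_mul_zero (s : σ) (f : MvPolynomial σ K) :
    homogeneousComponent 0 (X s * f) = 0 := by
  rw [homogeneousComponent_zero, ← constantCoeff_eq, map_mul, constantCoeff_X, zero_mul, C_0]

/-- The graded pieces of `L / (L ∩ I)`, as subspaces of `S / I`. -/
noncomputable def subq (L I : Ideal (MvPolynomial σ K)) :
    GradedFamily σ K (MvPolynomial σ K ⧸ I) where
  obj j := (L.restrictScalars K ⊓ homogeneousSubmodule σ K j).map
    (Ideal.Quotient.mkₐ K I).toLinearMap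
  X_smul_mem s j v hv := by
    obtain ⟨a, ⟨ha, ha'⟩, rfl⟩ := hv
    refine ⟨X s * a, ⟨L.mul_mem_left _ ha, ?_⟩, rfl⟩
    have := (isHomogeneous_X K s).mul ha'
    rwa [add_comm] at this

theorem mem_subq {L I : Ideal (MvPolynomial σ K)} {j : ℕ} {v : MvPolynomial σ K ⧸ I} :
    v ∈ (subq L I).obj j ↔ ∃ a ∈ L, a.IsHomogeneous j ∧ Ideal.Quotient.mk I a = v := by
  constructor
  · rintro ⟨a, ⟨ha, ha'⟩, rfl⟩
    exact ⟨a, ha, ha', rfl⟩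
  · rintro ⟨a, ha, ha', rfl⟩
    exact ⟨a, ⟨ha, ha'⟩, rfl⟩

theorem subq_exact_of_le {I L L' : Ideal (MvPolynomial σ K)} (h : I ≤ L) (h' : L ≤ L') :
    GradedExact LinearMap.id (Submodule.mapQ I L LinearMap.id h)
      (subq L I) (subq L' I) (subq L' L) := by
  refine ⟨?_, ?_, fun _ _ _ h => h, ?_, ?_, ?_⟩ <;> intro j v hv <;>
    obtain ⟨a, ha, ha', rfl⟩ := mem_subq.1 hv
  · exact mem_subq.2 ⟨a, h' ha, ha', rfl⟩
  · exact mem_subq.2 ⟨a, ha, ha', rfl⟩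
  · exact Ideal.Quotient.eq_zero_iff_mem.2 ha
  · intro h0
    exact ⟨_, mem_subq.2 ⟨a, Ideal.Quotient.eq_zero_iff_mem.1 h0, ha', rfl⟩, rfl⟩
  · exact ⟨_, mem_subq.2 ⟨a, ha, ha', rfl⟩, rfl⟩

/-- The isomorphism `(L' + L)/L' ≅ L/(L ∩ L')`. Since `L ∩ L' ≤ P ≤ L'`, the ideals `P` and `L'` cut
out the same part of `L`, so a product ideal can stand in for the intersection. -/
theorem subq_exact_sup {L P L' : Ideal (MvPolynomial σ K)} (hL : IsHomog L) (hL' : IsHomog L')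
    (h : P ≤ L') (h' : L ⊓ L' ≤ P) :
    GradedExact (Submodule.mapQ P L' LinearMap.id h)
      (Submodule.mapQ L' (L' ⊔ L) LinearMap.id le_sup_left)
      (subq L P) (subq ⊤ L') (subq ⊤ (L' ⊔ L)) := by
  refine ⟨?_, ?_, ?_, ?_, ?_, ?_⟩ <;> intro j v hv <;>
    obtain ⟨a, ha, ha', rfl⟩ := mem_subq.1 hv
  · exact mem_subq.2 ⟨a, trivial, ha', rfl⟩
  · exact mem_subq.2 ⟨a, ha, ha', rfl⟩
  · intro h0
    exact Ideal.Quotient.eq_zero_iff_mem.2 (h' ⟨ha, Ideal.Quotient.eq_zero_iff_mem.1 h0⟩)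
  · exact Ideal.Quotient.eq_zero_iff_mem.2 (le_sup_right (a := L') ha)
  · intro h0
    obtain ⟨b, hb, l, hl, (hbl : b + l = a)⟩ := Submodule.mem_sup.1 (Ideal.Quotient.eq_zero_iff_mem.1 h0)
    -- The preimage must be homogeneous, so `l` is replaced by its component of degree `j`.
    refine ⟨_, mem_subq.2 ⟨homogeneousComponent j l, hL.component_mem hl j,
      homogeneousComponent_isHomogeneous j l, rfl⟩, ?_⟩
    refine Ideal.Quotient.eq.2 ?_
    have e : homogeneousComponent j a = a := homogeneousComponent_eq_self ha'
    rw [← hbl, map_add, hbl] at e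
    change homogeneousComponent j l - a ∈ L'
    rw [← e, sub_add_cancel_right]
    exact neg_mem (hL'.component_mem hb j)
  · exact ⟨_, mem_subq.2 ⟨a, ha, ha', rfl⟩, rfl⟩

/-- Relative to `L`, the ideal `P` plays the role of the colon ideal `Q : X s`. It is `Q` itself
when `X s` is regular, and an ideal of variables in `HasShape.of_varIdeal_quotient`. -/
theorem subq_exact_X {P Q L : Ideal (MvPolynomial σ K)} (hQ : IsHomog Q) (hL : IsHomog L) (s : σ)
    (h : ∀ a ∈ P, X s * a ∈ Q) (h' : ∀ a ∈ L, X s * a ∈ Q → a ∈ P) :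
    GradedExact (Submodule.mapQ P Q (LinearMap.lsmul _ _ (X s)) h)
      (Submodule.mapQ Q (Q ⊔ Ideal.span {X s} * L) LinearMap.id le_sup_left)
      (subq L P).shift (subq L Q) (subq L (Q ⊔ Ideal.span {X s} * L)) := by
  have hshift : ∀ j, ∀ v ∈ (subq L P).shift.obj j, v = 0 ∨ ∃ k, j = k + 1 ∧ ∃ a ∈ L,
      a.IsHomogeneous k ∧ Ideal.Quotient.mk P a = v := by
    rintro (_ | j) v hv
    · exact Or.inl hv
    · exact Or.inr ⟨j, rfl, mem_subq.1 hv⟩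
  refine ⟨?_, ?_, ?_, ?_, ?_, ?_⟩ <;> intro j v hv
  · rcases hshift j v hv with rfl | ⟨k, rfl, a, ha, ha', rfl⟩
    · rw [map_zero]; exact zero_mem _
    · refine mem_subq.2 ⟨X s * a, L.mul_mem_left _ ha, ?_, rfl⟩
      have := (isHomogeneous_X K s).mul ha'
      rwa [add_comm] at this
  · obtain ⟨a, ha, ha', rfl⟩ := mem_subq.1 hv
    exact mem_subq.2 ⟨a, ha, ha', rfl⟩
  · rcases hshift j v hv with rfl | ⟨k, rfl, a, ha, ha', rfl⟩
    · exact fun _ => rfl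
    · intro h0
      exact Ideal.Quotient.eq_zero_iff_mem.2 (h' a ha (Ideal.Quotient.eq_zero_iff_mem.1 h0))
  · rcases hshift j v hv with rfl | ⟨k, rfl, a, ha, ha', rfl⟩
    · simp
    · exact Ideal.Quotient.eq_zero_iff_mem.2 (le_sup_right (a := Q)
        (Ideal.mul_mem_mul (Ideal.mem_span_singleton_self _) ha))
  · obtain ⟨a, ha, ha', rfl⟩ := mem_subq.1 hv
    intro h0
    obtain ⟨b, hb, l', hl', (hbl : b + l' = a)⟩ := Submodule.mem_sup.1 (Ideal.Quotient.eq_zero_iff_mem.1 h0)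
    obtain ⟨l, hl, rfl⟩ := Ideal.mem_span_singleton_mul.1 hl'
    have e : homogeneousComponent j a = a := homogeneousComponent_eq_self ha'
    rw [← hbl, map_add, hbl] at e
    rcases j with _ | j
    · rw [homogeneousComponent_X_mul_zero, add_zero] at e
      refine ⟨0, zero_mem _, ?_⟩
      rw [map_zero]
      refine (Ideal.Quotient.eq_zero_iff_mem.2 ?_).symm
      rw [← e]
      exact hQ.component_mem hb 0
    · rw [homogeneousComponent_X_mul_succ] at e
      refine ⟨Ideal.Quotient.mk P (homogeneousComponent j l), mem_subq.2
        ⟨homogeneousComponent j l, hL.component_mem hl j, homogeneousComponent_isHomogeneous j l,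
          rfl⟩, ?_⟩
      refine Ideal.Quotient.eq.2 ?_
      change X s * homogeneousComponent j l - a ∈ Q
      rw [← e, sub_add_cancel_right]
      exact neg_mem (hQ.component_mem hb _)
  · obtain ⟨a, ha, ha', rfl⟩ := mem_subq.1 hv
    exact ⟨_, mem_subq.2 ⟨a, ha, ha', rfl⟩, rfl⟩

/-- The ideal is stable under division by the variable `s`, discarding remainders. -/
def DivStable (s : σ) (L : Ideal (MvPolynomial σ K)) : Prop :=
  ∀ f ∈ L, f.divMonomial (Finsupp.single s 1) ∈ L

/-- Write `f` as a multiple of `X s` plus a remainder free of `X s`; the product of that remainder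
with `g` is again free of `X s`. -/
theorem mul_divMonomial_single {s : σ} {g : MvPolynomial σ K} (hg : s ∉ g.vars)
    (f : MvPolynomial σ K) :
    (f * g).divMonomial (Finsupp.single s 1) = f.divMonomial (Finsupp.single s 1) * g := by
  classical
  symm
  have hm : f * g = X s * (f.divMonomial (Finsupp.single s 1) * g) +
      f.modMonomial (Finsupp.single s 1) * g := by
    conv_lhs => rw [← divMonomial_add_modMonomial_single f s]
    ring
  have h0 : (f.modMonomial (Finsupp.single s 1) * g).divMonomial (Finsupp.single s 1) = 0 := by
    ext d
    rw [coeff_divMonomial, coeff_mul, coeff_zero]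
    refine Finset.sum_eq_zero fun p hp => ?_
    rw [Finset.HasAntidiagonal.mem_antidiagonal] at hp
    by_cases h1 : p.1 s = 0
    · have h2 : p.2 s ≠ 0 := by
        intro h2
        have := congrArg (fun d => d s) hp
        simp [h1, h2] at this
        omega
      rw [show coeff p.2 g = 0 from ?_, mul_zero]
      by_contra h3
      exact hg ((mem_vars_iff_mem_support s).2 ⟨p.2, mem_support_iff.2 h3, Finsupp.mem_support_iff.2 h2⟩)
    · rw [coeff_modMonomial_of_le, zero_mul]
      rw [Finsupp.single_le_iff]
      omega
  conv_rhs => rw [hm, add_divMonomial, h0, add_zero, X_mul_divMonomial]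

/-- The purpose of division stability: `X s` is regular modulo `L`. -/
theorem DivStable.mem_of_X_mul_mem {s : σ} {L : Ideal (MvPolynomial σ K)} (h : DivStable s L)
    {f : MvPolynomial σ K} (hf : X s * f ∈ L) : f ∈ L := by
  have := h _ hf
  rwa [X_mul_divMonomial] at this

theorem DivStable.top (s : σ) : DivStable s (⊤ : Ideal (MvPolynomial σ K)) := fun _ _ => trivial

theorem DivStable.sup {s : σ} {L L' : Ideal (MvPolynomial σ K)} (h : DivStable s L)
    (h' : DivStable s L') : DivStable s (L ⊔ L') := by
  intro f hf
  obtain ⟨a, ha, b, hb, rfl⟩ := Submodule.mem_sup.1 hf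
  rw [add_divMonomial]
  exact add_mem (le_sup_left (a := L) (h a ha)) (le_sup_right (a := L) (h' b hb))

theorem DivStable.span {s : σ} {B : Set (MvPolynomial σ K)} (h : ∀ g ∈ B, s ∉ g.vars) :
    DivStable s (Ideal.span B) := by
  intro f hf
  induction hf using Submodule.span_induction with
  | mem g hg =>
    have := mul_divMonomial_single (h g hg) 1
    rw [one_mul] at this
    rw [this]
    exact Ideal.mul_mem_left _ _ (Ideal.subset_span hg)
  | zero => rw [zero_divMonomial]; exact zero_mem _
  | add a b _ _ ha hb => rw [add_divMonomial]; exact add_mem ha hb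
  | smul r g hg hd =>
    -- Division by `X s` is not `S`-linear, so knowing it for `g` says nothing about `r • g`. An
    -- inner induction with arbitrary multiplier `r` is needed.
    clear hd
    induction hg using Submodule.span_induction generalizing r with
    | mem g hg =>
      rw [smul_eq_mul, mul_divMonomial_single (h g hg)]
      exact Ideal.mul_mem_left _ _ (Ideal.subset_span hg)
    | zero => rw [smul_zero, zero_divMonomial]; exact zero_mem _
    | add a b _ _ ha hb => rw [smul_add, add_divMonomial]; exact add_mem (ha r) (hb r)
    | smul r' g _ hg' => rw [smul_smul]; exact hg' _

theorem DivStable.span_X_mul {s t : σ} (hst : s ≠ t) {L : Ideal (MvPolynomial σ K)}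
    (h : DivStable s L) : DivStable s (Ideal.span {X t} * L) := by
  intro f hf
  obtain ⟨l, hl, rfl⟩ := Ideal.mem_span_singleton_mul.1 hf
  rw [mul_comm (X t), mul_divMonomial_single (by rwa [vars_X, Finset.mem_singleton]), mul_comm _ (X t)]
  exact Ideal.mul_mem_mul (Ideal.mem_span_singleton_self _) (h l hl)

variable [Fintype σ] [LinearOrder σ]

/-- The Betti numbers of `L / I` and of `L / (I + X_s L)` for a variable `X_s` that is regular on
`L / I`. -/
theorem tor_subq_X {I L : Ideal (MvPolynomial σ K)} (hI : IsHomog I) (hL : IsHomog L) (s : σ)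
    (h' : ∀ a ∈ L, X s * a ∈ I → a ∈ I) :
    (∀ j, (subq L (I ⊔ Ideal.span {X s} * L)).tor 0 j = (subq L I).tor 0 j) ∧
    (∀ i, (subq L (I ⊔ Ideal.span {X s} * L)).tor (i + 1) 0 = (subq L I).tor (i + 1) 0) ∧
    ∀ i j, (subq L (I ⊔ Ideal.span {X s} * L)).tor (i + 1) (j + 1) =
      (subq L I).tor (i + 1) (j + 1) + (subq L I).tor i j := by
  refine (subq_exact_X hI hL s (fun a ha => I.mul_mem_left _ ha) h').tor_of_smul s fun v => ?_
  obtain ⟨a, rfl⟩ := Ideal.Quotient.mk_surjective v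
  rfl

theorem tor_subq_X_le {I L : Ideal (MvPolynomial σ K)} (hI : IsHomog I) (hL : IsHomog L) (s : σ)
    (h' : ∀ a ∈ L, X s * a ∈ I → a ∈ I) (i j : ℕ)
    (h0 : (subq L (I ⊔ Ideal.span {X s} * L)).tor i j = 0) : (subq L I).tor i j = 0 := by
  obtain ⟨h1, h2, h3⟩ := tor_subq_X hI hL s h'
  rcases i with _ | i
  · rw [← h1, h0]
  rcases j with _ | j
  · rw [← h2, h0]
  · exact (add_eq_zero.1 ((h3 i j).symm.trans h0)).1

end Subquotients

/-! ### Ideals generated by variables -/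

section Variables

variable {σ : Type} (K : Type u) [Field K]

/-- The ideal generated by the variables in a set. -/
noncomputable def varIdeal (D : Set σ) : Ideal (MvPolynomial σ K) := Ideal.span (X '' D)

variable {K}

theorem varIdeal_isHomog (D : Set σ) : IsHomog (varIdeal K D) :=
  IsHomog.span fun f hf => by
    obtain ⟨s, -, rfl⟩ := hf
    exact ⟨1, isHomogeneous_X _ _⟩

theorem varIdeal_insert (s : σ) (D : Set σ) :
    varIdeal K (insert s D) = varIdeal K D ⊔ Ideal.span {X s} := by
  rw [varIdeal, Set.image_insert_eq, Set.insert_eq, Ideal.span_union, sup_comm]; rfl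

theorem varIdeal_empty : varIdeal K (∅ : Set σ) = ⊥ := by
  simp [varIdeal]

theorem X_mem_varIdeal {s : σ} {D : Set σ} (h : s ∈ D) : (X s : MvPolynomial σ K) ∈ varIdeal K D :=
  Ideal.subset_span ⟨s, h, rfl⟩

theorem mem_varIdeal {D : Set σ} {f : MvPolynomial σ K} :
    f ∈ varIdeal K D ↔ ∀ m ∈ f.support, ∃ i ∈ D, m i ≠ 0 :=
  mem_ideal_span_X_image

theorem mem_varIdeal_of_X_mul_mem {D : Set σ} {s : σ} (hs : s ∉ D) {f : MvPolynomial σ K}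
    (h : X s * f ∈ varIdeal K D) : f ∈ varIdeal K D :=
  (DivStable.span (s := s) (by
    rintro _ ⟨t, ht, rfl⟩
    rw [vars_X, Finset.mem_singleton]
    rintro rfl
    exact hs ht)).mem_of_X_mul_mem h

variable [Fintype σ] [LinearOrder σ]

/-- Modulo all variables only `K` in degree 0 is left, whose Koszul homology is confined to `i = j`
for degree reasons. The variables are then removed one by one: each is regular modulo the others, so
vanishing passes down to `S`. -/
theorem tor_top_bot_of_ne {i j : ℕ} (hij : i ≠ j) :
    (subq (⊤ : Ideal (MvPolynomial σ K)) ⊥).tor i j = 0 := by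
  classical
  have h1 : (subq (⊤ : Ideal (MvPolynomial σ K)) (varIdeal K Set.univ)).tor i j = 0 := by
    rcases lt_or_gt_of_ne hij with h | h
    · obtain ⟨l, rfl⟩ := Nat.exists_eq_add_of_lt h
      rw [add_assoc]
      refine GradedFamily.tor_add_of_obj _ (eq_bot_iff.2 fun v hv => ?_)
      obtain ⟨a, -, ha, rfl⟩ := mem_subq.1 hv
      refine Ideal.Quotient.eq_zero_iff_mem.2 (mem_varIdeal.2 fun m hm => ?_)
      by_contra! h0
      have h2 := ha (mem_support_iff.1 hm)
      have : m = 0 := Finsupp.ext fun i => h0 i trivial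
      rw [this] at h2
      simp at h2
    · exact GradedFamily.tor_of_lt _ h
  have key : ∀ D : Finset σ, (subq (⊤ : Ideal (MvPolynomial σ K)) (varIdeal K D)).tor i j = 0 →
      (subq (⊤ : Ideal (MvPolynomial σ K)) ⊥).tor i j = 0 := by
    intro D
    induction D using Finset.induction_on with
    | empty => rw [Finset.coe_empty, varIdeal_empty]; exact id
    | insert s D hs ih =>
      intro h
      refine ih (tor_subq_X_le (varIdeal_isHomog _) (Ideal.IsHomogeneous.top _) s ?_ i j ?_)
      · exact fun a _ => mem_varIdeal_of_X_mul_mem (by simpa using hs)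
      · rw [Ideal.mul_top, ← varIdeal_insert, ← Finset.coe_insert, h]
  refine key Finset.univ ?_
  rwa [Finset.coe_univ]

end Variables

/-! ### Koszul homology of graded free modules and dimension shifting -/

section Free

variable {σ : Type} {K : Type u} [Field K]
  {M : Type u} [AddCommGroup M] [Module K M] [Module (MvPolynomial σ K) M]

theorem isHomogeneous_iff_degree {p : MvPolynomial σ K} {n : ℕ} :
    p.IsHomogeneous n ↔ ∀ d, coeff d p ≠ 0 → d.degree = n := by
  rw [Finsupp.degree_eq_weight_one]; rfl

theorem isHomogeneous_zero_iff {p : MvPolynomial σ K} :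
    p.IsHomogeneous 0 ↔ p = C (coeff 0 p) := by
  rw [← totalDegree_zero_iff_isHomogeneous, totalDegree_eq_zero_iff_eq_C]

theorem GradedFamily.mem_strand_obj (𝓜 : GradedFamily σ K M) {i j : ℕ} {v : M} :
    v ∈ (𝓜.strand j).obj i ↔ v = 0 ∨ ∃ l, l + i = j ∧ v ∈ 𝓜.obj l := by
  rcases le_or_gt i j with hi | hi
  · obtain ⟨l, rfl⟩ := Nat.exists_eq_add_of_le hi
    rw [strand_obj_add]
    constructor
    · exact fun h => Or.inr ⟨l, add_comm _ _, h⟩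
    · rintro (rfl | ⟨l', hl', h⟩)
      · exact zero_mem _
      · rwa [show l = l' by omega]
  · rw [strand_obj_of_lt _ hi, Submodule.mem_bot]
    refine ⟨Or.inl, ?_⟩
    rintro (rfl | ⟨l', hl', -⟩)
    · rfl
    · omega

theorem GradedFamily.smul_mem [IsScalarTower K (MvPolynomial σ K) M] (𝓜 : GradedFamily σ K M)
    {i e : ℕ} {v : M} (hv : v ∈ 𝓜.obj i)
    {p : MvPolynomial σ K} (hp : p.IsHomogeneous e) : p • v ∈ 𝓜.obj (e + i) := by
  classical
  have key : ∀ (n : ℕ) (d : σ →₀ ℕ), d.degree = n →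
      (monomial d (1 : K)) • v ∈ 𝓜.obj (n + i) := by
    intro n
    induction n with
    | zero =>
      intro d hd
      rw [Finsupp.degree_eq_zero_iff] at hd
      subst hd
      have h1 : (monomial (0 : σ →₀ ℕ) (1 : K)) = 1 := rfl
      rwa [h1, one_smul, zero_add]
    | succ n ih =>
      intro d hd
      have hd0 : d ≠ 0 := by
        rintro rfl
        simp at hd
      obtain ⟨s, hs⟩ := Finsupp.ne_iff.1 hd0
      have h1 : d = Finsupp.single s 1 + (d - Finsupp.single s 1) := by
        rw [add_tsub_cancel_of_le]
        rw [Finsupp.single_le_iff]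
        exact Nat.one_le_iff_ne_zero.2 hs
      have h2 : (d - Finsupp.single s 1).degree = n := by
        have := congrArg Finsupp.degree h1
        rw [map_add, Finsupp.degree_single] at this
        omega
      have h3 : (monomial d (1 : K)) = X s * monomial (d - Finsupp.single s 1) 1 := by
        rw [X, monomial_mul, ← h1, one_mul]
      rw [h3, mul_smul, show n + 1 + i = n + i + 1 by omega]
      exact 𝓜.X_smul_mem s _ _ (ih _ h2)
  rw [p.as_sum, Finset.sum_smul]
  refine sum_mem fun d hd => ?_
  have h1 : monomial d (coeff d p) = coeff d p • monomial d (1 : K) := by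
    rw [smul_monomial, smul_eq_mul, mul_one]
  rw [h1, smul_assoc]
  refine Submodule.smul_mem _ _ (key e d ?_)
  exact isHomogeneous_iff_degree.1 hp d (mem_support_iff.1 hd)

variable (K) in
/-- The grading of the free module with basis elements of degrees `deg k`. -/
noncomputable def freeFam {r : ℕ} (deg : Fin r → ℕ) :
    GradedFamily σ K (Fin r → MvPolynomial σ K) where
  obj j :=
    { carrier := {f | ∀ k d, coeff d (f k) ≠ 0 → d.degree + deg k = j}
      zero_mem' := fun k d h => absurd (coeff_zero d) h
      add_mem' := fun {f g} hf hg k d h => by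
        by_cases h1 : coeff d (f k) = 0
        · refine hg k d fun h2 => h ?_
          rw [Pi.add_apply, coeff_add, h1, h2, add_zero]
        · exact hf k d h1
      smul_mem' := fun c f hf k d h => hf k d fun h1 => h (by
        rw [Pi.smul_apply, coeff_smul, h1, smul_zero]) }
  X_smul_mem s j f hf k d h := by
    classical
    rw [Pi.smul_apply, smul_eq_mul, coeff_X_mul'] at h
    split_ifs at h with hs
    · have h1 := hf k _ h
      have h2 : d = (d - Finsupp.single s 1) + Finsupp.single s 1 := by
        rw [tsub_add_cancel_of_le]
        rw [Finsupp.single_le_iff]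
        exact Nat.one_le_iff_ne_zero.2 (Finsupp.mem_support_iff.1 hs)
      have h3 := congrArg Finsupp.degree h2
      rw [map_add, Finsupp.degree_single] at h3
      omega
    · exact absurd rfl h

variable {r : ℕ} {deg : Fin r → ℕ}

theorem mem_freeFam_strand {i j : ℕ} {f : Fin r → MvPolynomial σ K} :
    f ∈ ((freeFam K deg).strand j).obj i ↔
      ∀ k d, coeff d (f k) ≠ 0 → d.degree + deg k + i = j := by
  rw [GradedFamily.mem_strand_obj]
  constructor
  · rintro (rfl | ⟨l, rfl, h⟩) k d hd
    · exact absurd (coeff_zero d) hd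
    · rw [h k d hd]
  · intro h
    by_cases h0 : f = 0
    · exact Or.inl h0
    · obtain ⟨k, hk⟩ := Function.ne_iff.1 h0
      obtain ⟨d, hd⟩ := ne_zero_iff.1 hk
      refine Or.inr ⟨d.degree + deg k, h k d hd, fun k' d' hd' => ?_⟩
      have := h k d hd
      have := h k' d' hd'
      omega

theorem mem_freeFam_iff_zero_or {j : ℕ} {f : Fin r → MvPolynomial σ K} :
    f ∈ (freeFam K deg).obj j ↔ ∀ k, f k = 0 ∨ ∃ e, e + deg k = j ∧ (f k).IsHomogeneous e := by
  refine forall_congr' fun k => ?_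
  constructor
  · intro h
    by_cases h0 : f k = 0
    · exact Or.inl h0
    · obtain ⟨d, hd⟩ := ne_zero_iff.1 h0
      refine Or.inr ⟨d.degree, h d hd, isHomogeneous_iff_degree.2 fun d' hd' => ?_⟩
      have := h d hd
      have := h d' hd'
      omega
  · rintro (h | ⟨e, he, h⟩) d hd
    · rw [h] at hd
      exact absurd (coeff_zero d) hd
    · rw [isHomogeneous_iff_degree.1 h d hd, he]

omit [Module K M] in
theorem map_eq_sum (φ : (Fin r → MvPolynomial σ K) →ₗ[MvPolynomial σ K] M)
    (f : Fin r → MvPolynomial σ K) : φ f = ∑ k, f k • φ (Pi.single k 1) := by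
  conv_lhs => rw [pi_eq_sum_univ' f]
  simp [map_sum, Pi.single]

variable (K deg) in
/-- The homogeneous component of degree `j` of an element of a graded free module. -/
noncomputable def freeComponent (j : ℕ) (f : Fin r → MvPolynomial σ K) :
    Fin r → MvPolynomial σ K :=
  fun k => if deg k ≤ j then homogeneousComponent (j - deg k) (f k) else 0

theorem coeff_freeComponent (j : ℕ) (f : Fin r → MvPolynomial σ K) (k : Fin r) (d : σ →₀ ℕ) :
    coeff d (freeComponent K deg j f k) = if d.degree + deg k = j then coeff d (f k) else 0 := by
  unfold freeComponent
  split_ifs with h1 h2 h2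
  · rw [coeff_homogeneousComponent, if_pos (by omega)]
  · rw [coeff_homogeneousComponent, if_neg (by omega)]
  · omega
  · rw [coeff_zero]

theorem freeComponent_mem (j : ℕ) (f : Fin r → MvPolynomial σ K) :
    freeComponent K deg j f ∈ (freeFam K deg).obj j := by
  intro k d h
  rw [coeff_freeComponent] at h
  by_contra h'
  rw [if_neg h'] at h
  exact h rfl

theorem sum_freeComponent (f : Fin r → MvPolynomial σ K) :
    ∃ N, ∀ n ≥ N, ∑ j ∈ Finset.range n, freeComponent K deg j f = f := by
  refine ⟨∑ k, ((f k).totalDegree + deg k) + 1, fun n hn => ?_⟩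
  funext k
  ext d
  rw [Finset.sum_apply, coeff_sum]
  simp only [coeff_freeComponent]
  rw [Finset.sum_ite_eq]
  split_ifs with h
  · rfl
  · by_contra h0
    have h1 := le_totalDegree (mem_support_iff.2 (Ne.symm h0))
    have h2 := Finset.single_le_sum (f := fun k => (f k).totalDegree + deg k)
      (fun _ _ => Nat.zero_le _) (Finset.mem_univ k)
    rw [Finset.mem_range] at h
    have h3 : d.degree = d.sum fun _ e => e := rfl
    omega

/-- The subspaces of the family are independent. -/
def GradedFamily.Indep (𝓜 : GradedFamily σ K M) : Prop :=
  ∀ (s : Finset ℕ) (v : ℕ → M), (∀ l, v l ∈ 𝓜.obj l) → ∑ l ∈ s, v l = 0 → ∀ l ∈ s, v l = 0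

theorem freeFam_indep : (freeFam (σ := σ) K deg).Indep := by
  intro s v hv hs l hl
  funext k
  ext d
  by_contra h0
  have h1 := hv l k d h0
  have h2 := congrArg (fun f => coeff d (f k)) hs
  simp only [Finset.sum_apply, coeff_sum, Pi.zero_apply, coeff_zero] at h2
  rw [Finset.sum_eq_single l] at h2
  · exact h0 h2
  · intro l' _ hl'
    by_contra h3
    exact hl' ((hv l' k d h3).symm.trans h1)
  · exact fun h => absurd hl h

section Map

variable [IsScalarTower K (MvPolynomial σ K) M] {𝓜 : GradedFamily σ K M}
  {φ : (Fin r → MvPolynomial σ K) →ₗ[MvPolynomial σ K] M}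

theorem map_mem_of_single (hφ : ∀ k, φ (Pi.single k 1) ∈ 𝓜.obj (deg k)) {j : ℕ}
    {f : Fin r → MvPolynomial σ K} (hf : f ∈ (freeFam K deg).obj j) : φ f ∈ 𝓜.obj j := by
  rw [map_eq_sum]
  refine sum_mem fun k _ => ?_
  rcases mem_freeFam_iff_zero_or.1 hf k with h | ⟨e, rfl, h⟩
  · rw [h, zero_smul]; exact zero_mem _
  · exact 𝓜.smul_mem (hφ k) h

/-- Summing `φ` over all components of `f` gives `φ f`, which lies in degree `j`; by independence
the two sides may be compared in that degree. -/
theorem map_freeComponent (hφ : ∀ k, φ (Pi.single k 1) ∈ 𝓜.obj (deg k)) (h𝓜 : 𝓜.Indep) {j : ℕ}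
    {f : Fin r → MvPolynomial σ K} (hf : φ f ∈ 𝓜.obj j) :
    φ (freeComponent K deg j f) = φ f := by
  obtain ⟨N, hN⟩ := sum_freeComponent (K := K) (deg := deg) f
  -- Enlarged so that degree `j` occurs in the sum.
  let n := max N (j + 1)
  let w : ℕ → M := fun l => φ (freeComponent K deg l f) - if l = j then φ f else 0
  have hw : ∀ l, w l ∈ 𝓜.obj l := by
    intro l
    refine sub_mem (map_mem_of_single hφ (freeComponent_mem l f)) ?_
    split_ifs with h
    · rwa [h]
    · exact zero_mem _
  have hj : j ∈ Finset.range n := Finset.mem_range.2 (lt_of_lt_of_le (Nat.lt_succ_self j)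
    (le_max_right _ _))
  have hs : ∑ l ∈ Finset.range n, w l = 0 := by
    rw [Finset.sum_sub_distrib, ← map_sum, hN n (le_max_left _ _), Finset.sum_ite_eq', if_pos hj,
      sub_self]
  have := h𝓜 _ w hw hs j hj
  simpa [w, sub_eq_zero] using this

end Map

variable [Fintype σ] [LinearOrder σ]

variable (σ K) in
/-- The standard grading of the polynomial ring. -/
noncomputable def polyFam : GradedFamily σ K (MvPolynomial σ K) where
  obj j := homogeneousSubmodule σ K j
  X_smul_mem s j v hv := by
    have := (isHomogeneous_X K s).mul hv
    rwa [add_comm] at this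

theorem tor_top_bot_eq (i j : ℕ) :
    (subq (⊤ : Ideal (MvPolynomial σ K)) ⊥).tor i j = (polyFam σ K).tor i j := by
  symm
  refine GradedFamily.tor_eq_of_bijective (Submodule.mkQ ⊥) ?_ ?_ ?_ i j
  · exact fun j v hv => mem_subq.2 ⟨v, trivial, hv, rfl⟩
  · exact fun j v _ h0 => Ideal.Quotient.eq_zero_iff_mem.1 h0
  · intro j v hv
    obtain ⟨a, -, ha, rfl⟩ := mem_subq.1 hv
    exact ⟨a, ha, rfl⟩

/-- Off the diagonal this is the reduction to `K`. On the diagonal with `i > 0` the chains have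
constant coefficients, and for `s ∈ A` the coefficient of `X s` in the boundary at `A \ {s}` is the
one at `A` up to sign, so the only cycle is 0. -/
theorem tor_polyFam {i j : ℕ} (h : i ≠ 0 ∨ j ≠ 0) : (polyFam σ K).tor i j = 0 := by
  by_cases hij : i = j
  · subst hij
    have hi : i ≠ 0 := by tauto
    refine Strand.h_eq_zero _ _ fun z hz hd => ⟨0, zero_mem _, ?_⟩
    rw [map_zero]
    ext1 A
    by_cases hA : A.card = i
    · have hzA : ∀ B : Finset σ, z B = C (coeff 0 (z B)) := by
        intro B
        refine isHomogeneous_zero_iff.1 ?_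
        by_cases hB : B.card = i
        · have := (hz B).1 hB
          have h1 := (polyFam σ K).strand_obj_add i 0
          rw [add_zero] at h1
          rwa [h1] at this
        · rw [(hz B).2 hB]; exact isHomogeneous_zero _ _ _
      obtain ⟨s, hs⟩ := Finset.card_pos.1 (by omega : 0 < A.card)
      have h1 := congrArg (coeff (Finsupp.single s 1)) (congrFun hd (A.erase s))
      rw [koszulD_apply, coeff_sum, Finset.sum_eq_single s] at h1
      · rw [contraction_apply, if_neg (Finset.notMem_erase s A), Finset.insert_erase hs, smul_eq_mul,
          coeff_X_mul', if_pos (by simp), tsub_self, coeff_smul] at h1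
        have h2 : coeff 0 (z A) = 0 := by
          rcases neg_one_pow_eq_or ℤ ((A.erase s).filter (· < s)).card with h3 | h3 <;>
            simpa [koszulSign, h3] using h1
        rw [hzA A, h2, C_0]; rfl
      · intro t _ hts
        rw [contraction_apply]
        split_ifs with ht
        · simp
        · rw [hzA, smul_eq_mul, coeff_X_mul', if_neg]
          rw [Finsupp.mem_support_iff, Finsupp.single_apply, if_neg (Ne.symm hts)]
          simp
      · simp
    · exact ((hz A).2 hA).symm
  · rw [← tor_top_bot_eq, tor_top_bot_of_ne hij]

/-- Coordinates decouple: the `k`-th one is a cycle in strand `j - deg k` of the polynomial ring.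
The only obstruction is a constant in homological degree 0, and `h0` excludes it. -/
theorem exists_koszulD_eq_of_freeFam {i j : ℕ} {z : Finset σ → Fin r → MvPolynomial σ K}
    (hz : z ∈ ((freeFam K deg).strand j).chains i) (hd : koszulD K _ z = 0)
    (h0 : i ≠ 0 ∨ ∀ k, constantCoeff (z ∅ k) = 0) :
    ∃ w ∈ ((freeFam K deg).strand j).chains (i + 1), koszulD K _ w = z := by
  have key : ∀ k, ∃ w : Finset σ → MvPolynomial σ K,
      (∀ A : Finset σ, (A.card = i + 1 → ∀ d, coeff d (w A) ≠ 0 → d.degree + deg k + (i + 1) = j) ∧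
        (A.card ≠ i + 1 → w A = 0)) ∧ koszulD K _ w = fun A => z A k := by
    intro k
    have hdk : koszulD K _ (fun A => z A k) = 0 := by
      have := koszulD_map (LinearMap.proj (R := MvPolynomial σ K)
        (φ := fun _ : Fin r => MvPolynomial σ K) k) z
      rw [hd] at this
      exact this
    by_cases hk : deg k ≤ j ∧ (i ≠ 0 ∨ j - deg k ≠ 0)
    · have hzk : (fun A => z A k) ∈ ((polyFam σ K).strand (j - deg k)).chains i := by
        refine fun A => ⟨fun hA => ?_, fun hA => congrFun ((hz A).2 hA) k⟩
        have h1 := mem_freeFam_strand.1 ((hz A).1 hA) k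
        rw [GradedFamily.mem_strand_obj]
        by_cases h2 : z A k = 0
        · exact Or.inl h2
        · obtain ⟨d, hd⟩ := ne_zero_iff.1 h2
          have h3 := h1 d hd
          refine Or.inr ⟨d.degree, by omega, isHomogeneous_iff_degree.2 fun d' hd' => ?_⟩
          have := h1 d' hd'
          omega
      obtain ⟨w, hw, hwz⟩ := Strand.exists_of_h_eq_zero _ i (tor_polyFam hk.2) hzk hdk
      refine ⟨w, fun A => ⟨fun hA d hd => ?_, (hw A).2⟩, hwz⟩
      rcases ((polyFam σ K).mem_strand_obj).1 ((hw A).1 hA) with h | ⟨l, hl, h⟩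
      · rw [h] at hd
        exact absurd (coeff_zero d) hd
      · have := isHomogeneous_iff_degree.1 h d hd
        omega
    -- Here the coordinate itself is zero: either `deg k > j`, or it is a constant in homological
    -- degree 0.
    · refine ⟨0, fun A => ⟨fun _ d hd => absurd (coeff_zero d) hd, fun _ => rfl⟩, ?_⟩
      rw [map_zero]
      funext A
      by_cases hA : A.card = i
      · symm
        ext d
        by_contra h2
        have h1 := mem_freeFam_strand.1 ((hz A).1 hA) k d h2
        have hi : i = 0 := by by_contra hi; exact hk ⟨by omega, Or.inl hi⟩
        have hj : j - deg k = 0 := by by_contra hj; exact hk ⟨by omega, Or.inr hj⟩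
        have hA' : A = ∅ := Finset.card_eq_zero.1 (hA.trans hi)
        have hd0 : d = 0 := (Finsupp.degree_eq_zero_iff d).1 (by omega)
        have h3 := (h0.resolve_left (by simpa using hi)) k
        rw [constantCoeff_eq, ← hA', ← hd0] at h3
        exact h2 h3
      · exact (congrFun ((hz A).2 hA) k).symm
  choose w hw hwz using key
  refine ⟨fun A k => w k A, fun A => ⟨fun hA => ?_, fun hA => funext fun k => (hw k A).2 hA⟩, ?_⟩
  · exact mem_freeFam_strand.2 fun k d hd => (hw k A).1 hA d hd
  · funext A k
    have := koszulD_map (LinearMap.proj (R := MvPolynomial σ K)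
      (φ := fun _ : Fin r => MvPolynomial σ K) k) (fun A k => w k A)
    exact (congrFun this A).symm.trans (congrFun (hwz k) A)

theorem tor_freeFam_succ (i j : ℕ) : (freeFam (σ := σ) K deg).tor (i + 1) j = 0 :=
  Strand.h_eq_zero _ _ fun _ hz hd =>
    exists_koszulD_eq_of_freeFam hz hd (Or.inl (Nat.succ_ne_zero i))

theorem constantCoeff_koszulD_eq_zero (w : Finset σ → Fin r → MvPolynomial σ K) (A : Finset σ)
    (k : Fin r) : constantCoeff (koszulD K _ w A k) = 0 := by
  rw [koszulD_apply, Finset.sum_apply, map_sum]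
  refine Finset.sum_eq_zero fun s _ => ?_
  rw [Pi.smul_apply, smul_eq_mul, map_mul, constantCoeff_X, zero_mul]

/-- Constant terms at the basis elements of degree `j` detect degree 0 homology, since boundaries
have no constant terms and nothing else survives. -/
theorem tor_freeFam_zero (j : ℕ) :
    (freeFam (σ := σ) K deg).tor 0 j = Fintype.card {k : Fin r // deg k = j} := by
  classical
  let φ : ((freeFam (σ := σ) K deg).strand j).chains 0 →ₗ[K] ({k : Fin r // deg k = j} → K) :=
    { toFun := fun z k => constantCoeff (z.1 ∅ k)
      map_add' := fun z w => funext fun k => by simp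
      map_smul' := fun c z => funext fun k => by simp [constantCoeff_eq] }
  rw [← rank_fun' (R := K)]
  refine Strand.h_zero_eq_rank _ φ ?_ ?_
  · intro c
    refine ⟨⟨fun A => if A = ∅ then fun k => if h : deg k = j then C (c ⟨k, h⟩) else 0 else 0,
      fun A => ⟨fun hA => ?_, fun hA => ?_⟩⟩, ?_⟩
    · beta_reduce
      rw [if_pos (Finset.card_eq_zero.1 hA)]
      refine mem_freeFam_strand.2 fun k d hd => ?_
      split_ifs at hd with h
      · rw [coeff_C] at hd
        split_ifs at hd with h0
        · rw [← h0]; simpa using h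
        · exact absurd rfl hd
      · exact absurd (coeff_zero d) hd
    · beta_reduce
      rw [if_neg]
      rintro rfl
      exact hA Finset.card_empty
    · funext k
      simp [φ, k.2]
  · intro z
    constructor
    · intro h
      obtain ⟨w, hw, hwz⟩ := exists_koszulD_eq_of_freeFam z.2 (Strand.koszulD_eq_zero _ z.2)
        (Or.inr fun k => by
          by_cases hk : deg k = j
          · exact congrFun h ⟨k, hk⟩
          · rw [constantCoeff_eq]
            by_contra h1
            have := mem_freeFam_strand.1 ((z.2 ∅).1 Finset.card_empty) k 0 h1
            simp at this
            exact hk this)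
      exact ⟨⟨w, hw⟩, Subtype.ext hwz⟩
    · rintro ⟨w, rfl⟩
      funext k
      exact constantCoeff_koszulD_eq_zero w.1 ∅ k

section Kernel

variable [IsScalarTower K (MvPolynomial σ K) M]
  {φ : (Fin r → MvPolynomial σ K) →ₗ[MvPolynomial σ K] M}

variable (deg φ) in
/-- The grading of the kernel of a map from a graded free module. -/
noncomputable def kerFam : GradedFamily σ K (Fin r → MvPolynomial σ K) where
  obj j := (freeFam K deg).obj j ⊓ (LinearMap.ker φ).restrictScalars K
  X_smul_mem s j v hv := ⟨(freeFam K deg).X_smul_mem s j v hv.1, (LinearMap.ker φ).smul_mem _ hv.2⟩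

/-- Minimality says that elements of the kernel have no constant terms, so the kernel maps to zero
in degree 0 homology of the free module. As the free module has no higher homology, the long exact
sequence becomes dimension shifting. -/
theorem tor_of_cover {𝓝 : GradedFamily σ K M}
    (hmap : ∀ j, ∀ f ∈ (freeFam K deg).obj j, φ f ∈ 𝓝.obj j)
    (hsurj : ∀ j, ∀ v ∈ 𝓝.obj j, ∃ f ∈ (freeFam K deg).obj j, φ f = v)
    (hmin : ∀ f, φ f = 0 → ∀ k, constantCoeff (f k) = 0) :
    (∀ j, 𝓝.tor 0 j = Fintype.card {k : Fin r // deg k = j}) ∧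
      ∀ i j, 𝓝.tor (i + 1) j = (kerFam deg φ).tor i j := by
  have h : GradedExact LinearMap.id φ (kerFam deg φ) (freeFam K deg) 𝓝 :=
    ⟨fun _ _ hv => hv.1, hmap, fun _ _ _ h => h, fun _ _ hv => hv.2,
      fun _ v hv h0 => ⟨v, ⟨hv, h0⟩, rfl⟩, hsurj⟩
  have h0 : ∀ j, (h.strand j).homL 0 = 0 := by
    intro j
    refine congrArg ModuleCat.Hom.hom
      (Strand.homologyMap_eq_zero LinearMap.id (h.strand j).map_left 0 fun z hz hd => ?_)
    refine exists_koszulD_eq_of_freeFam (fun A => ⟨fun hA => ?_, (hz A).2⟩) hd (Or.inr fun k => ?_)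
    · exact (h.strand j).map_left 0 _ ((hz A).1 hA)
    · rcases (GradedFamily.mem_strand_obj _).1 ((hz ∅).1 Finset.card_empty) with h1 | ⟨l, -, h1⟩
      · rw [h1]; exact map_zero _
      · exact hmin _ h1.2 k
  refine ⟨fun j => ?_, fun i j => ?_⟩
  · rw [(h.tor_of_homL_zero j (h0 j) (tor_freeFam_succ 0 j)).1, tor_freeFam_zero]
  · rcases i with _ | i
    · exact (h.tor_of_homL_zero j (h0 j) (tor_freeFam_succ 0 j)).2
    · exact h.tor_right_eq_left (tor_freeFam_succ _ j) (tor_freeFam_succ _ j)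

end Kernel

end Free

/-! ### Minimal resolutions compute Koszul homology -/

section Resolution

variable {σ : Type} {K : Type u} [Field K]
  {M : Type u} [AddCommGroup M] [Module K M] [Module (MvPolynomial σ K) M]

namespace MinimalGradedFreeResolution

variable {𝓜₀ : ℕ → Submodule K M} (R : MinimalGradedFreeResolution (σ := σ) 𝓜₀)

theorem constantCoeff_d (i : ℕ) (f : Fin (R.rank (i + 1)) → MvPolynomial σ K)
    (l : Fin (R.rank i)) : constantCoeff (R.d i f l) = 0 := by
  rw [map_eq_sum, Finset.sum_apply, map_sum]
  refine Finset.sum_eq_zero fun k _ => ?_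
  rw [Pi.smul_apply, smul_eq_mul, map_mul, R.minimal, mul_zero]

theorem d_single_mem (i : ℕ) (k : Fin (R.rank (i + 1))) :
    R.d i (Pi.single k 1) ∈ (freeFam K (R.deg i)).obj (R.deg (i + 1) k) :=
  mem_freeFam_iff_zero_or.2 fun l => R.d_homogeneous i k l

/-- The grading of the image of a differential. -/
noncomputable def imFam (i : ℕ) : GradedFamily σ K (Fin (R.rank i) → MvPolynomial σ K) where
  obj j := (freeFam K (R.deg i)).obj j ⊓ (LinearMap.range (R.d i)).restrictScalars K
  X_smul_mem s j v hv :=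
    ⟨(freeFam K (R.deg i)).X_smul_mem s j v hv.1, (LinearMap.range (R.d i)).smul_mem _ hv.2⟩

variable [Fintype σ] [LinearOrder σ]

theorem tor_imFam_step (i : ℕ) :
    (∀ j, (R.imFam i).tor 0 j = Fintype.card {k // R.deg (i + 1) k = j}) ∧
      ∀ l j, (R.imFam i).tor (l + 1) j = (R.imFam (i + 1)).tor l j := by
  have h := tor_of_cover (𝓝 := R.imFam i) (φ := R.d i) (deg := R.deg (i + 1)) ?_ ?_ ?_
  · refine ⟨h.1, fun l j => (h.2 l j).trans ?_⟩
    refine GradedFamily.tor_eq_of_bijective LinearMap.id ?_ (fun _ _ _ h => h) ?_ l j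
    · exact fun j v hv => ⟨hv.1, (R.exact_succ i v).1 hv.2⟩
    · exact fun j v hv => ⟨v, ⟨hv.1, (R.exact_succ i v).2 hv.2⟩, rfl⟩
  · exact fun j f hf => ⟨map_mem_of_single (R.d_single_mem i) hf, ⟨f, rfl⟩⟩
  · rintro j v ⟨hv, f, rfl⟩
    exact ⟨_, freeComponent_mem j f, map_freeComponent (R.d_single_mem i) freeFam_indep hv⟩
  · intro f hf
    obtain ⟨w, rfl⟩ := (R.exact_succ i f).1 hf
    exact R.constantCoeff_d (i + 1) w

theorem tor_imFam (n l i : ℕ) (h : l + i + 1 = n) (j : ℕ) :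
    (R.imFam l).tor i j = Fintype.card {k // R.deg n k = j} := by
  induction i generalizing l with
  | zero => subst h; exact (R.tor_imFam_step l).1 j
  | succ i ih => rw [(R.tor_imFam_step l).2, ih (l + 1) (by omega)]

/-- Dimension shifting, iterated along the images of the differentials. -/
theorem tor_eq_card [IsScalarTower K (MvPolynomial σ K) M] {𝓜 : GradedFamily σ K M}
    (h𝓜 : 𝓜.Indep) (R : MinimalGradedFreeResolution (σ := σ) 𝓜.obj) (i j : ℕ) :
    𝓜.tor i j = Fintype.card {k // R.deg i k = j} := by
  have h := tor_of_cover (𝓝 := 𝓜) (φ := R.ε) (deg := R.deg 0) ?_ ?_ ?_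
  · rcases i with _ | i
    · exact h.1 j
    · rw [h.2, ← R.tor_imFam (i + 1) 0 i (by omega)]
      refine GradedFamily.tor_eq_of_bijective LinearMap.id ?_ (fun _ _ _ h => h) ?_ i j
      · exact fun j v hv => ⟨hv.1, (R.exact_zero v).1 hv.2⟩
      · exact fun j v hv => ⟨v, ⟨hv.1, (R.exact_zero v).2 hv.2⟩, rfl⟩
  · exact fun j f hf => map_mem_of_single R.ε_homogeneous hf
  · intro j v hv
    obtain ⟨f, rfl⟩ := R.ε_surjective v
    exact ⟨_, freeComponent_mem j f, map_freeComponent R.ε_homogeneous h𝓜 hv⟩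
  · intro f hf
    obtain ⟨w, rfl⟩ := (R.exact_zero f).1 hf
    exact R.constantCoeff_d 0 w

end MinimalGradedFreeResolution

/-- The right side does not mention a resolution, so the choice made in `gradedBetti` is immaterial.
-/
theorem gradedBetti_eq_tor [Fintype σ] [LinearOrder σ] [IsScalarTower K (MvPolynomial σ K) M]
    {𝓜 : GradedFamily σ K M} (h𝓜 : 𝓜.Indep)
    (hR : Nonempty (MinimalGradedFreeResolution (σ := σ) 𝓜.obj)) (i j : ℕ) :
    (gradedBetti (σ := σ) 𝓜.obj i j : Cardinal.{u}) = 𝓜.tor i j := by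
  rw [gradedBetti, dif_pos hR, MinimalGradedFreeResolution.tor_eq_card h𝓜 hR.some]

/-! ### Existence of minimal graded free resolutions -/

section Existence

theorem exists_homogeneous_generators (𝓜 : GradedFamily σ K M)
    (N : Submodule (MvPolynomial σ K) M) (hfg : N.FG)
    (hN : ∀ f ∈ N, f ∈ Submodule.span (MvPolynomial σ K) {w | w ∈ N ∧ ∃ j, w ∈ 𝓜.obj j}) :
    ∃ (r : ℕ) (v : Fin r → M) (deg : Fin r → ℕ), (∀ k, v k ∈ 𝓜.obj (deg k)) ∧
      Submodule.span (MvPolynomial σ K) (Set.range v) = N := by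
  have hspan : Submodule.span (MvPolynomial σ K) {w | w ∈ N ∧ ∃ j, w ∈ 𝓜.obj j} = N :=
    le_antisymm (Submodule.span_le.2 fun w hw => hw.1) hN
  obtain ⟨s, hs, hs'⟩ := (Submodule.fg_span_iff_fg_span_finset_subset _).1 (hspan.symm ▸ hfg)
  have hdeg : ∀ k : Fin s.card, ∃ j, (s.equivFin.symm k : M) ∈ 𝓜.obj j := fun k =>
    (hs (s.equivFin.symm k).2).2
  choose deg hdeg using hdeg
  refine ⟨s.card, fun k => s.equivFin.symm k, deg, hdeg, ?_⟩
  rw [← hspan, hs']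
  congr 1
  ext w
  constructor
  · rintro ⟨k, rfl⟩
    exact (s.equivFin.symm k).2
  · intro hw
    exact ⟨s.equivFin ⟨w, hw⟩, by simp⟩

variable [IsScalarTower K (MvPolynomial σ K) M]

/-- A finite minimal homogeneous generating system. -/
theorem exists_minimal_cover {𝓜 : GradedFamily σ K M} (h𝓜 : 𝓜.Indep)
    (N : Submodule (MvPolynomial σ K) M)
    (hN : ∃ (r : ℕ) (v : Fin r → M) (deg : Fin r → ℕ), (∀ k, v k ∈ 𝓜.obj (deg k)) ∧
      Submodule.span (MvPolynomial σ K) (Set.range v) = N) :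
    ∃ (r : ℕ) (deg : Fin r → ℕ) (φ : (Fin r → MvPolynomial σ K) →ₗ[MvPolynomial σ K] M),
      (∀ k, φ (Pi.single k 1) ∈ 𝓜.obj (deg k)) ∧ LinearMap.range φ = N ∧
      ∀ f, φ f = 0 → ∀ k, constantCoeff (f k) = 0 := by
  classical
  -- A homogeneous generating system with the fewest elements.
  obtain ⟨r, ⟨v, deg, hv, hspan⟩, hmin⟩ := WellFounded.has_min wellFounded_lt
    {r : ℕ | ∃ (v : Fin r → M) (deg : Fin r → ℕ), (∀ k, v k ∈ 𝓜.obj (deg k)) ∧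
      Submodule.span (MvPolynomial σ K) (Set.range v) = N} hN
  let φ := Fintype.linearCombination (MvPolynomial σ K) v
  have hφ1 : ∀ k, φ (Pi.single k 1) = v k := fun k => by
    simp [φ, Fintype.linearCombination_apply_single]
  have hφ : ∀ k, φ (Pi.single k 1) ∈ 𝓜.obj (deg k) := fun k => by rw [hφ1]; exact hv k
  refine ⟨r, deg, φ, hφ, ?_, fun f hf k => ?_⟩
  · rw [Fintype.range_linearCombination, hspan]
  by_contra hk
  obtain ⟨r', hr'⟩ : ∃ r', r = r' + 1 := ⟨r - 1, by have := k.pos; omega⟩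
  subst hr'
  -- In degree `deg k` the coefficient at `k` of the relation is exactly its nonzero constant term,
  -- a unit; so `v k` is redundant, against the choice of `r`.
  have hg : φ (freeComponent K deg (deg k) f) = 0 :=
    (map_freeComponent hφ h𝓜 (by rw [hf]; exact zero_mem _)).trans hf
  set g := freeComponent K deg (deg k) f with hgdef
  have hgk : g k = C (constantCoeff (f k)) := by
    rw [hgdef, freeComponent, if_pos le_rfl, Nat.sub_self, homogeneousComponent_zero,
      constantCoeff_eq]
  have hvk : v k ∈ Submodule.span (MvPolynomial σ K) (Set.range (v ∘ k.succAbove)) := by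
    have h1 : g k • v k + ∑ l, g (k.succAbove l) • v (k.succAbove l) = 0 := by
      rw [← Fin.sum_univ_succAbove (fun l => g l • v l), ← hg]
      simp only [φ, Fintype.linearCombination_apply]
    have h2 : v k = (C (constantCoeff (f k))⁻¹ : MvPolynomial σ K) •
        (-∑ l, g (k.succAbove l) • v (k.succAbove l)) := by
      rw [← eq_neg_of_add_eq_zero_left h1, hgk, smul_smul, ← C_mul, inv_mul_cancel₀ hk, C_1,
        one_smul]
    rw [h2]
    refine Submodule.smul_mem _ _ (neg_mem (sum_mem fun l _ => Submodule.smul_mem _ _ ?_))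
    exact Submodule.subset_span ⟨l, rfl⟩
  refine hmin r' ⟨v ∘ k.succAbove, deg ∘ k.succAbove, fun l => hv _, ?_⟩ (Nat.lt_succ_self r')
  rw [← hspan]
  refine le_antisymm (Submodule.span_mono (Set.range_comp_subset_range _ _)) ?_
  rw [Submodule.span_le]
  rintro _ ⟨l, rfl⟩
  rcases Fin.eq_self_or_eq_succAbove k l with rfl | ⟨l', rfl⟩
  · exact hvk
  · exact Submodule.subset_span ⟨l', rfl⟩

variable (σ K) in
/-- A syzygy module: a homogeneous submodule of a graded free module. -/
structure SyzygyStage where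
  /-- the rank of the free module -/
  rank : ℕ
  /-- the degrees of the basis elements -/
  deg : Fin rank → ℕ
  /-- the submodule -/
  N : Submodule (MvPolynomial σ K) (Fin rank → MvPolynomial σ K)
  constantCoeff_eq_zero : ∀ f ∈ N, ∀ k, constantCoeff (f k) = 0
  component_mem : ∀ f ∈ N, ∀ j, freeComponent K deg j f ∈ N

theorem ker_component_mem {𝓜 : GradedFamily σ K M} (h𝓜 : 𝓜.Indep) {r : ℕ} {deg : Fin r → ℕ}
    {φ : (Fin r → MvPolynomial σ K) →ₗ[MvPolynomial σ K] M}
    (hφ : ∀ k, φ (Pi.single k 1) ∈ 𝓜.obj (deg k)) (f) (hf : f ∈ LinearMap.ker φ) (j : ℕ) :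
    freeComponent K deg j f ∈ LinearMap.ker φ := by
  rw [LinearMap.mem_ker] at hf ⊢
  rw [map_freeComponent hφ h𝓜 (by rw [hf]; exact zero_mem _), hf]

theorem SyzygyStage.exists_next [Finite σ] (t : SyzygyStage σ K) :
    ∃ (t' : SyzygyStage σ K)
      (φ : (Fin t'.rank → MvPolynomial σ K) →ₗ[MvPolynomial σ K] (Fin t.rank → MvPolynomial σ K)),
      (∀ k, φ (Pi.single k 1) ∈ (freeFam K t.deg).obj (t'.deg k)) ∧
      LinearMap.range φ = t.N ∧ LinearMap.ker φ = t'.N := by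
  obtain ⟨r, deg, φ, h1, h2, h3⟩ := exists_minimal_cover (freeFam_indep (deg := t.deg)) t.N
    (exists_homogeneous_generators (freeFam K t.deg) t.N (IsNoetherian.noetherian t.N) (by
      intro f hf
      obtain ⟨n, hn⟩ := sum_freeComponent (K := K) (deg := t.deg) f
      rw [← hn n le_rfl]
      exact sum_mem fun j _ => Submodule.subset_span
        ⟨t.component_mem f hf j, j, freeComponent_mem j f⟩))
  exact ⟨⟨r, deg, LinearMap.ker φ, h3, ker_component_mem freeFam_indep h1⟩, φ, h1, h2, rfl⟩

/-- Minimal graded free resolutions exist. -/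
theorem nonempty_minimalGradedFreeResolution [Finite σ] {𝓜 : GradedFamily σ K M}
    (h𝓜 : 𝓜.Indep)
    (hN : ∃ (r : ℕ) (v : Fin r → M) (deg : Fin r → ℕ), (∀ k, v k ∈ 𝓜.obj (deg k)) ∧
      Submodule.span (MvPolynomial σ K) (Set.range v) = ⊤) :
    Nonempty (MinimalGradedFreeResolution (σ := σ) 𝓜.obj) := by
  obtain ⟨r, deg, ε, h1, h2, h3⟩ := exists_minimal_cover h𝓜 ⊤ hN
  -- The kernel of each cover is the module covered at the next stage, so exactness holds by
  -- construction.
  choose next φ hφ1 hφ2 hφ3 using SyzygyStage.exists_next (σ := σ) (K := K)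
  let st : ℕ → SyzygyStage σ K := fun n => Nat.rec
    ⟨r, deg, LinearMap.ker ε, h3, ker_component_mem h𝓜 h1⟩ (fun _ t => next t) n
  exact ⟨{
    rank := fun i => (st i).rank
    deg := fun i => (st i).deg
    d := fun i => φ (st i)
    ε := ε
    ε_homogeneous := h1
    d_homogeneous := fun i k l => mem_freeFam_iff_zero_or.1 (hφ1 (st i) k) l
    minimal := fun i k l => (st i).constantCoeff_eq_zero _
      ((hφ2 (st i)).le ⟨Pi.single k 1, rfl⟩) l
    ε_surjective := LinearMap.range_eq_top.1 h2
    exact_zero := LinearMap.exact_iff.2 (hφ2 (st 0)).symm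
    exact_succ := fun i => LinearMap.exact_iff.2 ((hφ3 (st i)).trans (hφ2 (st (i + 1))).symm) }⟩

end Existence

/-! ### Projective dimension as the length of a minimal resolution -/

section ProjectiveDimension

namespace MinimalGradedFreeResolution

variable {𝓜₀ : ℕ → Submodule K M} (R : MinimalGradedFreeResolution (σ := σ) 𝓜₀)

/-- The cover of a syzygy module by the next free module of the resolution. -/
noncomputable def cover {C : Type u} [AddCommGroup C] [Module (MvPolynomial σ K) C] {q : ℕ}
    (b : (Fin (R.rank q) → MvPolynomial σ K) →ₗ[MvPolynomial σ K] C)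
    (hb : Function.Exact (R.d q) b) :
    (Fin (R.rank (q + 1)) → MvPolynomial σ K) →ₗ[MvPolynomial σ K] LinearMap.ker b :=
  (R.d q).codRestrict _ fun f => (hb _).2 ⟨f, rfl⟩

variable {C : Type u} [AddCommGroup C] [Module (MvPolynomial σ K) C] {q : ℕ}
    {b : (Fin (R.rank q) → MvPolynomial σ K) →ₗ[MvPolynomial σ K] C}

theorem cover_surjective (hb : Function.Exact (R.d q) b) :
    Function.Surjective (R.cover b hb) := by
  rintro ⟨f, hf⟩
  obtain ⟨w, rfl⟩ := (hb _).1 hf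
  exact ⟨w, rfl⟩

theorem cover_exact (hb : Function.Exact (R.d q) b) :
    Function.Exact (R.d (q + 1)) (R.cover b hb) := by
  intro f
  rw [← R.exact_succ q f]
  exact ⟨fun h => congrArg Subtype.val h, fun h => Subtype.ext h⟩

instance projective_free (q : ℕ) :
    Projective (ModuleCat.of (MvPolynomial σ K) (Fin (R.rank q) → MvPolynomial σ K)) :=
  (IsProjective.iff_projective _).1 inferInstance

/-- Induction on `n`, replacing `C` by its syzygy `ker b`; hence the arbitrary starting place `q`.
-/
theorem hasProjectiveDimensionLT (n : ℕ) {C : Type u} [AddCommGroup C]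
    [Module (MvPolynomial σ K) C] {q : ℕ}
    {b : (Fin (R.rank q) → MvPolynomial σ K) →ₗ[MvPolynomial σ K] C}
    (hb : Function.Exact (R.d q) b) (hb' : Function.Surjective b)
    (hn : R.rank (q + n) = 0) :
    HasProjectiveDimensionLT (ModuleCat.of (MvPolynomial σ K) C) n := by
  induction n generalizing q C with
  | zero =>
    have : IsEmpty (Fin (R.rank q)) := by
      rw [add_zero] at hn
      rw [hn]; infer_instance
    have : Subsingleton C := hb'.subsingleton
    exact (ModuleCat.isZero_of_subsingleton _).hasProjectiveDimensionLT_zero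
  | succ n ih =>
    have h1 := ih (R.cover_exact hb) (R.cover_surjective hb) (by rw [← hn]; congr 1; omega)
    have := R.projective_free q
    exact (b.shortExact_shortComplexKer hb').hasProjectiveDimensionLT_X₃ n h1
      (hasProjectiveDimensionLT_of_ge _ 1 _ (by omega))

/-- If `C` is projective, `ker b` is a direct summand of the free module, with projection `ρ`. Then
`z = d e_k`, whose entries have no constant terms, is also the image of `∑ z_l w_l`. The difference
`e_k - ∑ z_l w_l` is a cycle with constant term 1 at `k`, which minimality of the next differential
forbids. -/
theorem rank_eq_zero_of_projective (hb : Function.Exact (R.d q) b) (hb' : Function.Surjective b)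
    [Module.Projective (MvPolynomial σ K) C] : R.rank (q + 1) = 0 := by
  by_contra h0
  let k : Fin (R.rank (q + 1)) := ⟨0, Nat.pos_of_ne_zero h0⟩
  obtain ⟨t, ht⟩ := Module.projective_lifting_property b LinearMap.id hb'
  let ρ : (Fin (R.rank q) → MvPolynomial σ K) →ₗ[MvPolynomial σ K]
      (Fin (R.rank q) → MvPolynomial σ K) := LinearMap.id - t ∘ₗ b
  have hρ : ∀ f, ∃ w, R.d q w = ρ f := fun f => (hb _).1 (by
    have := LinearMap.congr_fun ht (b f)
    simp only [LinearMap.comp_apply, LinearMap.id_apply] at this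
    simp [ρ, this])
  choose w hw using fun l => hρ (Pi.single l 1)
  set z := R.d q (Pi.single k 1) with hz
  have hbz : b z = 0 := (hb z).2 ⟨_, rfl⟩
  have h1 : R.d q (∑ l, z l • w l) = z := by
    calc R.d q (∑ l, z l • w l) = ∑ l, z l • ρ (Pi.single l 1) := by simp [map_sum, hw]
      _ = ρ z := (map_eq_sum ρ z).symm
      _ = z := by simp [ρ, hbz]
  obtain ⟨y, hy⟩ := (R.exact_succ q (Pi.single k 1 - ∑ l, z l • w l)).1 (by
    rw [map_sub, h1, ← hz, sub_self])
  have h2 := R.constantCoeff_d (q + 1) y k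
  rw [hy, Pi.sub_apply, Pi.single_eq_same, map_sub, map_one, Finset.sum_apply, map_sum,
    Finset.sum_eq_zero] at h2
  · simp at h2
  · intro l _
    rw [Pi.smul_apply, smul_eq_mul, map_mul, hz, R.constantCoeff_d, zero_mul]

theorem rank_eq_zero_of_hasProjectiveDimensionLT (n : ℕ) {C : Type u} [AddCommGroup C]
    [Module (MvPolynomial σ K) C] {q : ℕ}
    {b : (Fin (R.rank q) → MvPolynomial σ K) →ₗ[MvPolynomial σ K] C}
    (hb : Function.Exact (R.d q) b) (hb' : Function.Surjective b)
    (hC : HasProjectiveDimensionLT (ModuleCat.of (MvPolynomial σ K) C) (n + 1)) :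
    R.rank (q + n + 1) = 0 := by
  induction n generalizing q C with
  | zero =>
    have h1 : Projective (ModuleCat.of (MvPolynomial σ K) C) :=
      projective_iff_hasProjectiveDimensionLT_one.2 hC
    have : Module.Projective (MvPolynomial σ K) C := (IsProjective.iff_projective _).2 h1
    exact R.rank_eq_zero_of_projective hb hb'
  | succ n ih =>
    have h1 := ((b.shortExact_shortComplexKer hb').hasProjectiveDimensionLT_X₃_iff n
      (R.projective_free q)).1 hC
    have h2 := ih (R.cover_exact hb) (R.cover_surjective hb) h1
    rw [← h2]; congr 1; omega

theorem projdim_eq {p : ℕ} (hp : p ≠ 0) (h1 : R.rank p ≠ 0) (h2 : R.rank (p + 1) = 0) :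
    projdim (MvPolynomial σ K) M = (p : ℕ∞) := by
  obtain ⟨n, rfl⟩ := Nat.exists_eq_succ_of_ne_zero hp
  refine le_antisymm ?_ ?_
  · refine (projectiveDimension_le_iff _ _).2
      (R.hasProjectiveDimensionLT _ R.exact_zero R.ε_surjective ?_)
    rwa [zero_add]
  · refine (projectiveDimension_ge_iff _ _).2 fun h => h1 ?_
    have := R.rank_eq_zero_of_hasProjectiveDimensionLT n R.exact_zero R.ε_surjective h
    rwa [zero_add] at this

end MinimalGradedFreeResolution

end ProjectiveDimension

end Resolution

/-! ### Betti numbers and projective dimension of `S/I` and `I` via Koszul homology -/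

section BettiTor

variable {σ : Type} {K : Type u} [Field K]

theorem subq_top_obj (I : Ideal (MvPolynomial σ K)) :
    (subq ⊤ I).obj = quotientGrading I := by
  funext j
  change Submodule.map _ (_ ⊓ _) = Submodule.map _ _
  rw [Submodule.restrictScalars_top, top_inf_eq]

theorem subq_top_indep {I : Ideal (MvPolynomial σ K)} (hI : IsHomog I) : (subq ⊤ I).Indep := by
  intro s v hv hs l hl
  choose a _ ha hav using fun l => mem_subq.1 (hv l)
  have h1 : ∑ l ∈ s, a l ∈ I := by
    rw [← Ideal.Quotient.eq_zero_iff_mem, map_sum, ← hs]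
    exact Finset.sum_congr rfl fun l _ => hav l
  have h2 := hI.component_mem h1 l
  rw [map_sum, Finset.sum_eq_single l] at h2
  · rw [← hav, Ideal.Quotient.eq_zero_iff_mem]
    rwa [homogeneousComponent_eq_self (ha l)] at h2
  · intro l' _ hl'
    rw [homogeneousComponent_of_mem (ha l'), if_neg (Ne.symm hl')]
  · exact fun h => absurd hl h

theorem nonempty_resolution_quotient [Finite σ] {I : Ideal (MvPolynomial σ K)} (hI : IsHomog I) :
    Nonempty (MinimalGradedFreeResolution (σ := σ) (subq ⊤ I).obj) := by
  refine nonempty_minimalGradedFreeResolution (subq_top_indep hI)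
    ⟨1, fun _ => 1, fun _ => 0,
      fun _ => mem_subq.2 ⟨1, trivial, isHomogeneous_one σ K, map_one _⟩, ?_⟩
  rw [eq_top_iff]
  rintro v -
  obtain ⟨a, rfl⟩ := Ideal.Quotient.mk_surjective v
  have : (Ideal.Quotient.mk I a) = a • (1 : MvPolynomial σ K ⧸ I) := by
    change _ = Ideal.Quotient.mk I (a * 1)
    rw [mul_one]
  rw [this]
  exact Submodule.smul_mem _ _ (Submodule.subset_span ⟨0, rfl⟩)

/-- The standard grading of a homogeneous ideal. -/
noncomputable def idealFam (I : Ideal (MvPolynomial σ K)) : GradedFamily σ K I where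
  obj := idealGrading I
  X_smul_mem s j v hv := by
    have := (isHomogeneous_X K s).mul (show (v : MvPolynomial σ K).IsHomogeneous j from hv)
    rw [add_comm] at this
    exact this

theorem mem_idealFam {I : Ideal (MvPolynomial σ K)} {j : ℕ} {v : I} :
    v ∈ (idealFam I).obj j ↔ (v : MvPolynomial σ K).IsHomogeneous j := Iff.rfl

theorem idealFam_indep {I : Ideal (MvPolynomial σ K)} : (idealFam I).Indep := by
  intro s v hv hs l hl
  have h2 := congrArg (fun w : I => homogeneousComponent l (w : MvPolynomial σ K)) hs
  simp only [AddSubmonoidClass.coe_finsetSum, map_sum] at h2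
  rw [Finset.sum_eq_single l] at h2
  · rw [homogeneousComponent_eq_self (mem_idealFam.1 (hv l))] at h2
    exact Subtype.ext (h2.trans (map_zero _))
  · intro l' _ hl'
    rw [homogeneousComponent_of_mem (show (v l' : MvPolynomial σ K) ∈ homogeneousSubmodule σ K l'
      from hv l'), if_neg (Ne.symm hl')]
  · exact fun h => absurd hl h

theorem nonempty_resolution_ideal [Finite σ] {I : Ideal (MvPolynomial σ K)} (hI : IsHomog I) :
    Nonempty (MinimalGradedFreeResolution (σ := σ) (idealFam I).obj) := by
  refine nonempty_minimalGradedFreeResolution idealFam_indep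
    (exists_homogeneous_generators _ _ (IsNoetherian.noetherian _) ?_)
  rintro ⟨f, hf⟩ -
  have : (⟨f, hf⟩ : I) = ∑ j ∈ Finset.range (f.totalDegree + 1),
      ⟨homogeneousComponent j f, hI.component_mem hf j⟩ := by
    refine Subtype.ext ?_
    rw [AddSubmonoidClass.coe_finsetSum]
    exact (sum_homogeneousComponent f).symm
  rw [this]
  exact sum_mem fun j _ => Submodule.subset_span
    ⟨trivial, j, mem_idealFam.2 (homogeneousComponent_isHomogeneous j f)⟩

variable [Fintype σ] [LinearOrder σ]

theorem bettiQuotient_eq {I : Ideal (MvPolynomial σ K)} (hI : IsHomog I) (i j : ℕ) :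
    (bettiQuotient I i j : Cardinal.{u}) = (subq ⊤ I).tor i j := by
  rw [bettiQuotient, ← subq_top_obj]
  exact gradedBetti_eq_tor (subq_top_indep hI) (nonempty_resolution_quotient hI) i j

theorem tor_top_bot {i j : ℕ} (h : i ≠ 0 ∨ j ≠ 0) :
    (subq (⊤ : Ideal (MvPolynomial σ K)) ⊥).tor i j = 0 := by
  rw [tor_top_bot_eq, tor_polyFam h]

theorem tor_top_bot_zero : (subq (⊤ : Ideal (MvPolynomial σ K)) ⊥).tor 0 0 = 1 := by
  have h1 : (polyFam σ K).tor 0 0 = (freeFam (σ := σ) K (fun _ : Fin 1 => 0)).tor 0 0 := by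
    refine GradedFamily.tor_eq_of_bijective
      (LinearMap.pi fun _ : Fin 1 => (LinearMap.id : MvPolynomial σ K →ₗ[_] _)) ?_ ?_ ?_ 0 0
    · intro j v hv k d hd
      exact isHomogeneous_iff_degree.1 hv d hd
    · intro j v _ h0
      exact congrFun h0 0
    · intro j v hv
      refine ⟨v 0, isHomogeneous_iff_degree.2 fun d hd => hv 0 d hd, ?_⟩
      funext k
      rw [Subsingleton.elim k 0]
      rfl
  rw [tor_top_bot_eq, h1, tor_freeFam_zero]
  simp

/-- Dimension shifting along `0 → I → S → S/I → 0`; position `(0, 0)` is excluded because `S` has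
homology there. -/
theorem tor_ideal {I : Ideal (MvPolynomial σ K)} {i j : ℕ} (h : i ≠ 0 ∨ j ≠ 0) :
    (subq I ⊥).tor i j = (subq ⊤ I).tor (i + 1) j :=
  ((subq_exact_of_le bot_le le_top).tor_right_eq_left
    (tor_top_bot (Or.inl (Nat.succ_ne_zero i))) (tor_top_bot h)).symm

theorem bettiIdeal_eq {I : Ideal (MvPolynomial σ K)} (hI : IsHomog I) (i j : ℕ)
    (h : i ≠ 0 ∨ j ≠ 0) : (bettiIdeal I i j : Cardinal.{u}) = (subq ⊤ I).tor (i + 1) j := by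
  have h1 : (bettiIdeal I i j : Cardinal.{u}) = (idealFam I).tor i j :=
    gradedBetti_eq_tor idealFam_indep (nonempty_resolution_ideal hI) i j
  rw [h1, ← tor_ideal h]
  refine GradedFamily.tor_eq_of_bijective
    ((Submodule.mkQ (⊥ : Ideal (MvPolynomial σ K))) ∘ₗ I.subtype) ?_ ?_ ?_ i j
  · exact fun j v hv => mem_subq.2 ⟨v, v.2, hv, rfl⟩
  · exact fun j v _ h0 => Subtype.ext (Ideal.Quotient.eq_zero_iff_mem.1 h0)
  · intro j v hv
    obtain ⟨a, ha, ha', rfl⟩ := mem_subq.1 hv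
    exact ⟨⟨a, ha⟩, ha', rfl⟩

theorem projdim_quotient {I : Ideal (MvPolynomial σ K)} (hI : IsHomog I) {p : ℕ} (hp : p ≠ 0)
    {j : ℕ} (h1 : (subq ⊤ I).tor p j ≠ 0) (h2 : ∀ j, (subq ⊤ I).tor (p + 1) j = 0) :
    projdim (MvPolynomial σ K) (MvPolynomial σ K ⧸ I) = (p : ℕ∞) := by
  obtain ⟨R⟩ := nonempty_resolution_quotient hI
  refine R.projdim_eq hp ?_ ?_
  · intro h
    rw [MinimalGradedFreeResolution.tor_eq_card (subq_top_indep hI) R] at h1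
    have : IsEmpty (Fin (R.rank p)) := by rw [h]; infer_instance
    simp at h1
  · by_contra h
    let k : Fin (R.rank (p + 1)) := ⟨0, Nat.pos_of_ne_zero h⟩
    have h3 := h2 (R.deg (p + 1) k)
    rw [MinimalGradedFreeResolution.tor_eq_card (subq_top_indep hI) R, Nat.cast_eq_zero,
      Fintype.card_eq_zero_iff] at h3
    exact h3.false ⟨k, rfl⟩

omit [Fintype σ] [LinearOrder σ] in
theorem projdim_ideal_add_one {I : Ideal (MvPolynomial σ K)} {p : ℕ} (hp : p ≠ 0)
    (h : projdim (MvPolynomial σ K) (MvPolynomial σ K ⧸ I) = (p : ℕ∞)) :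
    projdim (MvPolynomial σ K) I + 1 = (p : ℕ∞) := by
  obtain ⟨n, rfl⟩ := Nat.exists_eq_succ_of_ne_zero hp
  let T := ModuleCat.shortComplexOfCompEqZero I.subtype I.mkQ
    (LinearMap.ext fun v => Ideal.Quotient.eq_zero_iff_mem.2 v.2)
  have hT : T.ShortExact := ModuleCat.shortComplex_shortExact T
    (LinearMap.exact_iff.2 (by simp [T])) I.injective_subtype I.mkQ_surjective
  have hproj : Projective T.X₂ := (IsProjective.iff_projective _).1 inferInstance
  have h1 : HasProjectiveDimensionLT T.X₁ (n + 1) :=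
    (hT.hasProjectiveDimensionLT_X₃_iff n hproj).1 ((projectiveDimension_le_iff _ (n + 1)).1 h.le)
  have h2 : ¬ HasProjectiveDimensionLT T.X₁ n := fun h3 =>
    (projectiveDimension_ge_iff _ (n + 1)).1 h.ge
      (hT.hasProjectiveDimensionLT_X₃ n h3 (hasProjectiveDimensionLT_of_ge _ 1 _ (by omega)))
  have h3 : projdim (MvPolynomial σ K) I = (n : ℕ∞) :=
    le_antisymm ((projectiveDimension_le_iff _ n).2 h1) ((projectiveDimension_ge_iff _ n).2 h2)
  rw [h3]
  rfl

end BettiTor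

/-! ### The ideal of 2-minors as a toric ideal, and its Gröbner basis -/

section ToricMap

theorem aeval_monomial_one_eq_sum {σ τ : Type*} {K : Type*} [Field K] (e : σ → τ →₀ ℕ)
    (f : MvPolynomial σ K) :
    aeval (fun s => monomial (e s) (1 : K)) f =
      ∑ d ∈ f.support, monomial (d.sum fun s k => k • e s) (coeff d f) := by
  conv_lhs => rw [f.as_sum]
  rw [map_sum]
  refine Finset.sum_congr rfl fun d _ => ?_
  rw [aeval_monomial, algebraMap_eq, Finsupp.prod, Finsupp.sum]
  simp only [monomial_pow, one_pow]
  rw [← monomial_sum_one, C_mul_monomial, mul_one]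

/-- The map sends terms to terms, so a term can only be cancelled by another one with the same
image. -/
theorem exists_ne_of_aeval_monomial_one_eq_zero {σ τ : Type*} {K : Type*} [Field K]
    {e : σ → τ →₀ ℕ} {f : MvPolynomial σ K} (hf : aeval (fun s => monomial (e s) (1 : K)) f = 0)
    {d : σ →₀ ℕ} (hd : d ∈ f.support) :
    ∃ d' ∈ f.support, d' ≠ d ∧
      (d'.sum fun s k => k • e s) = d.sum fun s k => k • e s := by
  classical
  by_contra! h
  have h1 := congrArg (coeff (d.sum fun s k => k • e s)) hf
  rw [aeval_monomial_one_eq_sum, coeff_sum, coeff_zero,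
    Finset.sum_eq_single_of_mem d hd fun d' hd' hne => by
      rw [coeff_monomial, if_neg (h d' hd' hne)], coeff_monomial, if_pos rfl] at h1
  exact mem_support_iff.1 hd h1

variable {V : Type}

theorem inl_ne_inr (v w : V) : (Sum.inlₗ v : Vars V) ≠ Sum.inrₗ w := by
  intro h; exact Sum.inl_ne_inr (toLex.injective h)

theorem inl_inj {v w : V} : (Sum.inlₗ v : Vars V) = Sum.inlₗ w ↔ v = w :=
  toLex.injective.eq_iff.trans Sum.inl_injective.eq_iff

theorem inr_inj {v w : V} : (Sum.inrₗ v : Vars V) = Sum.inrₗ w ↔ v = w :=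
  toLex.injective.eq_iff.trans Sum.inr_injective.eq_iff

theorem sum_vars [Fintype V] {M : Type*} [AddCommMonoid M] [Fintype (Vars V)] (f : Vars V → M) :
    ∑ s, f s = ∑ v, f (Sum.inlₗ v) + ∑ v, f (Sum.inrₗ v) := by
  rw [← Fintype.sum_equiv (toLex : V ⊕ V ≃ Vars V) (fun s => f (toLex s)) f (fun _ => rfl),
    Fintype.sum_sum_type]

variable [LinearOrder V]

/-- The exponents of the images of the variables under the map `x_v ↦ s t_v`, `y_v ↦ t_v` for
`v ∈ W`; the variable `s` has index `none`. -/
noncomputable def toricExp (W : Finset V) (s : Vars V) : Option (Vars V) →₀ ℕ :=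
  Sum.elim
    (fun v => if v ∈ W then Finsupp.single none 1 + Finsupp.single (some (Sum.inrₗ v)) 1
      else Finsupp.single (some (Sum.inlₗ v)) 1)
    (fun v => Finsupp.single (some (Sum.inrₗ v)) 1) (ofLex s)

theorem toricExp_inl (W : Finset V) (v : V) : toricExp W (Sum.inlₗ v) =
    if v ∈ W then Finsupp.single none 1 + Finsupp.single (some (Sum.inrₗ v)) 1
      else Finsupp.single (some (Sum.inlₗ v)) 1 := rfl

theorem toricExp_inr (W : Finset V) (v : V) :
    toricExp W (Sum.inrₗ v) = Finsupp.single (some (Sum.inrₗ v)) 1 := rfl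

variable {K : Type u} [Field K]

/-- The generator `x_i y_j - x_j y_i`. -/
noncomputable abbrev binom (K : Type u) [Field K] (i j : V) : PolyRing K V :=
  x K i * y K j - x K j * y K i

/-- The ideal of maximal minors of the generic `2 × W` matrix. -/
noncomputable def genericIdeal (K : Type u) [Field K] (W : Finset V) : Ideal (PolyRing K V) :=
  Ideal.span {f | ∃ i ∈ W, ∃ j ∈ W, i < j ∧ f = binom K i j}

theorem binom_mem_genericIdeal {W : Finset V} {i j : V} (hi : i ∈ W) (hj : j ∈ W) (h : i < j) :
    binom K i j ∈ genericIdeal K W :=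
  Ideal.subset_span ⟨i, hi, j, hj, h, rfl⟩

theorem binom_mem_genericIdeal' {W : Finset V} {i j : V} (hi : i ∈ W) (hj : j ∈ W) :
    binom K i j ∈ genericIdeal K W := by
  rcases lt_trichotomy i j with h | rfl | h
  · exact binom_mem_genericIdeal hi hj h
  · simp [binom]
  · rw [binom, ← neg_sub]
    exact neg_mem (binom_mem_genericIdeal hj hi h)

/-- The map `x_v ↦ s t_v`, `y_v ↦ t_v` for `v ∈ W`. -/
noncomputable def toricMap (K : Type u) [Field K] (W : Finset V) :
    PolyRing K V →ₐ[K] MvPolynomial (Option (Vars V)) K :=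
  aeval fun s => monomial (toricExp W s) 1

theorem toricMap_binom {W : Finset V} {i j : V} (hi : i ∈ W) (hj : j ∈ W) :
    toricMap K W (binom K i j) = 0 := by
  simp only [toricMap, binom, x, y, map_sub, map_mul, aeval_X, toricExp_inl, toricExp_inr, if_pos hi,
    if_pos hj, monomial_mul]
  rw [sub_eq_zero, add_right_comm]

theorem toricMap_eq_zero_of_mem {W : Finset V} {f : PolyRing K V} (hf : f ∈ genericIdeal K W) :
    toricMap K W f = 0 := by
  have : genericIdeal K W ≤ RingHom.ker (toricMap K W) := by
    refine Ideal.span_le.2 ?_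
    rintro _ ⟨i, hi, j, hj, _, rfl⟩
    exact toricMap_binom hi hj
  exact this hf

variable [Fintype V]

/-- This and the next two formulas list what monomials with equal image share: the total `x`-degree
on `W`, the exponent of `x_v` for `v ∉ W`, and the column degrees. -/
theorem toricExp_sum_none (W : Finset V) (d : Vars V →₀ ℕ) :
    (d.sum fun s k => k • toricExp W s) none = ∑ v ∈ W, d (Sum.inlₗ v) := by
  classical
  let _ : Fintype (Vars V) := Fintype.ofFinite _
  rw [Finsupp.sum_fintype d (fun s k => k • toricExp W s) (fun _ => zero_smul _ _), sum_vars, Finsupp.add_apply,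
    Finsupp.finsetSum_apply, Finsupp.finsetSum_apply]
  simp only [toricExp_inl, toricExp_inr, Finsupp.smul_apply]
  rw [← Finset.sum_filter_add_sum_filter_not Finset.univ (· ∈ W)]
  rw [Finset.sum_congr rfl (g := fun v => d (Sum.inlₗ v))
      (by intro v hv; rw [if_pos (Finset.mem_filter.1 hv).2]; simp),
    Finset.sum_eq_zero (s := Finset.univ.filter (· ∉ W))
      (by intro v hv; rw [if_neg (Finset.mem_filter.1 hv).2]; simp)]
  simp

theorem toricExp_sum_inl {W : Finset V} {v : V} (hv : v ∉ W) (d : Vars V →₀ ℕ) :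
    (d.sum fun s k => k • toricExp W s) (some (Sum.inlₗ v)) = d (Sum.inlₗ v) := by
  classical
  let _ : Fintype (Vars V) := Fintype.ofFinite _
  rw [Finsupp.sum_fintype d (fun s k => k • toricExp W s) (fun _ => zero_smul _ _), sum_vars, Finsupp.add_apply,
    Finsupp.finsetSum_apply, Finsupp.finsetSum_apply, Finset.sum_eq_single v]
  · simp [toricExp_inl, toricExp_inr, hv]
  · intro w _ hw
    rw [toricExp_inl]
    split_ifs <;> simp [hw]
  · simp

theorem toricExp_sum_inr (W : Finset V) (v : V) (d : Vars V →₀ ℕ) :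
    (d.sum fun s k => k • toricExp W s) (some (Sum.inrₗ v)) =
      (if v ∈ W then d (Sum.inlₗ v) else 0) + d (Sum.inrₗ v) := by
  classical
  let _ : Fintype (Vars V) := Fintype.ofFinite _
  rw [Finsupp.sum_fintype d (fun s k => k • toricExp W s) (fun _ => zero_smul _ _), sum_vars, Finsupp.add_apply,
    Finsupp.finsetSum_apply, Finsupp.finsetSum_apply]
  congr 1
  · rw [Finset.sum_eq_single v]
    · rw [toricExp_inl]
      split_ifs <;> simp
    · intro w _ hw
      rw [toricExp_inl]
      split_ifs <;> simp [hw]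
    · simp
  · rw [Finset.sum_eq_single v]
    · simp [toricExp_inr]
    · intro w _ hw
      simp [toricExp_inr, hw]
    · simp

open MonomialOrder in
/-- A nonzero element of the kernel of the toric map has its leading monomial divisible by some
`x_i y_j` with `i < j` in `W`. -/
theorem exists_lt_of_toricMap_eq_zero {W : Finset V} {f : PolyRing K V}
    (hf : toricMap K W f = 0) (h0 : f ≠ 0) :
    ∃ i ∈ W, ∃ j ∈ W, i < j ∧ (MonomialOrder.lex.degree f) (Sum.inlₗ i) ≠ 0 ∧
      (MonomialOrder.lex.degree f) (Sum.inrₗ j) ≠ 0 := by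
  obtain ⟨ν, hν, hne, hπ⟩ :=
    exists_ne_of_aeval_monomial_one_eq_zero hf (MonomialOrder.lex.degree_mem_support h0)
  have hle := MonomialOrder.lex.le_degree hν
  set μ := (MonomialOrder.lex.degree f : Vars V →₀ ℕ)
  have hlt : ν ≺[lex] μ := lt_of_le_of_ne hle fun h => hne (lex.toSyn.injective h)
  have hinl : ∀ v ∉ W, ν (Sum.inlₗ v) = μ (Sum.inlₗ v) := fun v hv => by
    rw [← toricExp_sum_inl hv, hπ, toricExp_sum_inl hv]
  have hinr : ∀ v, (if v ∈ W then ν (Sum.inlₗ v) else 0) + ν (Sum.inrₗ v) =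
      (if v ∈ W then μ (Sum.inlₗ v) else 0) + μ (Sum.inrₗ v) := fun v => by
    rw [← toricExp_sum_inr, hπ, toricExp_sum_inr]
  have hnone : ∑ v ∈ W, ν (Sum.inlₗ v) = ∑ v ∈ W, μ (Sum.inlₗ v) := by
    rw [← toricExp_sum_none, hπ, toricExp_sum_none]
  obtain ⟨k, hk, hk'⟩ := Finsupp.Lex.lt_iff.1 (MonomialOrder.lex_lt_iff.1 hlt)
  change ∀ j, j < k → ν j = μ j at hk
  change ν k < μ k at hk'
  obtain ⟨k | k, rfl⟩ := (toLex : V ⊕ V ≃ Vars V).surjective k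
  · change ν (Sum.inlₗ k) < μ (Sum.inlₗ k) at hk'
    have hkW : k ∈ W := by
      by_contra h
      exact hk'.ne (hinl k h)
    -- The `x`-degrees on `W` agree, so the deficit of `ν` at `x_k` is made up at some `x_j`, and `j
    -- > k` because `k` is the first difference.
    obtain ⟨j, hj, hj'⟩ : ∃ j ∈ W, μ (Sum.inlₗ j) < ν (Sum.inlₗ j) := by
      by_contra! h
      exact (Finset.sum_lt_sum h ⟨k, hkW, hk'⟩).ne hnone
    have h1 : k < j := by
      rcases lt_trichotomy k j with h | rfl | h
      · exact h
      · omega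
      · exact absurd (hk (Sum.inlₗ j) (Sum.Lex.inl_lt_inl_iff.2 h)) hj'.ne'
    -- Equal degrees in column `j` force `y_j` to divide the leading monomial.
    have h2 := hinr j
    rw [if_pos hj, if_pos hj] at h2
    exact ⟨k, hkW, j, hj, h1, by omega, by omega⟩
  -- A first difference at `y_k` is impossible: the exponents of `x_k` agree, hence so do those of
  -- `y_k`.
  · change ν (Sum.inrₗ k) < μ (Sum.inrₗ k) at hk'
    have h1 := hk (Sum.inlₗ k) (Sum.Lex.inl_lt_inr k k)
    have h2 := hinr k
    rw [h1] at h2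
    omega

open MonomialOrder in
theorem degree_binom {i j : V} (h : i < j) : lex.degree (binom K i j) =
    Finsupp.single (Sum.inlₗ i) 1 + Finsupp.single (Sum.inrₗ j) 1 := by
  classical
  have hd : ∀ a b : V, lex.degree (x K a * y K b) =
      Finsupp.single (Sum.inlₗ a) 1 + Finsupp.single (Sum.inrₗ b) 1 := fun a b => by
    rw [x, y, degree_mul (X_ne_zero _) (X_ne_zero _), degree_X, degree_X]
  rw [degree_sub_of_lt, hd]
  rw [hd, hd, lex_lt_iff]
  refine Finsupp.Lex.lt_iff.2 ⟨Sum.inlₗ i, fun s hs => ?_, ?_⟩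
  · obtain ⟨s | s, rfl⟩ := (toLex : V ⊕ V ≃ Vars V).surjective s
    · have h1 : s < i := Sum.Lex.inl_lt_inl_iff.1 hs
      change (Finsupp.single (Sum.inlₗ j) 1 + Finsupp.single (Sum.inrₗ i) 1 : Vars V →₀ ℕ)
        (Sum.inlₗ s) = (Finsupp.single (Sum.inlₗ i) 1 + Finsupp.single (Sum.inrₗ j) 1 :
          Vars V →₀ ℕ) (Sum.inlₗ s)
      simp [h1.ne', (h1.trans h).ne']
    · exact absurd hs Sum.Lex.not_inr_lt_inl
  · change (Finsupp.single (Sum.inlₗ j) 1 + Finsupp.single (Sum.inrₗ i) 1 : Vars V →₀ ℕ)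
        (Sum.inlₗ i) < (Finsupp.single (Sum.inlₗ i) 1 + Finsupp.single (Sum.inrₗ j) 1 :
          Vars V →₀ ℕ) (Sum.inlₗ i)
    simp [h.ne']

open MonomialOrder in
theorem leadingCoeff_binom {i j : V} (h : i < j) : lex.leadingCoeff (binom K i j) = 1 := by
  classical
  rw [leadingCoeff, degree_binom h, binom, coeff_sub, x, y, x, y]
  simp only [X, monomial_mul, coeff_monomial]
  rw [if_pos trivial, if_neg, mul_one, sub_zero]
  intro h1
  have := DFunLike.congr_fun h1 (Sum.inlₗ i)
  simp [h.ne'] at this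

open MonomialOrder in
theorem leadingTerm_binom {i j : V} (h : i < j) :
    lex.leadingTerm (binom K i j) = x K i * y K j := by
  rw [leadingTerm, leadingCoeff_binom h, degree_binom h, x, y, X, X, monomial_mul, mul_one]

-- For the converse divide `f` by the minors. The remainder is still in the toric kernel, but none
-- of its monomials is divisible by `x_i y_j` with `i < j` in `W`, so it is 0. Thus the ideal is the
-- kernel of a map to a domain.
open MonomialOrder in
theorem mem_genericIdeal_iff {W : Finset V} {f : PolyRing K V} :
    f ∈ genericIdeal K W ↔ toricMap K W f = 0 := by
  refine ⟨toricMap_eq_zero_of_mem, fun hf => ?_⟩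
  obtain ⟨g, r, h1, -, h2⟩ := lex.div_set
    (B := {f | ∃ i ∈ W, ∃ j ∈ W, i < j ∧ f = binom K i j}) (by
      rintro _ ⟨i, _, j, _, h, rfl⟩
      rw [leadingCoeff_binom h]
      exact isUnit_one) f
  have h3 : Finsupp.linearCombination _ (fun b : {f | ∃ i ∈ W, ∃ j ∈ W, i < j ∧ f = binom K i j} =>
      (b : PolyRing K V)) g ∈ genericIdeal K W := by
    rw [Finsupp.linearCombination_apply]
    exact Submodule.sum_mem _ fun b _ => Ideal.mul_mem_left _ _ (Ideal.subset_span b.2)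
  have h4 : r = 0 := by
    by_contra h0
    have h5 : toricMap K W r = 0 := by
      rwa [h1, map_add, toricMap_eq_zero_of_mem h3, zero_add] at hf
    obtain ⟨i, hi, j, hj, h, hxi, hyj⟩ := exists_lt_of_toricMap_eq_zero h5 h0
    refine h2 _ (lex.degree_mem_support h0) _ ⟨i, hi, j, hj, h, rfl⟩ ?_
    rw [degree_binom h]
    intro s
    rw [Finsupp.add_apply]
    by_cases hs : s = Sum.inlₗ i
    · subst hs
      simp only [Finsupp.single_apply, (inl_ne_inr _ _).symm, if_true, if_false]
      omega
    · by_cases hs' : s = Sum.inrₗ j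
      · subst hs'
        simp only [Finsupp.single_apply, inl_ne_inr, if_true, if_false]
        omega
      · simp [Ne.symm hs, Ne.symm hs']
  rw [h1, h4, add_zero]
  exact h3

/-- The toric map goes to a domain and sends no variable to zero. -/
theorem mem_genericIdeal_of_X_mul_mem {W : Finset V} (s : Vars V) {f : PolyRing K V}
    (h : X s * f ∈ genericIdeal K W) : f ∈ genericIdeal K W := by
  rw [mem_genericIdeal_iff] at h ⊢
  rw [map_mul, toricMap, aeval_X] at h
  exact (mul_eq_zero.1 h).resolve_left (by simp)

end ToricMap

/-! ### Shapes of Betti tables and how they change under linear operations -/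

section Shape

variable {σ : Type} {K : Type u} [Field K] [Fintype σ] [LinearOrder σ]
variable {M : Type u} [AddCommGroup M] [Module K M] [Module (MvPolynomial σ K) M]
  [IsScalarTower K (MvPolynomial σ K) M]

/-- The Betti numbers of `𝓜` live on the strand `(i, i + a)` with `i < t`, and the last one
is `b`. -/
structure IsLinear (𝓜 : GradedFamily σ K M) (a t b : ℕ) : Prop where
  eq_of_ne : ∀ i j, 𝓜.tor i j ≠ 0 → j = i + a ∧ i < t ∧ b ≠ 0
  top : ∀ i, i + 1 = t → 𝓜.tor i (i + a) = b
  eq_zero : t = 0 → b = 0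

/-- The Betti numbers of `S / I` live at `(i, i)` with `i < r` and at `(i, i + 1)` with `i < N`,
and the last one on the second strand is `b`. -/
structure HasShape (I : Ideal (MvPolynomial σ K)) (r N b : ℕ) : Prop where
  eq_of_ne : ∀ i j, (subq ⊤ I).tor i j ≠ 0 → (j = i ∧ i < r) ∨ (j = i + 1 ∧ i < N)
  top : ∀ i, i + 1 = N → (subq ⊤ I).tor i (i + 1) = b

/-- A regular variable prolongs the strand by one step, and the old last Betti number reappears at
the new end. -/
theorem IsLinear.sup_X {I L : Ideal (MvPolynomial σ K)} {a t b : ℕ}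
    (h : IsLinear (subq L I) a t b) (hI : IsHomog I) (hL : IsHomog L) (s : σ)
    (h' : ∀ f ∈ L, X s * f ∈ I → f ∈ I) :
    IsLinear (subq L (I ⊔ Ideal.span {X s} * L)) a (t + 1) b := by
  obtain ⟨h1, h2, h3⟩ := tor_subq_X hI hL s h'
  refine ⟨fun i j hij => ?_, fun i hi => ?_, fun h => absurd h (by omega)⟩
  · rcases i with _ | i
    · rw [h1] at hij
      have := h.eq_of_ne _ _ hij
      exact ⟨this.1, by omega, this.2.2⟩
    rcases j with _ | j
    · rw [h2] at hij
      have := h.eq_of_ne _ _ hij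
      omega
    · rw [h3] at hij
      by_cases h4 : (subq L I).tor i j = 0
      · rw [h4, add_zero] at hij
        have := h.eq_of_ne _ _ hij
        exact ⟨this.1, by omega, this.2.2⟩
      · have := h.eq_of_ne _ _ h4
        exact ⟨by omega, by omega, this.2.2⟩
  · obtain rfl : i = t := by omega
    rcases i with _ | i
    · rw [h1, h.eq_zero rfl, Nat.cast_zero]
      by_contra h4
      exact absurd (h.eq_of_ne _ _ h4).2.1 (lt_irrefl 0)
    · have h4 : (subq L I).tor (i + 1) (i + 1 + a) = 0 := by
        by_contra h4
        exact absurd (h.eq_of_ne _ _ h4).2.1 (lt_irrefl _)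
      rw [show i + 1 + a = (i + a) + 1 by omega] at h4 ⊢
      rw [h3, h4, zero_add, h.top i rfl]

omit [Fintype σ] [LinearOrder σ] in
theorem DivStable.varIdeal_mul {s : σ} {L : Ideal (MvPolynomial σ K)} (hL : DivStable s L)
    {D : Finset σ} (hs : s ∉ D) : DivStable s (varIdeal K D * L) := by
  classical
  induction D using Finset.induction_on with
  | empty =>
    rw [Finset.coe_empty, varIdeal_empty, Ideal.bot_mul]
    intro f hf
    rw [(Submodule.mem_bot _).1 hf, zero_divMonomial]
    exact zero_mem _
  | insert t D ht ih =>
    rw [Finset.mem_insert, not_or] at hs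
    rw [Finset.coe_insert, varIdeal_insert, Ideal.sup_mul]
    exact (ih hs.2).sup (hL.span_X_mul hs.1)

/-- Each variable of `D` is regular on `L` modulo the preceding ones, so every one of them prolongs
the strand by one. -/
theorem IsLinear.varIdeal_mul {L : Ideal (MvPolynomial σ K)} {a t b : ℕ}
    (h : IsLinear (subq L ⊥) a t b) (hL : IsHomog L) {D : Finset σ}
    (hD : ∀ s ∈ D, DivStable s L) :
    IsLinear (subq L (varIdeal K D * L)) a (t + D.card) b := by
  classical
  induction D using Finset.induction_on with
  | empty =>
    rw [Finset.coe_empty, varIdeal_empty, Ideal.bot_mul]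
    exact h
  | insert s D hs ih =>
    rw [Finset.card_insert_of_notMem hs, Finset.coe_insert, varIdeal_insert, Ideal.sup_mul,
      ← add_assoc]
    exact (ih fun t ht => hD t (Finset.mem_insert_of_mem ht)).sup_X
      ((varIdeal_isHomog _).mul hL) hL s
      fun f _ => ((hD s (Finset.mem_insert_self s D)).varIdeal_mul hs).mem_of_X_mul_mem

theorem isLinear_varIdeal (D : Finset σ) :
    IsLinear (subq (⊤ : Ideal (MvPolynomial σ K)) (varIdeal K D)) 0 (1 + D.card) 1 := by
  rw [← Ideal.mul_top (varIdeal K (D : Set σ))]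
  refine IsLinear.varIdeal_mul ⟨fun i j hij => ?_, fun i hi => ?_, fun h => absurd h one_ne_zero⟩
    (Ideal.IsHomogeneous.top _) fun s _ => .top s
  · by_contra h
    exact hij (tor_top_bot (by omega))
  · obtain rfl : i = 0 := by omega
    rw [zero_add, tor_top_bot_zero, Nat.cast_one]

theorem HasShape.bot : HasShape (⊥ : Ideal (MvPolynomial σ K)) 1 1 0 := by
  refine ⟨fun i j hij => ?_, fun i hi => ?_⟩
  · by_contra h
    exact hij (tor_top_bot (by omega))
  · rw [tor_top_bot (Or.inr i.succ_ne_zero), Nat.cast_zero]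

theorem HasShape.sup_X {I : Ideal (MvPolynomial σ K)} {r N b : ℕ} (h : HasShape I r N b)
    (hN : N ≠ 0) (hI : IsHomog I) (s : σ) (h' : ∀ f, X s * f ∈ I → f ∈ I) :
    HasShape (I ⊔ Ideal.span {X s}) (r + 1) (N + 1) b := by
  obtain ⟨h1, h2, h3⟩ := tor_subq_X hI (Ideal.IsHomogeneous.top _) s fun f _ => h' f
  rw [Ideal.mul_top] at h1 h2 h3
  refine ⟨fun i j hij => ?_, fun i hi => ?_⟩
  · rcases i with _ | i
    · rw [h1] at hij
      have := h.eq_of_ne _ _ hij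
      omega
    rcases j with _ | j
    · rw [h2] at hij
      have := h.eq_of_ne _ _ hij
      omega
    · rw [h3] at hij
      by_cases h4 : (subq ⊤ I).tor i j = 0
      · rw [h4, add_zero] at hij
        have := h.eq_of_ne _ _ hij
        omega
      · have := h.eq_of_ne _ _ h4
        omega
  · obtain ⟨i, rfl⟩ := Nat.exists_eq_succ_of_ne_zero (show i ≠ 0 by omega)
    have h4 : (subq ⊤ I).tor (i + 1) (i + 1 + 1) = 0 := by
      by_contra h4
      have := h.eq_of_ne _ _ h4
      omega
    rw [Nat.succ_eq_add_one, h3, h4, zero_add, h.top i (by omega)]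

/-- The Betti number of `S/I` at `(i, j)` is a summand of the one of the quotient at `(i + 1, j +
1)`, so the shape can be read backwards. -/
theorem HasShape.of_sup_X {I : Ideal (MvPolynomial σ K)} {r N b : ℕ} (hI : IsHomog I) (s : σ)
    (h' : ∀ f, X s * f ∈ I → f ∈ I) (h : HasShape (I ⊔ Ideal.span {X s}) r (N + 1) b) :
    HasShape I r N b := by
  obtain ⟨h1, h2, h3⟩ := tor_subq_X hI (Ideal.IsHomogeneous.top _) s fun f _ => h' f
  rw [Ideal.mul_top] at h1 h2 h3
  have key : ∀ i j, (subq ⊤ I).tor i j ≠ 0 → (j = i ∧ i < r) ∨ (j = i + 1 ∧ i < N) := by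
    intro i j hij
    have h4 : (subq ⊤ (I ⊔ Ideal.span {X s})).tor (i + 1) (j + 1) ≠ 0 := by
      rw [h3]
      exact fun h0 => hij (add_eq_zero.1 h0).2
    have := h.eq_of_ne _ _ h4
    omega
  refine ⟨key, fun i hi => ?_⟩
  have h4 : (subq ⊤ I).tor (i + 1) (i + 1 + 1) = 0 := by
    by_contra h4
    have := key _ _ h4
    omega
  rw [← h.top (i + 1) (by omega), h3, h4, zero_add]

/-- The hypotheses say `Q : X s = (D)`, so `S/(D)`, shifted by one, is the kernel of `S/Q → S/(Q + X
s)`. The shifted Koszul complex of `D` lies in the second strand and ends at the same place `N - 1`,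
where it adds exactly 1. -/
theorem HasShape.of_varIdeal_quotient {Q : Ideal (MvPolynomial σ K)} {r N b : ℕ} (hQ : IsHomog Q)
    {s : σ} {D : Finset σ} (hs : s ∉ D) (h1 : ∀ t ∈ D, X s * X t ∈ Q) (h2 : Q ≤ varIdeal K D)
    (hN : N = D.card + 1) (hN' : 2 ≤ N) (hr : r ≤ N) (h : HasShape (Q ⊔ Ideal.span {X s}) r N b) :
    HasShape Q r N (b + 1) := by
  have hP := isLinear_varIdeal (K := K) D
  have hE : GradedExact _ _ (subq ⊤ (varIdeal K D)).shift (subq ⊤ Q) _ :=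
    subq_exact_X hQ (Ideal.IsHomogeneous.top _) s
      (fun f hf => by
        have : varIdeal K (D : Set σ) * Ideal.span {X s} ≤ Q := by
          rw [varIdeal, Ideal.span_mul_span', Ideal.span_le]
          rintro _ ⟨_, ⟨t, ht, rfl⟩, _, rfl, rfl⟩
          rw [SetLike.mem_coe]
          simpa only [mul_comm] using h1 t ht
        rw [mul_comm]
        exact this (Ideal.mul_mem_mul hf (Ideal.mem_span_singleton_self _)))
      (fun f _ hf => mem_varIdeal_of_X_mul_mem (s := s) (by simpa using hs) (h2 hf))
  rw [Ideal.mul_top] at hE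
  refine ⟨fun i j hij => ?_, fun i hi => ?_⟩
  · by_cases h4 : (subq ⊤ (Q ⊔ Ideal.span {X s})).tor i j = 0
    · have h5 : (subq ⊤ (varIdeal K (D : Set σ))).shift.tor i j ≠ 0 :=
        fun h5 => hij (hE.tor_mid_eq_zero h5 h4)
      rcases j with _ | j
      · exact absurd (GradedFamily.tor_shift_zero _ _) h5
      · rw [GradedFamily.tor_shift_succ] at h5
        have := hP.eq_of_ne _ _ h5
        omega
    · exact h.eq_of_ne _ _ h4
  · obtain ⟨i, rfl⟩ := Nat.exists_eq_succ_of_ne_zero (show i ≠ 0 by omega)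
    rw [Nat.succ_eq_add_one, hE.tor_mid_eq_add, GradedFamily.tor_shift_succ, hP.top (i + 1) (by omega), h.top (i + 1) hi]
    · push_cast
      exact add_comm _ _
    · by_contra h4
      have := h.eq_of_ne _ _ h4
      omega
    · rw [GradedFamily.tor_shift_succ]
      by_contra h4
      have := hP.eq_of_ne _ _ h4
      omega

/-- The ideal contains no polynomial with a nonzero term of degree less than two. -/
def NoLinearTerms (I : Ideal (MvPolynomial σ K)) : Prop :=
  ∀ f ∈ I, ∀ d : σ →₀ ℕ, d.degree < 2 → coeff d f = 0

omit [Fintype σ] [LinearOrder σ] in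
theorem NoLinearTerms.span {B : Set (MvPolynomial σ K)}
    (h : ∀ f ∈ B, f.IsHomogeneous 2) : NoLinearTerms (Ideal.span B) := by
  classical
  intro f hf
  induction hf using Submodule.span_induction with
  | mem f hf =>
    intro d hd
    by_contra h0
    have := isHomogeneous_iff_degree.1 (h f hf) d h0
    omega
  | zero => simp
  | add f g _ _ hf hg => intro d hd; rw [coeff_add, hf d hd, hg d hd, add_zero]
  | smul r f _ hf =>
    intro d hd
    rw [smul_eq_mul, coeff_mul]
    refine Finset.sum_eq_zero fun p hp => ?_
    rw [hf, mul_zero]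
    rw [Finset.HasAntidiagonal.mem_antidiagonal] at hp
    have := congrArg Finsupp.degree hp
    rw [map_add] at this
    omega

theorem NoLinearTerms.tor_eq_zero {I : Ideal (MvPolynomial σ K)} (h : NoLinearTerms I) (i : ℕ)
    {l : ℕ} (hl : l < 2) : (subq I ⊥).tor i (i + l) = 0 := by
  refine GradedFamily.tor_add_of_obj _ (eq_bot_iff.2 fun v hv => ?_)
  obtain ⟨f, hf, hf', rfl⟩ := mem_subq.1 hv
  have : f = 0 := by
    ext d
    rw [coeff_zero]
    by_contra h0
    have h1 := isHomogeneous_iff_degree.1 hf' d h0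
    exact h0 (h f hf d (by omega))
  rw [this, map_zero]
  exact zero_mem _

/-- Entries `(i + 1, i + 1)` come from elements of `I` of degree at most 1. This discards the bound
on the first strand picked up from auxiliary variables. -/
theorem HasShape.of_noLinearTerms {I : Ideal (MvPolynomial σ K)} {r N b : ℕ}
    (hI : NoLinearTerms I) (h : HasShape I r N b) : HasShape I 1 N b := by
  refine ⟨fun i j hij => ?_, h.top⟩
  rcases h.eq_of_ne _ _ hij with ⟨rfl, h1⟩ | h1
  · rcases j with _ | j
    · omega
    · rw [← tor_ideal (Or.inr j.succ_ne_zero)] at hij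
      exact absurd (hI.tor_eq_zero j one_lt_two) hij
  · exact Or.inr h1

/-- Passing from `S/I` to `I` lowers the homological degree by one, so the strand `(i, i + 1)` of
length `N` becomes `(i, i + 2)` of length `N - 1`. -/
theorem HasShape.isLinear {I : Ideal (MvPolynomial σ K)} {r N : ℕ}
    (hI : NoLinearTerms I) (h : HasShape I r N (N - 1)) : IsLinear (subq I ⊥) 2 (N - 1) (N - 1) := by
  refine ⟨fun i j hij => ?_, fun i hi => ?_, id⟩
  · have h0 : ∀ l < 2, j ≠ i + l := by
      rintro l hl rfl
      exact hij (hI.tor_eq_zero i hl)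
    have h1 := h0 0
    have h2 := h0 1
    have h3 : i ≠ 0 ∨ j ≠ 0 := by omega
    rw [tor_ideal h3] at hij
    have := h.eq_of_ne _ _ hij
    omega
  · rw [tor_ideal (by omega), ← h.top (i + 1) (by omega)]

end Shape

/-! ### Betti data of the monomial ideals `(x_i y_j : i < j in W)` -/

section Minors

variable {V : Type} {K : Type u} [Field K]

theorem isHomogeneous_x_mul_y (i j : V) : (x K i * y K j).IsHomogeneous 2 :=
  (isHomogeneous_X _ _).mul (isHomogeneous_X _ _)

theorem notMem_vars_x_mul_y {s : Vars V} {i j : V} (hi : s ≠ Sum.inlₗ i) (hj : s ≠ Sum.inrₗ j) :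
    s ∉ (x K i * y K j).vars := by
  classical
  intro h
  have := vars_mul _ _ h
  rw [x, y, vars_X, vars_X, Finset.mem_union, Finset.mem_singleton, Finset.mem_singleton] at this
  tauto

variable [LinearOrder V]

theorem notMem_vars_binom {s : Vars V} {i j : V} (hi : s ≠ Sum.inlₗ i) (hj : s ≠ Sum.inrₗ j)
    (hi' : s ≠ Sum.inrₗ i) (hj' : s ≠ Sum.inlₗ j) : s ∉ (binom K i j).vars := by
  classical
  intro h
  rcases Finset.mem_union.1 (vars_sub_subset _ h) with h | h
  · exact notMem_vars_x_mul_y hi hj h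
  · exact notMem_vars_x_mul_y hj' hi' h

/-- The initial ideal of the ideal of maximal minors of the generic `2 × W` matrix. -/
noncomputable def monoIdeal (K : Type u) [Field K] (W : Finset V) : Ideal (PolyRing K V) :=
  Ideal.span {f | ∃ i ∈ W, ∃ j ∈ W, i < j ∧ f = x K i * y K j}

theorem noLinearTerms_genericIdeal (W : Finset V) : NoLinearTerms (genericIdeal K W) :=
  NoLinearTerms.span <| by
    rintro _ ⟨i, _, j, _, _, rfl⟩
    exact (isHomogeneous_x_mul_y _ _).sub (isHomogeneous_x_mul_y _ _)

theorem noLinearTerms_monoIdeal (W : Finset V) : NoLinearTerms (monoIdeal K W) :=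
  NoLinearTerms.span <| by
    rintro _ ⟨i, _, j, _, _, rfl⟩
    exact isHomogeneous_x_mul_y _ _

theorem genericIdeal_isHomog (W : Finset V) : IsHomog (genericIdeal K W) :=
  IsHomog.span <| by
    rintro _ ⟨i, _, j, _, _, rfl⟩
    exact ⟨2, (isHomogeneous_x_mul_y _ _).sub (isHomogeneous_x_mul_y _ _)⟩

theorem monoIdeal_isHomog (W : Finset V) : IsHomog (monoIdeal K W) :=
  IsHomog.span <| by
    rintro _ ⟨i, _, j, _, _, rfl⟩
    exact ⟨2, isHomogeneous_x_mul_y _ _⟩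

theorem divStable_genericIdeal {W : Finset V} {s : Vars V}
    (hs : ∀ v ∈ W, s ≠ Sum.inlₗ v ∧ s ≠ Sum.inrₗ v) : DivStable s (genericIdeal K W) :=
  DivStable.span <| by
    rintro _ ⟨i, hi, j, hj, _, rfl⟩
    exact notMem_vars_binom (hs i hi).1 (hs j hj).2 (hs i hi).2 (hs j hj).1

theorem divStable_monoIdeal {W : Finset V} {s : Vars V}
    (hs : ∀ v ∈ W, s ≠ Sum.inlₗ v ∧ s ≠ Sum.inrₗ v) : DivStable s (monoIdeal K W) :=
  DivStable.span <| by
    rintro _ ⟨i, hi, j, hj, _, rfl⟩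
    exact notMem_vars_x_mul_y (hs i hi).1 (hs j hj).2

theorem genericIdeal_mono {W W' : Finset V} (h : W ⊆ W') : genericIdeal K W ≤ genericIdeal K W' :=
  Ideal.span_mono <| by
    rintro _ ⟨i, hi, j, hj, hij, rfl⟩
    exact ⟨i, h hi, j, h hj, hij, rfl⟩

theorem monoIdeal_mono {W W' : Finset V} (h : W ⊆ W') : monoIdeal K W ≤ monoIdeal K W' :=
  Ideal.span_mono <| by
    rintro _ ⟨i, hi, j, hj, hij, rfl⟩
    exact ⟨i, h hi, j, h hj, hij, rfl⟩

theorem genericIdeal_singleton (v : V) : genericIdeal K {v} = ⊥ := by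
  refine le_bot_iff.1 (Ideal.span_le.2 ?_)
  rintro _ ⟨i, hi, j, hj, hij, rfl⟩
  rw [Finset.mem_singleton] at hi hj
  exact absurd hij (by simp [hi, hj])

theorem monoIdeal_singleton (v : V) : monoIdeal K {v} = ⊥ := by
  refine le_bot_iff.1 (Ideal.span_le.2 ?_)
  rintro _ ⟨i, hi, j, hj, hij, rfl⟩
  rw [Finset.mem_singleton] at hi hj
  exact absurd hij (by simp [hi, hj])

variable [Fintype (Vars V)]

/-- As `v` is the last vertex it enters only through the products `x_w y_v`. So adding `y_v` reduces
to the ideal of `W`, and the colon by `y_v` is generated by the `x_w` with `w ∈ W`. -/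
theorem hasShape_monoIdeal_insert {v : V} {W : Finset V} (hW : W.Nonempty)
    (hv : ∀ w ∈ W, w < v) (h : HasShape (monoIdeal K W) 1 W.card (W.card - 1)) :
    HasShape (monoIdeal K (insert v W)) 1 (insert v W).card ((insert v W).card - 1) := by
  classical
  have hvW : v ∉ W := fun h => lt_irrefl v (hv v h)
  have hc : W.card ≠ 0 := hW.card_pos.ne'
  have h1 := h.sup_X hc (monoIdeal_isHomog W) (Sum.inrₗ v) fun f =>
    (divStable_monoIdeal fun w hw => ⟨(inl_ne_inr _ _).symm, fun h => hvW (by rwa [inr_inj.1 h])⟩).mem_of_X_mul_mem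
  have h2 : monoIdeal K (insert v W) ⊔ Ideal.span {X (Sum.inrₗ v)} =
      monoIdeal K W ⊔ Ideal.span {X (Sum.inrₗ v)} := by
    refine le_antisymm (sup_le (Ideal.span_le.2 ?_) le_sup_right)
      (sup_le_sup_right (monoIdeal_mono (Finset.subset_insert v W)) _)
    rintro _ ⟨i, hi, j, hj, hij, rfl⟩
    rcases Finset.mem_insert.1 hj with rfl | hj'
    · exact le_sup_right (a := monoIdeal K W)
        (Ideal.mul_mem_left _ _ (Ideal.mem_span_singleton_self _))
    · rcases Finset.mem_insert.1 hi with rfl | hi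
      · exact absurd hij (hv j hj').not_gt
      · exact le_sup_left (a := monoIdeal K W) (Ideal.subset_span ⟨i, hi, j, hj', hij, rfl⟩)
  rw [← h2] at h1
  have h3 := HasShape.of_varIdeal_quotient (monoIdeal_isHomog (insert v W)) (s := Sum.inrₗ v)
    (D := W.image fun w => (Sum.inlₗ w : Vars V)) (N := W.card + 1) (r := 1 + 1) (b := W.card - 1)
    (by simp) (by
      intro t ht
      obtain ⟨w, hw, rfl⟩ := Finset.mem_image.1 ht
      rw [mul_comm]
      exact Ideal.subset_span ⟨w, Finset.mem_insert_of_mem hw, v, Finset.mem_insert_self _ _,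
        hv w hw, rfl⟩)
    (Ideal.span_le.2 (by
      rintro _ ⟨i, hi, j, hj, hij, rfl⟩
      have hi' : i ∈ W := by
        rcases Finset.mem_insert.1 hi with rfl | hi
        · rcases Finset.mem_insert.1 hj with rfl | hj
          · exact absurd hij (lt_irrefl _)
          · exact absurd hij (hv j hj).not_gt
        · exact hi
      exact Ideal.mul_mem_right _ _ (X_mem_varIdeal (by simpa using hi'))))
    (by rw [Finset.card_image_of_injective _ fun a b h => inl_inj.1 h]) (by omega) (by omega) h1
  rw [Finset.card_insert_of_notMem hvW]
  have h4 : W.card - 1 + 1 = W.card + 1 - 1 := by omega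
  rw [h4] at h3
  exact h3.of_noLinearTerms (noLinearTerms_monoIdeal _)

theorem hasShape_monoIdeal {W : Finset V} (hW : W.Nonempty) :
    HasShape (monoIdeal K W) 1 W.card (W.card - 1) := by
  induction W using Finset.induction_on_max with
  | empty => exact absurd hW Finset.not_nonempty_empty
  | insert v W hv ih =>
    rcases W.eq_empty_or_nonempty with rfl | hW'
    · rw [insert_empty_eq, monoIdeal_singleton, Finset.card_singleton]
      exact HasShape.bot
    · exact hasShape_monoIdeal_insert hW' hv (ih hW')

end Minors

/-! ### Betti data of the ideals of 2-minors -/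

section Generic

variable {V : Type} {K : Type u} [Field K] [LinearOrder V] [Fintype V] [Fintype (Vars V)]

/-- Modulo `x_v` and `y_v` the ideals of `insert v W` and `W` agree. First `x_v` is removed: modulo
`y_v` the minor of columns `v`, `w` is `x_v y_w`, so the colon by `x_v` is generated by all `y_w`.
Then `y_v` is removed, being regular. -/
theorem hasShape_genericIdeal_insert {v : V} {W : Finset V} (hW : W.Nonempty)
    (hv : ∀ w ∈ W, w < v) (h : HasShape (genericIdeal K W) 1 W.card (W.card - 1)) :
    HasShape (genericIdeal K (insert v W)) 1 (insert v W).card ((insert v W).card - 1) := by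
  classical
  have hvW : v ∉ W := fun h => lt_irrefl v (hv v h)
  have hc : W.card ≠ 0 := hW.card_pos.ne'
  have hX : DivStable (Sum.inlₗ v : Vars V) (Ideal.span {(X (Sum.inrₗ v) : PolyRing K V)}) :=
    DivStable.span (by
      rintro _ rfl
      rw [vars_X, Finset.mem_singleton]
      exact inl_ne_inr _ _)
  have h1 := (h.sup_X hc (genericIdeal_isHomog W) (Sum.inrₗ v)
    fun f => mem_genericIdeal_of_X_mul_mem _).sup_X (Nat.succ_ne_zero _)
      ((genericIdeal_isHomog W).sup (IsHomog.span_singleton_X _)) (Sum.inlₗ v) fun f =>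
    ((divStable_genericIdeal fun w hw => ⟨fun h => hvW (by rwa [inl_inj.1 h]), inl_ne_inr _ _⟩).sup
      hX).mem_of_X_mul_mem
  have h2 : genericIdeal K (insert v W) ⊔ Ideal.span {X (Sum.inrₗ v)} ⊔
      Ideal.span {X (Sum.inlₗ v)} =
      genericIdeal K W ⊔ Ideal.span {X (Sum.inrₗ v)} ⊔ Ideal.span {X (Sum.inlₗ v)} := by
    refine le_antisymm (sup_le (sup_le (Ideal.span_le.2 ?_) ?_) le_sup_right)
      (sup_le_sup_right (sup_le_sup_right (genericIdeal_mono (Finset.subset_insert v W)) _) _)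
    · rintro _ ⟨i, hi, j, hj, hij, rfl⟩
      rcases Finset.mem_insert.1 hj with rfl | hj'
      · refine Ideal.sub_mem _ ?_ ?_
        · exact Ideal.mul_mem_left _ _ (Ideal.mem_sup_left (Ideal.mem_sup_right
            (Ideal.mem_span_singleton_self _)))
        · exact Ideal.mul_mem_right _ _ (Ideal.mem_sup_right (Ideal.mem_span_singleton_self _))
      · rcases Finset.mem_insert.1 hi with rfl | hi
        · exact absurd hij (hv j hj').not_gt
        · exact Ideal.mem_sup_left (Ideal.mem_sup_left (binom_mem_genericIdeal hi hj' hij))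
    · exact le_sup_right.trans le_sup_left
  rw [← h2] at h1
  have hQ := (genericIdeal_isHomog (K := K) (insert v W)).sup (IsHomog.span_singleton_X (Sum.inrₗ v))
  have h3 := HasShape.of_varIdeal_quotient hQ (s := Sum.inlₗ v)
    (D := (insert v W).image fun w => (Sum.inrₗ w : Vars V)) (N := W.card + 1 + 1)
    (r := 1 + 1 + 1) (b := W.card - 1)
    (by simp) (by
      intro t ht
      obtain ⟨w, hw, rfl⟩ := Finset.mem_image.1 ht
      have h4 : (X (Sum.inlₗ v) * X (Sum.inrₗ w) : PolyRing K V) =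
        binom K v w + x K w * X (Sum.inrₗ v) := (sub_add_cancel _ _).symm
      rw [h4]
      exact add_mem (Ideal.mem_sup_left (binom_mem_genericIdeal' (Finset.mem_insert_self _ _) hw))
        (Ideal.mem_sup_right (Ideal.mul_mem_left _ _ (Ideal.mem_span_singleton_self _))))
    (sup_le (Ideal.span_le.2 (by
      rintro _ ⟨i, hi, j, hj, hij, rfl⟩
      refine Ideal.sub_mem _ ?_ ?_
      · exact Ideal.mul_mem_left _ _ (X_mem_varIdeal (by simpa using hj))
      · exact Ideal.mul_mem_left _ _ (X_mem_varIdeal (by simpa using hi))))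
      ((Ideal.span_singleton_le_iff_mem _).2 (X_mem_varIdeal (by simp))))
    (by rw [Finset.card_image_of_injective _ fun a b h => inr_inj.1 h,
      Finset.card_insert_of_notMem hvW]) (by omega) (by omega) h1
  rw [Finset.card_insert_of_notMem hvW]
  have h4 : W.card - 1 + 1 = W.card + 1 - 1 := by omega
  rw [h4] at h3
  exact (HasShape.of_sup_X (genericIdeal_isHomog _) _
    (fun f => mem_genericIdeal_of_X_mul_mem _) h3).of_noLinearTerms (noLinearTerms_genericIdeal _)

theorem hasShape_genericIdeal {W : Finset V} (hW : W.Nonempty) :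
    HasShape (genericIdeal K W) 1 W.card (W.card - 1) := by
  induction W using Finset.induction_on_max with
  | empty => exact absurd hW Finset.not_nonempty_empty
  | insert v W hv ih =>
    rcases W.eq_empty_or_nonempty with rfl | hW'
    · rw [insert_empty_eq, genericIdeal_singleton, Finset.card_singleton]
      exact HasShape.bot
    · exact hasShape_genericIdeal_insert hW' hv (ih hW')

end Generic

/-! ### Intersections with ideals of variables -/

section Retraction

variable {σ : Type} {K : Type u} [Field K]

open Classical in
/-- The retraction setting the variables in `D` to zero. -/
noncomputable def killVars (K : Type u) [Field K] (D : Set σ) :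
    MvPolynomial σ K →ₐ[K] MvPolynomial σ K :=
  aeval fun s => if s ∈ D then 0 else X s

theorem sub_killVars_mem (D : Set σ) (f : MvPolynomial σ K) :
    f - killVars K D f ∈ varIdeal K D := by
  induction f using MvPolynomial.induction_on with
  | C a => rw [killVars, aeval_C, algebraMap_eq, sub_self]; exact zero_mem _
  | add f g hf hg => rw [map_add, add_sub_add_comm]; exact add_mem hf hg
  | mul_X f s hf =>
    have h1 : f * X s - killVars K D (f * X s) =
        (f - killVars K D f) * X s + killVars K D f * (X s - killVars K D (X s)) := by
      rw [map_mul]; ring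
    rw [h1]
    refine add_mem (Ideal.mul_mem_right _ _ hf) (Ideal.mul_mem_left _ _ ?_)
    rw [killVars, aeval_X]
    split_ifs with hs
    · rw [sub_zero]; exact X_mem_varIdeal hs
    · rw [sub_self]; exact zero_mem _

theorem killVars_eq_zero {D : Set σ} {f : MvPolynomial σ K} (hf : f ∈ varIdeal K D) :
    killVars K D f = 0 := by
  have : varIdeal K D ≤ RingHom.ker (killVars K D) := by
    refine Ideal.span_le.2 ?_
    rintro _ ⟨s, hs, rfl⟩
    change killVars K D (X s) = 0
    rw [killVars, aeval_X, if_pos hs]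
  exact this hf

theorem killVars_eq_self {D : Set σ} {f : MvPolynomial σ K} (hf : ∀ s ∈ f.vars, s ∉ D) :
    killVars K D f = f := by
  conv_rhs => rw [← aeval_X_left_apply (R := K) f]
  refine eval₂Hom_congr' rfl (fun s hs _ => ?_) rfl
  rw [if_neg (hf s hs)]

/-- Setting the variables of `D` to zero fixes the generators in `B`, so it changes an element of
their ideal only by an element of the product; and it sends elements of `(D)` to zero. -/
theorem span_inf_varIdeal_le {B : Set (MvPolynomial σ K)} {D : Set σ}
    (h : ∀ f ∈ B, ∀ s ∈ f.vars, s ∉ D) :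
    Ideal.span B ⊓ varIdeal K D ≤ varIdeal K D * Ideal.span B := by
  rintro f ⟨hf, hf'⟩
  have key : f - killVars K D f ∈ varIdeal K D * Ideal.span B := by
    clear hf'
    induction hf using Submodule.span_induction with
    | mem g hg => rw [killVars_eq_self (h g hg), sub_self]; exact zero_mem _
    | zero => rw [map_zero, sub_self]; exact zero_mem _
    | add f g _ _ hf hg => rw [map_add, add_sub_add_comm]; exact add_mem hf hg
    | smul r g hg hg' =>
      have h1 : r • g - killVars K D (r • g) =
          (r - killVars K D r) * g + killVars K D r * (g - killVars K D g) := by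
        rw [smul_eq_mul, map_mul]; ring
      rw [h1]
      exact add_mem (Ideal.mul_mem_mul (sub_killVars_mem D r) hg) (Ideal.mul_mem_left _ _ hg')
  rwa [killVars_eq_zero hf', sub_zero] at key

end Retraction

/-! ### Gluing the Betti table from the three pieces -/

section Assembly

variable {σ : Type} {K : Type u} [Field K] [Fintype σ] [LinearOrder σ]

/-- The Betti numbers of an ideal `G` glued from three ideals `LA`, `LB` and `G + LA + LB`. -/
theorem tor_of_glue {G LA LB PA PB : Ideal (MvPolynomial σ K)} {m n : ℕ} (hn : 1 ≤ n)
    (hmn : n ≤ m) (hG : IsHomog G) (hLA : IsHomog LA) (hLB : IsHomog LB)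
    (hA : PB * LA ≤ G) (hB : PA * LB ≤ G) (hGA : G ≤ PA) (hGB : G ≤ PB) (hLPA : LA ≤ PA)
    (hAinf : LA ⊓ PB ≤ PB * LA) (hBinf : LB ⊓ PA ≤ PA * LB)
    (hNA : IsLinear (subq LA (PB * LA)) 2 (m - 1 + 2 * n) (m - 1))
    (hNB : IsLinear (subq LB (PA * LB)) 2 (n - 1 + 2 * m) (n - 1))
    (hV : HasShape (G ⊔ LA ⊔ LB) 1 (m + n) (m + n - 1)) {p : ℕ}
    (hp : p = if n = 1 then m else 2 * m + n - 2) :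
    (∀ i j, (subq ⊤ G).tor i j ≠ 0 → i ≤ p ∧ j ≤ i + 2) ∧
    (2 ≤ m → (subq ⊤ G).tor p (p + 2) =
      (if n = 1 then m - 1 else if m = n then 2 * (n - 1) else n - 1 : ℕ)) ∧
    (m = 1 → (subq ⊤ G).tor 1 2 ≠ 0) := by
  have E1 : GradedExact _ _ (subq LA (PB * LA)) (subq ⊤ G) (subq ⊤ (G ⊔ LA)) :=
    subq_exact_sup hLA hG hA ((inf_le_inf_left LA hGB).trans hAinf)
  have E2 : GradedExact _ _ (subq LB (PA * LB)) (subq ⊤ (G ⊔ LA)) (subq ⊤ (G ⊔ LA ⊔ LB)) :=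
    subq_exact_sup hLB (hG.sup hLA) (hB.trans le_sup_left)
      ((inf_le_inf_left LB (sup_le hGA hLPA)).trans hBinf)
  -- The value of `p` without truncated subtraction.
  have hp1 : n = 1 ∧ p = m ∨ n ≠ 1 ∧ p + 2 = 2 * m + n := by
    split_ifs at hp <;> omega
  -- The case `m = 1` is listed because the piece then has last Betti number 0, and linearity makes
  -- all its homology vanish; likewise `n = 1` below.
  have zNA : ∀ i j, (j ≠ i + 2 ∨ m + 2 * n ≤ i + 1 ∨ m = 1) → (subq LA (PB * LA)).tor i j = 0 := by
    intro i j h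
    by_contra h0
    have := hNA.eq_of_ne _ _ h0
    omega
  have zNB : ∀ i j, (j ≠ i + 2 ∨ n + 2 * m ≤ i + 1 ∨ n = 1) → (subq LB (PA * LB)).tor i j = 0 := by
    intro i j h
    by_contra h0
    have := hNB.eq_of_ne _ _ h0
    omega
  have zV : ∀ i j, (i + 2 ≤ j ∨ m + n ≤ i) → (subq ⊤ (G ⊔ LA ⊔ LB)).tor i j = 0 := by
    intro i j h
    by_contra h0
    have := hV.eq_of_ne _ _ h0
    omega
  refine ⟨fun i j hij => ?_, fun hm => ?_, fun hm => ?_⟩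
  · by_contra h
    refine hij (E1.tor_mid_eq_zero (zNA _ _ (by omega)) (E2.tor_mid_eq_zero (zNB _ _ (by omega))
      (zV _ _ (by omega))))
  · obtain ⟨q, rfl⟩ := Nat.exists_eq_succ_of_ne_zero (show p ≠ 0 by omega)
    -- At `(p, p + 2)` both sequences split numerically: the pieces `LA`, `LB` live only in row 2,
    -- and the third piece stops before homological degree `p + 1`. It remains to see which of the
    -- two pieces ends at `p`.
    rw [Nat.succ_eq_add_one, E1.tor_mid_eq_add
      (E2.tor_mid_eq_zero (zNB _ _ (by omega)) (zV _ _ (by omega))) (zNA _ _ (by omega)),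
      E2.tor_mid_eq_add (zV _ _ (by omega)) (zNB _ _ (by omega)), zV _ _ (by omega), add_zero]
    split_ifs with h1 h2
    · rw [zNB _ _ (by omega), add_zero, hNA.top _ (by omega)]
    · rw [hNA.top _ (by omega), hNB.top _ (by omega), h2, two_mul, Nat.cast_add]
    · rw [hNB.top _ (by omega), zNA _ _ (by omega), zero_add]
  -- Now `m = n = 1`, both row 2 pieces vanish, and the entry `(1, 2)` comes from the third piece.
  · have h1 := hV.top 1 (by omega)
    have h2 : m + n - 1 = 1 := by omega
    rw [h2, Nat.cast_one] at h1
    intro h0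
    refine one_ne_zero (h1.symm.trans ?_)
    exact E2.tor_right_succ_eq_zero (E1.tor_right_succ_eq_zero h0 (zNA _ _ (by omega)))
      (zNB _ _ (by omega))

end Assembly

/-! ### The ideals of the complete bipartite graph satisfy the gluing hypotheses -/

section Bipartite

variable {V : Type} {K : Type u} [Field K] [LinearOrder V]

/-- The indices of the variables `x_v` and `y_v` with `v ∈ W`. -/
def vertexVars (W : Finset V) : Finset (Vars V) :=
  (W.image fun v => (Sum.inlₗ v : Vars V)) ∪ W.image fun v => (Sum.inrₗ v : Vars V)

theorem mem_vertexVars {W : Finset V} {s : Vars V} :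
    s ∈ vertexVars W ↔ ∃ v ∈ W, s = Sum.inlₗ v ∨ s = Sum.inrₗ v := by
  simp only [vertexVars, Finset.mem_union, Finset.mem_image]
  constructor
  · rintro (⟨v, hv, rfl⟩ | ⟨v, hv, rfl⟩)
    exacts [⟨v, hv, Or.inl rfl⟩, ⟨v, hv, Or.inr rfl⟩]
  · rintro ⟨v, hv, rfl | rfl⟩
    exacts [Or.inl ⟨v, hv, rfl⟩, Or.inr ⟨v, hv, rfl⟩]

theorem inl_mem_vertexVars {W : Finset V} {v : V} : Sum.inlₗ v ∈ vertexVars W ↔ v ∈ W := by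
  rw [mem_vertexVars]
  constructor
  · rintro ⟨w, hw, h | h⟩
    · rwa [inl_inj.1 h]
    · exact absurd h (inl_ne_inr _ _)
  · exact fun h => ⟨v, h, Or.inl rfl⟩

theorem inr_mem_vertexVars {W : Finset V} {v : V} : Sum.inrₗ v ∈ vertexVars W ↔ v ∈ W := by
  rw [mem_vertexVars]
  constructor
  · rintro ⟨w, hw, h | h⟩
    · exact absurd h.symm (inl_ne_inr _ _)
    · rwa [inr_inj.1 h]
  · exact fun h => ⟨v, h, Or.inr rfl⟩

theorem card_vertexVars (W : Finset V) : (vertexVars W).card = 2 * W.card := by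
  rw [vertexVars, Finset.card_union_of_disjoint, Finset.card_image_of_injective _
    fun a b h => inl_inj.1 h, Finset.card_image_of_injective _ fun a b h => inr_inj.1 h, two_mul]
  rw [Finset.disjoint_left]
  intro s hs hs'
  obtain ⟨v, -, rfl⟩ := Finset.mem_image.1 hs
  obtain ⟨w, -, h⟩ := Finset.mem_image.1 hs'
  exact inl_ne_inr _ _ h.symm

/-- The ideal generated by the `x_v` and `y_v` with `v ∈ W`. -/
noncomputable abbrev vertexIdeal (K : Type u) [Field K] (W : Finset V) : Ideal (PolyRing K V) :=
  varIdeal K (vertexVars W : Set (Vars V))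

theorem x_mem_vertexIdeal {W : Finset V} {v : V} (h : v ∈ W) : x K v ∈ vertexIdeal K W :=
  X_mem_varIdeal (inl_mem_vertexVars.2 h)

theorem y_mem_vertexIdeal {W : Finset V} {v : V} (h : v ∈ W) : y K v ∈ vertexIdeal K W :=
  X_mem_varIdeal (inr_mem_vertexVars.2 h)

theorem genericIdeal_le_vertexIdeal (W : Finset V) : genericIdeal K W ≤ vertexIdeal K W := by
  refine Ideal.span_le.2 ?_
  rintro _ ⟨i, hi, j, hj, _, rfl⟩
  exact Ideal.sub_mem _ (Ideal.mul_mem_right _ _ (x_mem_vertexIdeal hi))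
    (Ideal.mul_mem_right _ _ (x_mem_vertexIdeal hj))

theorem monoIdeal_le_vertexIdeal (W : Finset V) : monoIdeal K W ≤ vertexIdeal K W := by
  refine Ideal.span_le.2 ?_
  rintro _ ⟨i, hi, j, hj, _, rfl⟩
  exact Ideal.mul_mem_right _ _ (x_mem_vertexIdeal hi)

theorem ne_of_mem_vertexVars {W W' : Finset V} (h : Disjoint W W') {s : Vars V}
    (hs : s ∈ vertexVars W') : ∀ v ∈ W, s ≠ Sum.inlₗ v ∧ s ≠ Sum.inrₗ v := by
  intro v hv
  constructor <;> rintro rfl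
  · exact Finset.disjoint_left.1 h hv (inl_mem_vertexVars.1 hs)
  · exact Finset.disjoint_left.1 h hv (inr_mem_vertexVars.1 hs)

theorem genericIdeal_inf_vertexIdeal_le {W W' : Finset V} (h : Disjoint W W') :
    genericIdeal K W ⊓ vertexIdeal K W' ≤ vertexIdeal K W' * genericIdeal K W := by
  refine span_inf_varIdeal_le ?_
  rintro _ ⟨i, hi, j, hj, _, rfl⟩ s hs hs'
  have h1 := ne_of_mem_vertexVars h hs'
  exact notMem_vars_binom (h1 i hi).1 (h1 j hj).2 (h1 i hi).2 (h1 j hj).1 hs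

theorem monoIdeal_inf_vertexIdeal_le {W W' : Finset V} (h : Disjoint W W') :
    monoIdeal K W ⊓ vertexIdeal K W' ≤ vertexIdeal K W' * monoIdeal K W := by
  refine span_inf_varIdeal_le ?_
  rintro _ ⟨i, hi, j, hj, _, rfl⟩ s hs hs'
  have h1 := ne_of_mem_vertexVars h hs'
  exact notMem_vars_x_mul_y (h1 i hi).1 (h1 j hj).2 hs

theorem vertexIdeal_mul_le {W : Finset V} {L G : Ideal (PolyRing K V)}
    {B : Set (PolyRing K V)} (hL : L = Ideal.span B)
    (h : ∀ v ∈ W, ∀ f ∈ B, x K v * f ∈ G ∧ y K v * f ∈ G) : vertexIdeal K W * L ≤ G := by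
  rw [hL, vertexIdeal, varIdeal, Ideal.span_mul_span', Ideal.span_le]
  rintro _ ⟨_, ⟨s, hs, rfl⟩, f, hf, rfl⟩
  obtain ⟨v, hv, rfl | rfl⟩ := mem_vertexVars.1 hs
  exacts [(h v hv f hf).1, (h v hv f hf).2]

/-- The binomial edge ideal of the complete bipartite graph with parts `A` and `B`. -/
noncomputable def genericBipartite (K : Type u) [Field K] (A B : Finset V) :
    Ideal (PolyRing K V) :=
  Ideal.span {f | ∃ a ∈ A, ∃ b ∈ B, f = binom K a b}

/-- The initial ideal of the binomial edge ideal of the complete bipartite graph with parts `A`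
and `B`, where `A` precedes `B`. -/
noncomputable def monoBipartite (K : Type u) [Field K] (A B : Finset V) :
    Ideal (PolyRing K V) :=
  Ideal.span ({f | ∃ a ∈ A, ∃ b ∈ B, f = x K a * y K b} ∪
    ({f | ∃ b ∈ B, ∃ i ∈ A, ∃ j ∈ A, i < j ∧ f = x K b * (x K i * y K j)} ∪
      {f | ∃ a ∈ A, ∃ i ∈ B, ∃ j ∈ B, i < j ∧ f = y K a * (x K i * y K j)}))

variable {A B : Finset V}

omit [LinearOrder V] in
theorem binom_mem_genericBipartite {a b : V} (ha : a ∈ A) (hb : b ∈ B) :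
    binom K a b ∈ genericBipartite K A B :=
  Ideal.subset_span ⟨a, ha, b, hb, rfl⟩

theorem x_mul_y_mem_monoBipartite {a b : V} (ha : a ∈ A) (hb : b ∈ B) :
    x K a * y K b ∈ monoBipartite K A B :=
  Ideal.subset_span (Or.inl ⟨a, ha, b, hb, rfl⟩)

theorem x_mul_mem_monoBipartite {b i j : V} (hb : b ∈ B) (hi : i ∈ A) (hj : j ∈ A) (hij : i < j) :
    x K b * (x K i * y K j) ∈ monoBipartite K A B :=
  Ideal.subset_span (Or.inr (Or.inl ⟨b, hb, i, hi, j, hj, hij, rfl⟩))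

theorem y_mul_mem_monoBipartite {a i j : V} (ha : a ∈ A) (hi : i ∈ B) (hj : j ∈ B) (hij : i < j) :
    y K a * (x K i * y K j) ∈ monoBipartite K A B :=
  Ideal.subset_span (Or.inr (Or.inr ⟨a, ha, i, hi, j, hj, hij, rfl⟩))

-- Expansion of a 3 by 3 determinant with a repeated row, in the columns `i`, `j`, `b`.
omit [LinearOrder V] in
theorem mul_binom_mem_left {b i j : V} (hb : b ∈ B) (hi : i ∈ A) (hj : j ∈ A) :
    x K b * binom K i j ∈ genericBipartite K A B ∧
      y K b * binom K i j ∈ genericBipartite K A B := by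
  have h1 := binom_mem_genericBipartite (K := K) hi hb
  have h2 := binom_mem_genericBipartite (K := K) hj hb
  have e1 : x K b * binom K i j = x K j * binom K i b - x K i * binom K j b := by
    simp only [binom]; ring
  have e2 : y K b * binom K i j = y K j * binom K i b - y K i * binom K j b := by
    simp only [binom]; ring
  rw [e1, e2]
  exact ⟨Ideal.sub_mem _ (Ideal.mul_mem_left _ _ h1) (Ideal.mul_mem_left _ _ h2),
    Ideal.sub_mem _ (Ideal.mul_mem_left _ _ h1) (Ideal.mul_mem_left _ _ h2)⟩

omit [LinearOrder V] in
theorem mul_binom_mem_right {a i j : V} (ha : a ∈ A) (hi : i ∈ B) (hj : j ∈ B) :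
    x K a * binom K i j ∈ genericBipartite K A B ∧
      y K a * binom K i j ∈ genericBipartite K A B := by
  have h1 := binom_mem_genericBipartite (K := K) ha hj
  have h2 := binom_mem_genericBipartite (K := K) ha hi
  have e1 : x K a * binom K i j = x K i * binom K a j - x K j * binom K a i := by
    simp only [binom]; ring
  have e2 : y K a * binom K i j = y K i * binom K a j - y K j * binom K a i := by
    simp only [binom]; ring
  rw [e1, e2]
  exact ⟨Ideal.sub_mem _ (Ideal.mul_mem_left _ _ h1) (Ideal.mul_mem_left _ _ h2),
    Ideal.sub_mem _ (Ideal.mul_mem_left _ _ h1) (Ideal.mul_mem_left _ _ h2)⟩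

theorem genericBipartite_le_left : genericBipartite K A B ≤ vertexIdeal K A := by
  refine Ideal.span_le.2 ?_
  rintro _ ⟨a, ha, b, hb, rfl⟩
  exact Ideal.sub_mem _ (Ideal.mul_mem_right _ _ (x_mem_vertexIdeal ha))
    (Ideal.mul_mem_left _ _ (y_mem_vertexIdeal ha))

theorem genericBipartite_le_right : genericBipartite K A B ≤ vertexIdeal K B := by
  refine Ideal.span_le.2 ?_
  rintro _ ⟨a, ha, b, hb, rfl⟩
  exact Ideal.sub_mem _ (Ideal.mul_mem_left _ _ (y_mem_vertexIdeal hb))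
    (Ideal.mul_mem_right _ _ (x_mem_vertexIdeal hb))

theorem monoBipartite_le_left : monoBipartite K A B ≤ vertexIdeal K A := by
  refine Ideal.span_le.2 ?_
  rintro _ (⟨a, ha, b, hb, rfl⟩ | ⟨b, hb, i, hi, j, hj, -, rfl⟩ | ⟨a, ha, i, hi, j, hj, -, rfl⟩)
  · exact Ideal.mul_mem_right _ _ (x_mem_vertexIdeal ha)
  · exact Ideal.mul_mem_left _ _ (Ideal.mul_mem_right _ _ (x_mem_vertexIdeal hi))
  · exact Ideal.mul_mem_right _ _ (y_mem_vertexIdeal ha)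

theorem monoBipartite_le_right : monoBipartite K A B ≤ vertexIdeal K B := by
  refine Ideal.span_le.2 ?_
  rintro _ (⟨a, ha, b, hb, rfl⟩ | ⟨b, hb, i, hi, j, hj, -, rfl⟩ | ⟨a, ha, i, hi, j, hj, -, rfl⟩)
  · exact Ideal.mul_mem_left _ _ (y_mem_vertexIdeal hb)
  · exact Ideal.mul_mem_right _ _ (x_mem_vertexIdeal hb)
  · exact Ideal.mul_mem_left _ _ (Ideal.mul_mem_right _ _ (x_mem_vertexIdeal hi))

omit [LinearOrder V] in
theorem genericBipartite_isHomog : IsHomog (genericBipartite K A B) :=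
  IsHomog.span <| by
    rintro _ ⟨a, -, b, -, rfl⟩
    exact ⟨2, (isHomogeneous_x_mul_y _ _).sub (isHomogeneous_x_mul_y _ _)⟩

theorem monoBipartite_isHomog : IsHomog (monoBipartite K A B) :=
  IsHomog.span <| by
    rintro _ (⟨a, -, b, -, rfl⟩ | ⟨b, -, i, -, j, -, -, rfl⟩ | ⟨a, -, i, -, j, -, -, rfl⟩)
    · exact ⟨2, isHomogeneous_x_mul_y _ _⟩
    · exact ⟨3, (isHomogeneous_X _ _).mul (isHomogeneous_x_mul_y _ _)⟩
    · exact ⟨3, (isHomogeneous_X _ _).mul (isHomogeneous_x_mul_y _ _)⟩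

theorem genericBipartite_sup (hAB : ∀ a ∈ A, ∀ b ∈ B, a < b) :
    genericBipartite K A B ⊔ genericIdeal K A ⊔ genericIdeal K B = genericIdeal K (A ∪ B) := by
  refine le_antisymm (sup_le (sup_le (Ideal.span_le.2 ?_)
    (genericIdeal_mono Finset.subset_union_left)) (genericIdeal_mono Finset.subset_union_right))
    (Ideal.span_le.2 ?_)
  · rintro _ ⟨a, ha, b, hb, rfl⟩
    exact binom_mem_genericIdeal (Finset.mem_union_left _ ha) (Finset.mem_union_right _ hb)
      (hAB a ha b hb)
  · rintro _ ⟨i, hi, j, hj, hij, rfl⟩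
    rcases Finset.mem_union.1 hi with hi | hi <;> rcases Finset.mem_union.1 hj with hj | hj
    · exact Ideal.mem_sup_left (Ideal.mem_sup_right (binom_mem_genericIdeal hi hj hij))
    · exact Ideal.mem_sup_left (Ideal.mem_sup_left (binom_mem_genericBipartite hi hj))
    · exact absurd hij (hAB j hj i hi).not_gt
    · exact Ideal.mem_sup_right (binom_mem_genericIdeal hi hj hij)

theorem monoBipartite_sup (hAB : ∀ a ∈ A, ∀ b ∈ B, a < b) :
    monoBipartite K A B ⊔ monoIdeal K A ⊔ monoIdeal K B = monoIdeal K (A ∪ B) := by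
  have hA : monoIdeal K A ≤ monoIdeal K (A ∪ B) := monoIdeal_mono Finset.subset_union_left
  have hB : monoIdeal K B ≤ monoIdeal K (A ∪ B) := monoIdeal_mono Finset.subset_union_right
  refine le_antisymm (sup_le (sup_le (Ideal.span_le.2 ?_) hA) hB) (Ideal.span_le.2 ?_)
  · rintro _ (⟨a, ha, b, hb, rfl⟩ | ⟨b, hb, i, hi, j, hj, hij, rfl⟩ |
      ⟨a, ha, i, hi, j, hj, hij, rfl⟩)
    · exact Ideal.subset_span ⟨a, Finset.mem_union_left _ ha, b, Finset.mem_union_right _ hb,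
        hAB a ha b hb, rfl⟩
    · exact Ideal.mul_mem_left _ _ (hA (Ideal.subset_span ⟨i, hi, j, hj, hij, rfl⟩))
    · exact Ideal.mul_mem_left _ _ (hB (Ideal.subset_span ⟨i, hi, j, hj, hij, rfl⟩))
  · rintro _ ⟨i, hi, j, hj, hij, rfl⟩
    rcases Finset.mem_union.1 hi with hi | hi <;> rcases Finset.mem_union.1 hj with hj | hj
    · exact Ideal.mem_sup_left (Ideal.mem_sup_right (Ideal.subset_span ⟨i, hi, j, hj, hij, rfl⟩))
    · exact Ideal.mem_sup_left (Ideal.mem_sup_left (x_mul_y_mem_monoBipartite hi hj))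
    · exact absurd hij (hAB j hj i hi).not_gt
    · exact Ideal.mem_sup_right (Ideal.subset_span ⟨i, hi, j, hj, hij, rfl⟩)

variable [Fintype V] [Fintype (Vars V)]

theorem isLinear_genericIdeal {W W' : Finset V} (hW : W.Nonempty) (h : Disjoint W W') :
    IsLinear (subq (genericIdeal K W) (vertexIdeal K W' * genericIdeal K W)) 2
      (W.card - 1 + 2 * W'.card) (W.card - 1) := by
  rw [← card_vertexVars W']
  exact ((hasShape_genericIdeal hW).isLinear (noLinearTerms_genericIdeal W)).varIdeal_mul
    (genericIdeal_isHomog W) fun s hs => divStable_genericIdeal (ne_of_mem_vertexVars h hs)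

omit [Fintype V] in
theorem isLinear_monoIdeal {W W' : Finset V} (hW : W.Nonempty) (h : Disjoint W W') :
    IsLinear (subq (monoIdeal K W) (vertexIdeal K W' * monoIdeal K W)) 2
      (W.card - 1 + 2 * W'.card) (W.card - 1) := by
  rw [← card_vertexVars W']
  exact ((hasShape_monoIdeal hW).isLinear (noLinearTerms_monoIdeal W)).varIdeal_mul
    (monoIdeal_isHomog W) fun s hs => divStable_monoIdeal (ne_of_mem_vertexVars h hs)

theorem tor_genericBipartite {m n p : ℕ} (hAB : ∀ a ∈ A, ∀ b ∈ B, a < b) (hA : A.card = m)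
    (hB : B.card = n) (hn : 1 ≤ n) (hmn : n ≤ m) (hp : p = if n = 1 then m else 2 * m + n - 2) :
    (∀ i j, (subq ⊤ (genericBipartite K A B)).tor i j ≠ 0 → i ≤ p ∧ j ≤ i + 2) ∧
    (2 ≤ m → (subq ⊤ (genericBipartite K A B)).tor p (p + 2) =
      (if n = 1 then m - 1 else if m = n then 2 * (n - 1) else n - 1 : ℕ)) ∧
    (m = 1 → (subq ⊤ (genericBipartite K A B)).tor 1 2 ≠ 0) := by
  have hd : Disjoint A B := Finset.disjoint_left.2 fun a ha hb => lt_irrefl a (hAB a ha a hb)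
  have hA' : A.Nonempty := Finset.card_pos.1 (by omega)
  have hB' : B.Nonempty := Finset.card_pos.1 (by omega)
  have h1 := isLinear_genericIdeal (K := K) hA' hd
  have h2 := isLinear_genericIdeal (K := K) hB' hd.symm
  have h3 := hasShape_genericIdeal (K := K) (hA'.mono (Finset.subset_union_left (s₂ := B)))
  rw [Finset.card_union_of_disjoint hd, ← genericBipartite_sup hAB] at h3
  subst hA hB
  refine tor_of_glue hn hmn genericBipartite_isHomog (genericIdeal_isHomog A)
    (genericIdeal_isHomog B) (vertexIdeal_mul_le rfl ?_) (vertexIdeal_mul_le rfl ?_)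
    genericBipartite_le_left genericBipartite_le_right (genericIdeal_le_vertexIdeal A)
    (genericIdeal_inf_vertexIdeal_le hd) (genericIdeal_inf_vertexIdeal_le hd.symm) h1 h2 h3 hp
  · rintro b hb _ ⟨i, hi, j, hj, -, rfl⟩
    exact mul_binom_mem_left hb hi hj
  · rintro a ha _ ⟨i, hi, j, hj, -, rfl⟩
    exact mul_binom_mem_right ha hi hj

omit [Fintype V] in
theorem tor_monoBipartite {m n p : ℕ} (hAB : ∀ a ∈ A, ∀ b ∈ B, a < b) (hA : A.card = m)
    (hB : B.card = n) (hn : 1 ≤ n) (hmn : n ≤ m) (hp : p = if n = 1 then m else 2 * m + n - 2) :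
    (∀ i j, (subq ⊤ (monoBipartite K A B)).tor i j ≠ 0 → i ≤ p ∧ j ≤ i + 2) ∧
    (2 ≤ m → (subq ⊤ (monoBipartite K A B)).tor p (p + 2) =
      (if n = 1 then m - 1 else if m = n then 2 * (n - 1) else n - 1 : ℕ)) ∧
    (m = 1 → (subq ⊤ (monoBipartite K A B)).tor 1 2 ≠ 0) := by
  have hd : Disjoint A B := Finset.disjoint_left.2 fun a ha hb => lt_irrefl a (hAB a ha a hb)
  have hA' : A.Nonempty := Finset.card_pos.1 (by omega)
  have hB' : B.Nonempty := Finset.card_pos.1 (by omega)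
  have h1 := isLinear_monoIdeal (K := K) hA' hd
  have h2 := isLinear_monoIdeal (K := K) hB' hd.symm
  have h3 := hasShape_monoIdeal (K := K) (hA'.mono (Finset.subset_union_left (s₂ := B)))
  rw [Finset.card_union_of_disjoint hd, ← monoBipartite_sup hAB] at h3
  subst hA hB
  refine tor_of_glue hn hmn monoBipartite_isHomog (monoIdeal_isHomog A)
    (monoIdeal_isHomog B) (vertexIdeal_mul_le rfl ?_) (vertexIdeal_mul_le rfl ?_)
    monoBipartite_le_left monoBipartite_le_right (monoIdeal_le_vertexIdeal A)
    (monoIdeal_inf_vertexIdeal_le hd) (monoIdeal_inf_vertexIdeal_le hd.symm) h1 h2 h3 hp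
  · rintro b hb _ ⟨i, hi, j, hj, hij, rfl⟩
    refine ⟨x_mul_mem_monoBipartite hb hi hj hij, ?_⟩
    rw [show y K b * (x K i * y K j) = y K j * (x K i * y K b) by ring]
    exact Ideal.mul_mem_left _ _ (x_mul_y_mem_monoBipartite hi hb)
  · rintro a ha _ ⟨i, hi, j, hj, hij, rfl⟩
    refine ⟨?_, y_mul_mem_monoBipartite ha hi hj hij⟩
    rw [show x K a * (x K i * y K j) = x K i * (x K a * y K j) by ring]
    exact Ideal.mul_mem_left _ _ (x_mul_y_mem_monoBipartite ha hj)

end Bipartite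

/-! ### The lexicographic initial ideal -/

section InitialIdeal

theorem exists_monomial_eq_X_mul {σ : Type} {K : Type u} [Field K] {μ : σ →₀ ℕ} {s : σ}
    (hs : μ s ≠ 0) (c : K) :
    ∃ μ' : σ →₀ ℕ, monomial μ c = X s * monomial μ' c ∧ ∀ t, t ≠ s → μ' t = μ t := by
  refine ⟨μ - Finsupp.single s 1, ?_, fun t ht => by simp [ht.symm]⟩
  rw [X, monomial_mul, one_mul, add_tsub_cancel_of_le]
  rw [Finsupp.single_le_iff]
  omega

variable {V : Type} {K : Type u} [Field K]

theorem exists_monomial_eq_x_mul_y_mul {μ : Vars V →₀ ℕ} {i j : V} (hi : μ (Sum.inlₗ i) ≠ 0)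
    (hj : μ (Sum.inrₗ j) ≠ 0) (c : K) : ∃ μ' : Vars V →₀ ℕ,
      monomial μ c = x K i * y K j * monomial μ' c ∧
        ∀ t, t ≠ Sum.inlₗ i → t ≠ Sum.inrₗ j → μ' t = μ t := by
  obtain ⟨μ₁, h1, h1'⟩ := exists_monomial_eq_X_mul hi c
  rw [← h1' _ (inl_ne_inr _ _).symm] at hj
  obtain ⟨μ₂, h2, h2'⟩ := exists_monomial_eq_X_mul hj c
  exact ⟨μ₂, by rw [h1, h2, mul_assoc]; rfl, fun t ht ht' => by rw [h2' t ht', h1' t ht]⟩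

variable [LinearOrder V]

/-- If `i ∈ A` and `j ∈ B`, then `x_i y_j` is a generator. If both lie in `A`, a factor `y_b` gives
the generator `x_i y_b` and a factor `x_b` the cubic `x_b x_i y_j`; the case of `B` is symmetric.
This explains the cubic generators. -/
theorem monomial_mem_monoBipartite {A B : Finset V} (hAB : ∀ a ∈ A, ∀ b ∈ B, a < b)
    {μ : Vars V →₀ ℕ} (c : K) {i j : V} (hi : i ∈ A ∪ B) (hj : j ∈ A ∪ B) (hij : i < j)
    (hxi : μ (Sum.inlₗ i) ≠ 0) (hyj : μ (Sum.inrₗ j) ≠ 0)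
    (hA : ∃ s ∈ vertexVars A, μ s ≠ 0) (hB : ∃ s ∈ vertexVars B, μ s ≠ 0) :
    monomial μ c ∈ monoBipartite K A B := by
  have key : ∀ {a b : V}, a ∈ A → b ∈ B → μ (Sum.inlₗ a) ≠ 0 → μ (Sum.inrₗ b) ≠ 0 →
      monomial μ c ∈ monoBipartite K A B := by
    intro a b ha hb hxa hyb
    obtain ⟨μ', h, -⟩ := exists_monomial_eq_x_mul_y_mul hxa hyb c
    rw [h]
    exact Ideal.mul_mem_right _ _ (x_mul_y_mem_monoBipartite ha hb)
  obtain ⟨μ', h, h'⟩ := exists_monomial_eq_x_mul_y_mul hxi hyj c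
  rcases Finset.mem_union.1 hi with hi | hi <;> rcases Finset.mem_union.1 hj with hj | hj
  · obtain ⟨s, hs, hμ⟩ := hB
    obtain ⟨b, hb, rfl | rfl⟩ := mem_vertexVars.1 hs
    · rw [← h' _ (fun e => (hAB i hi b hb).ne' (inl_inj.1 e)) (inl_ne_inr _ _)] at hμ
      obtain ⟨μ'', h1, -⟩ := exists_monomial_eq_X_mul hμ c
      rw [h, h1, ← mul_assoc, mul_comm _ (X _)]
      exact Ideal.mul_mem_right _ _ (x_mul_mem_monoBipartite hb hi hj hij)
    · exact key hi hb hxi hμ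
  · exact key hi hj hxi hyj
  · exact absurd hij (hAB j hj i hi).not_gt
  · obtain ⟨s, hs, hμ⟩ := hA
    obtain ⟨a, ha, rfl | rfl⟩ := mem_vertexVars.1 hs
    · exact key ha hj hμ hyj
    · rw [← h' _ (inl_ne_inr _ _).symm (fun e => (hAB a ha j hj).ne (inr_inj.1 e))] at hμ
      obtain ⟨μ'', h1, -⟩ := exists_monomial_eq_X_mul hμ c
      rw [h, h1, ← mul_assoc, mul_comm _ (X _)]
      exact Ideal.mul_mem_right _ _ (y_mul_mem_monoBipartite ha hi hj hij)

variable [Fintype V]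

/-- The ideal lies in the ideal of all minors and in both vertex ideals. So a leading monomial is
divisible by some `x_i y_j` with `i < j` and involves a variable from each part, which puts it in
the monomial ideal. Conversely the generators are leading terms of binomials and of their multiples
by a variable of the other part. -/
theorem initialIdeal_genericBipartite {A B : Finset V} (hAB : ∀ a ∈ A, ∀ b ∈ B, a < b) :
    initialIdeal (genericBipartite K A B) = monoBipartite K A B := by
  refine le_antisymm (Ideal.span_le.2 ?_) (Ideal.span_le.2 ?_)
  · rintro _ ⟨f, hf, rfl⟩
    rw [SetLike.mem_coe] at hf
    rcases eq_or_ne f 0 with rfl | h0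
    · rw [MonomialOrder.leadingTerm_zero]
      exact zero_mem _
    have h1 : genericBipartite K A B ≤ genericIdeal K (A ∪ B) := by
      rw [← genericBipartite_sup hAB]
      exact le_sup_left.trans le_sup_left
    obtain ⟨i, hi, j, hj, hij, hxi, hyj⟩ :=
      exists_lt_of_toricMap_eq_zero (toricMap_eq_zero_of_mem (h1 hf)) h0
    have hμ := MonomialOrder.lex.degree_mem_support h0
    exact monomial_mem_monoBipartite hAB _ hi hj hij hxi hyj
      (mem_varIdeal.1 (genericBipartite_le_left hf) _ hμ)
      (mem_varIdeal.1 (genericBipartite_le_right hf) _ hμ)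
  · have hX : ∀ s : Vars V, MonomialOrder.lex.leadingTerm (X s : PolyRing K V) = X s := fun s =>
      MonomialOrder.lex.leadingTerm_monomial _ _
    rintro _ (⟨a, ha, b, hb, rfl⟩ | ⟨b, hb, i, hi, j, hj, hij, rfl⟩ |
      ⟨a, ha, i, hi, j, hj, hij, rfl⟩) <;> refine Ideal.subset_span ?_
    · exact ⟨_, binom_mem_genericBipartite ha hb, leadingTerm_binom (hAB a ha b hb)⟩
    · exact ⟨_, (mul_binom_mem_left hb hi hj).1,
        by rw [MonomialOrder.leadingTerm_mul, leadingTerm_binom hij, x, hX]⟩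
    · exact ⟨_, (mul_binom_mem_right ha hi hj).2,
        by rw [MonomialOrder.leadingTerm_mul, leadingTerm_binom hij, y, hX]⟩

end InitialIdeal

/-! ### Identification with the graph `completeBipartite m n` -/

section CompleteBipartite

theorem castAdd_lt_natAdd {m n : ℕ} (i : Fin m) (j : Fin n) : Fin.castAdd n i < Fin.natAdd m j := by
  rw [Fin.lt_def, Fin.val_castAdd, Fin.val_natAdd]
  omega

variable (K : Type u) [Field K] (m n : ℕ)

/-- The first part of the vertex set. -/
abbrev leftPart : Finset (Fin (m + n)) := Finset.univ.image (Fin.castAdd n)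

/-- The second part of the vertex set. -/
abbrev rightPart : Finset (Fin (m + n)) := Finset.univ.image (Fin.natAdd m)

theorem leftPart_lt_rightPart : ∀ a ∈ leftPart m n, ∀ b ∈ rightPart m n, a < b := by
  intro a ha b hb
  obtain ⟨i, -, rfl⟩ := Finset.mem_image.1 ha
  obtain ⟨j, -, rfl⟩ := Finset.mem_image.1 hb
  exact castAdd_lt_natAdd i j

theorem card_leftPart : (leftPart m n).card = m := by
  rw [Finset.card_image_of_injective _ (Fin.castAdd_injective m n), Finset.card_univ,
    Fintype.card_fin]

theorem card_rightPart : (rightPart m n).card = n := by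
  rw [Finset.card_image_of_injective _ (Fin.natAdd_injective n m), Finset.card_univ,
    Fintype.card_fin]

theorem binomialEdgeIdeal_completeBipartite :
    binomialEdgeIdeal K (completeBipartite m n) =
      genericBipartite K (leftPart m n) (rightPart m n) := by
  refine congrArg Ideal.span (Set.ext fun f => ?_)
  constructor
  · rintro ⟨i, j, hij, hadj, rfl⟩
    rw [completeBipartite, SimpleGraph.map_adj] at hadj
    obtain ⟨v, w, hvw, rfl, rfl⟩ := hadj
    rcases v with v | v <;> rcases w with w | w
    · simp at hvw
    · exact ⟨_, Finset.mem_image_of_mem _ (Finset.mem_univ v), _,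
        Finset.mem_image_of_mem _ (Finset.mem_univ w), rfl⟩
    -- The condition `i < j` rules out an edge listed from the second part to the first.
    · exact absurd hij (castAdd_lt_natAdd w v).not_gt
    · simp at hvw
  · rintro ⟨a, ha, b, hb, rfl⟩
    refine ⟨a, b, leftPart_lt_rightPart m n a ha b hb, ?_, rfl⟩
    obtain ⟨i, -, rfl⟩ := Finset.mem_image.1 ha
    obtain ⟨j, -, rfl⟩ := Finset.mem_image.1 hb
    rw [completeBipartite, SimpleGraph.map_adj]
    exact ⟨Sum.inl i, Sum.inr j, by simp, rfl, rfl⟩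

end CompleteBipartite

/-! ### Reading off extremal Betti numbers and projective dimension -/

section Extremal

variable {σ : Type} {K : Type u} [Field K] [Fintype σ] [LinearOrder σ]

/-- All nonzero entries lie in the rectangle of columns at most `p` and rows at most 2, and its
corner is nonzero, so it dominates every other entry. -/
theorem isExtremalBetti_iff_of_tor {I : Ideal (MvPolynomial σ K)} (hI : IsHomog I) {p : ℕ}
    (h1 : ∀ i j, (subq ⊤ I).tor i j ≠ 0 → i ≤ p ∧ j ≤ i + 2)
    (h2 : (subq ⊤ I).tor p (p + 2) ≠ 0) (i j : ℕ) :
    IsExtremalBetti (bettiQuotient I) i j ↔ i = p ∧ j = 2 := by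
  have h1' : ∀ i j, bettiQuotient I i j ≠ 0 → i ≤ p ∧ j ≤ i + 2 := fun i j h =>
    h1 i j (by rw [← bettiQuotient_eq hI]; exact_mod_cast h)
  have h2' : bettiQuotient I p (p + 2) ≠ 0 := by
    rw [← bettiQuotient_eq hI] at h2
    exact_mod_cast h2
  constructor
  · rintro ⟨h3, h4⟩
    have h5 := h1' _ _ h3
    by_contra h6
    exact h2' (h4 p 2 h5.1 (by omega) (by rw [ne_eq, Prod.mk.injEq]; omega))
  · rintro ⟨rfl, rfl⟩
    refine ⟨h2', fun k l hk hl hne => ?_⟩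
    by_contra h3
    have h4 := h1' _ _ h3
    exact hne (Prod.ext (by simp only; omega) (by simp only; omega))

/-- The conclusions drawn from the shape of the Betti table. -/
theorem projdim_of_tor {I : Ideal (MvPolynomial σ K)} (hI : IsHomog I) {m p b : ℕ} (hp : p ≠ 0)
    (hb : 2 ≤ m → b ≠ 0) (hm : 1 ≤ m)
    (h1 : ∀ i j, (subq ⊤ I).tor i j ≠ 0 → i ≤ p ∧ j ≤ i + 2)
    (h2 : 2 ≤ m → (subq ⊤ I).tor p (p + 2) = (b : ℕ))
    (h3 : m = 1 → (subq ⊤ I).tor p (p + 1) ≠ 0) :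
    projdim (MvPolynomial σ K) (MvPolynomial σ K ⧸ I) = (p : ℕ∞) := by
  have h4 : ∀ j, (subq ⊤ I).tor (p + 1) j = 0 := by
    intro j
    by_contra h
    have := h1 _ _ h
    omega
  rcases eq_or_ne m 1 with hm1 | hm1
  -- For `m = 1` row 2 is empty and the projective dimension is attained in row 1.
  · exact projdim_quotient hI hp (h3 hm1) h4
  · refine projdim_quotient hI hp (j := p + 2) ?_ h4
    rw [h2 (by omega)]
    exact_mod_cast hb (by omega)

end Extremal

end BinomialEdge

theorem mainTheorem3 {K : Type*} [Field K] (m n p b : ℕ) (hn : 1 ≤ n) (hmn : n ≤ m)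
    (hp : p = if n = 1 then m else 2 * m + n - 2)
    (hb : b = if n = 1 then m - 1 else if m = n then 2 * (n - 1) else n - 1)
    (J I : Ideal (BinomialEdge.PolyRing K (Fin (m + n))))
    (hJ : J = BinomialEdge.binomialEdgeIdeal K (BinomialEdge.completeBipartite m n))
    (hI : I = BinomialEdge.initialIdeal J) :
    -- projective dimensions
    (BinomialEdge.projdim (BinomialEdge.PolyRing K (Fin (m + n)))
        (BinomialEdge.PolyRing K (Fin (m + n)) ⧸ I) = (p : ℕ∞) ∧
      BinomialEdge.projdim (BinomialEdge.PolyRing K (Fin (m + n))) I + 1 = (p : ℕ∞) ∧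
      BinomialEdge.projdim (BinomialEdge.PolyRing K (Fin (m + n)))
        (BinomialEdge.PolyRing K (Fin (m + n)) ⧸ J) = (p : ℕ∞)) ∧
    -- the unique extremal Betti number
    (2 ≤ m →
      ((∀ i j, BinomialEdge.IsExtremalBetti (BinomialEdge.bettiQuotient I) i j ↔
          i = p ∧ j = 2) ∧
        BinomialEdge.bettiQuotient I p (p + 2) = b ∧
        BinomialEdge.bettiIdeal I (p - 1) (p + 2) = b) ∧
      ((∀ i j, BinomialEdge.IsExtremalBetti (BinomialEdge.bettiQuotient J) i j ↔
          i = p ∧ j = 2) ∧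
        BinomialEdge.bettiQuotient J p (p + 2) = b)) := by
  classical
  let _ : Fintype (BinomialEdge.Vars (Fin (m + n))) := Fintype.ofFinite _
  have hAB := BinomialEdge.leftPart_lt_rightPart m n
  have hA := BinomialEdge.card_leftPart m n
  have hB := BinomialEdge.card_rightPart m n
  have hJ' := hJ.trans (BinomialEdge.binomialEdgeIdeal_completeBipartite K m n)
  have hI' : I = BinomialEdge.monoBipartite K (BinomialEdge.leftPart m n)
      (BinomialEdge.rightPart m n) := by
    rw [hI, hJ', BinomialEdge.initialIdeal_genericBipartite hAB]
  obtain ⟨g1, g2, g3⟩ := BinomialEdge.tor_genericBipartite (K := K) hAB hA hB hn hmn hp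
  obtain ⟨i1, i2, i3⟩ := BinomialEdge.tor_monoBipartite (K := K) hAB hA hB hn hmn hp
  have hJh : BinomialEdge.IsHomog J := hJ' ▸ BinomialEdge.genericBipartite_isHomog
  have hIh : BinomialEdge.IsHomog I := hI' ▸ BinomialEdge.monoBipartite_isHomog
  rw [← hJ'] at g1 g2 g3
  rw [← hI'] at i1 i2 i3
  rw [← hb] at g2 i2
  have hp0 : p ≠ 0 := by split_ifs at hp <;> omega
  have hp1 : m = 1 → p = 1 := by intro h; split_ifs at hp <;> omega
  have hb0 : 2 ≤ m → b ≠ 0 := by intro h; split_ifs at hb <;> omega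
  have hIdim := BinomialEdge.projdim_of_tor hIh hp0 hb0 (hn.trans hmn) i1 i2
    fun h => by rw [hp1 h]; exact i3 h
  refine ⟨⟨hIdim, BinomialEdge.projdim_ideal_add_one hp0 hIdim,
    BinomialEdge.projdim_of_tor hJh hp0 hb0 (hn.trans hmn) g1 g2
      fun h => by rw [hp1 h]; exact g3 h⟩, fun hm => ⟨⟨?_, ?_, ?_⟩, ?_, ?_⟩⟩
  · refine BinomialEdge.isExtremalBetti_iff_of_tor hIh i1 ?_
    rw [i2 hm]
    exact_mod_cast hb0 hm
  · have := (BinomialEdge.bettiQuotient_eq hIh p (p + 2)).trans (i2 hm)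
    exact_mod_cast this
  · have := BinomialEdge.bettiIdeal_eq hIh (p - 1) (p + 2) (Or.inr (Nat.succ_ne_zero _))
    rw [Nat.sub_add_cancel (Nat.one_le_iff_ne_zero.2 hp0), i2 hm] at this
    exact_mod_cast this
  · refine BinomialEdge.isExtremalBetti_iff_of_tor hJh g1 ?_
    rw [g2 hm]
    exact_mod_cast hb0 hm
  · have := (BinomialEdge.bettiQuotient_eq hJh p (p + 2)).trans (g2 hm)
    exact_mod_cast this
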